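/- For a graph $H$ and an integer $k\ge 1$, let $gr_k(K_3:H)$ denote the minimum integer $m$ such that every coloring of the edges of the complete graph $K_m$ with $k$ available colors (not all of which need to be used) contains either a rainbow triangle (a triangle whose three edges have pairwise different colors) or a monochromatic copy of $H$, that is, a not necessarily induced subgraph isomorphic to $H$ all of whose edges have the same color. For $t\ge 3$, let $P_t^+$ denote the graph obtained from the path $v_1v_2\cdots v_t$ on $t$ vertices by adding the edge $v_1v_3$. Then for all integers $t\ge 4$ and $k\ge 1$, $$ gr_k(K_3:P_t^+)=\begin{cases} 2(t-1)\cdot 5^{\frac{k-2}{2}}+1 & \text{if } k \text{ is even},\\ (t-1)\cdot 5^{\frac{k-1}{2}}+1 & \text{if } k \text{ is odd}. \end{cases} $$ -/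

import Mathlib

/-- The path on the `t` vertices `0, 1, …, t - 1` (in this order) together with the edge joining
the end `0` to the vertex `2` at distance two along the path. Meaningful for `3 ≤ t`. -/
def pathPlus (t : ℕ) : SimpleGraph (Fin t) :=
  SimpleGraph.pathGraph t ⊔ SimpleGraph.fromRel (fun i j => i.val = 0 ∧ j.val = 2)

/-- The edge-coloured complete graph `C` contains a (not necessarily induced) copy of `G` whose
edges receive pairwise distinct colours. -/
def HasRainbowCopy {V K W : Type*} (C : SimpleGraph.TopEdgeLabeling V K)
    (G : SimpleGraph W) : Prop :=
  ∃ f : SimpleGraph.Copy G (⊤ : SimpleGraph V),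
    Function.Injective (fun e : G.edgeSet => C (f.toHom.mapEdgeSet e))

/-- The edge-coloured complete graph `C` contains a (not necessarily induced) copy of `H` whose
edges all have the same colour. -/
def HasMonochromaticCopy {V K W : Type*} (C : SimpleGraph.TopEdgeLabeling V K)
    (H : SimpleGraph W) : Prop :=
  ∃ c : K, SimpleGraph.IsContained H (C.labelGraph c)

/-- `m` is the Gallai-Ramsey number `gr_k(G : H)`: the least number of vertices such that every
edge colouring of the complete graph with colours from a `k`-element set contains a rainbow copy
of `G` or a monochromatic copy of `H`. -/
def IsGallaiRamseyNumber {U W : Type*} (k : ℕ) (G : SimpleGraph U) (H : SimpleGraph W)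
    (m : ℕ) : Prop :=
  IsLeast {n : ℕ | ∀ C : SimpleGraph.TopEdgeLabeling (Fin n) (Fin k),
    HasRainbowCopy C G ∨ HasMonochromaticCopy C H} m

/-!
Write `u = t - 1` and `s = u / 2`. A monochromatic complete bipartite graph with more than `s`
vertices on both sides, together with a triangle in the same component of its colour, contains a
tailed triangle on `2 * s + 2 ≥ t` vertices: an edge or a path joins the triangle to the bipartite
graph, which is then traversed. A colouring without rainbow triangles has, by Gallai's theorem, a
partition into homogeneous parts between which only two colours occur. So the parts can only be
large in a few ways, each of which forces a colour to disappear from the large parts.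

For at least three colours this is applied not to the whole vertex set `W` but to a minimal
homogeneous set `A` which at most `s` outside vertices join in each colour. As `A` misses only a few
vertices of `W`, it suffices that the two or five large parts of `A` are bounded by induction. Where
the induction hypothesis is tight, the outside vertices are accommodated by recolouring: those which
do not distinguish the vertices of two large parts are added to one of them. All edges between such
a vertex and that part receive the colour which it sends to the parts, and a path through recoloured
edges can be rerouted through the other part, so that no tailed triangles arise.

For the lower bound, `5` copies of an extremal colouring with `k` colours are placed on the vertices
of a `5`-cycle whose edges and diagonals receive two new colours.
-/

/-- A colouring of the pairs of elements of `V`. The values on the diagonal are irrelevant; they are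
only there so that the colour of a pair can be written down without a proof that it is a pair. -/
structure PairColoring (V κ : Type*) where
  toFun : V → V → κ
  symm : ∀ x y, toFun x y = toFun y x

namespace PairColoring

instance (V κ : Type*) : CoeFun (PairColoring V κ) fun _ => V → V → κ := ⟨toFun⟩

open scoped Classical

variable {V κ : Type*} {C : PairColoring V κ} {c : κ} {A B X Y : Finset V} {m n s u : ℕ}
  {v w x y z : V} {l : List V}

section Paths

/-- Adjacency in the graph of colour `c` on `A`. -/
structure Adj (C : PairColoring V κ) (c : κ) (A : Finset V) (x y : V) : Prop where
  left_mem : x ∈ A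
  right_mem : y ∈ A
  ne : x ≠ y
  color : C x y = c

/-- Being in the same component of the graph of colour `c` on `A`. -/
def Reachable (C : PairColoring V κ) (c : κ) (A : Finset V) : V → V → Prop :=
  Relation.ReflTransGen (C.Adj c A)

/-- A path of colour `c` in `A`, as the list of its vertices. -/
structure IsPath (C : PairColoring V κ) (c : κ) (A : Finset V) (l : List V) : Prop where
  nodup : l.Nodup
  mem : ∀ v ∈ l, v ∈ A
  isChain : l.IsChain (C · · = c)

/-- A triangle of colour `c` in `A`. -/
structure IsTriangle (C : PairColoring V κ) (c : κ) (A : Finset V) (x y z : V) : Prop where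
  adj₁₂ : C.Adj c A x y
  adj₁₃ : C.Adj c A x z
  adj₂₃ : C.Adj c A y z

/-- A copy of the graph `pathPlus` of colour `c` in `A`, as the list of its vertices: a triangle,
made of the first three of them, with a tail. -/
def IsTailedTriangle (C : PairColoring V κ) (c : κ) (A : Finset V) (l : List V) : Prop :=
  C.IsPath c A l ∧ ∃ x y z l', l = x :: y :: z :: l' ∧ C x z = c

/-- The existence of a tailed triangle of colour `c` in `A` on at least `m` vertices. -/
def HasTailedTriangle (C : PairColoring V κ) (c : κ) (A : Finset V) (m : ℕ) : Prop :=
  ∃ l, C.IsTailedTriangle c A l ∧ m ≤ l.length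

theorem Adj.symm (h : C.Adj c A x y) : C.Adj c A y x :=
  ⟨h.right_mem, h.left_mem, h.ne.symm, by rw [C.symm, h.color]⟩

theorem Adj.mono (h : C.Adj c A x y) (hAB : A ⊆ B) : C.Adj c B x y :=
  ⟨hAB h.left_mem, hAB h.right_mem, h.ne, h.color⟩

theorem Reachable.symm (h : C.Reachable c A x y) : C.Reachable c A y x :=
  haveI : Std.Symm (C.Adj c A) := ⟨fun _ _ => Adj.symm⟩
  Relation.ReflTransGen.stdSymm.symm _ _ h

theorem Reachable.mono (h : C.Reachable c A x y) (hAB : A ⊆ B) : C.Reachable c B x y :=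
  Relation.ReflTransGen.mono (fun _ _ hab => Adj.mono hab hAB) _ _ h

theorem IsTriangle.mono (h : C.IsTriangle c A x y z) (hAB : A ⊆ B) : C.IsTriangle c B x y z :=
  ⟨h.adj₁₂.mono hAB, h.adj₁₃.mono hAB, h.adj₂₃.mono hAB⟩

theorem IsTriangle.rotate (h : C.IsTriangle c A x y z) : C.IsTriangle c A y z x :=
  ⟨h.adj₂₃, h.adj₁₂.symm, h.adj₁₃.symm⟩

theorem isPath_singleton : C.IsPath c A [v] ↔ v ∈ A :=
  ⟨fun h => h.mem v (by simp), fun h => ⟨by simp, by simpa, by simp⟩⟩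

theorem isPath_cons_cons : C.IsPath c A (v :: w :: l) ↔
    v ∈ A ∧ v ∉ w :: l ∧ C v w = c ∧ C.IsPath c A (w :: l) := by
  constructor
  · rintro ⟨hnd, hA, hc⟩
    rw [List.isChain_cons_cons] at hc
    exact ⟨hA v (by simp), hnd.notMem, hc.1, hnd.of_cons,
      fun x hx => hA x (List.mem_cons_of_mem v hx), hc.2⟩
  · rintro ⟨hv, hvl, hc, hl⟩
    exact ⟨List.nodup_cons.mpr ⟨hvl, hl.nodup⟩, List.forall_mem_cons.mpr ⟨hv, hl.mem⟩,
      hl.isChain.cons_cons hc⟩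

theorem IsPath.of_mem (h : C.IsPath c A l) (hl : ∀ v ∈ l, v ∈ B) : C.IsPath c B l :=
  ⟨h.nodup, hl, h.isChain⟩

theorem IsPath.mono (h : C.IsPath c A l) (hAB : A ⊆ B) : C.IsPath c B l :=
  h.of_mem fun v hv => hAB (h.mem v hv)

theorem IsPath.infix {l' : List V} (h : C.IsPath c A l) (hl : l' <:+: l) : C.IsPath c A l' :=
  ⟨h.nodup.sublist hl.sublist, fun v hv => h.mem v (hl.subset hv), h.isChain.infix hl⟩

theorem IsPath.append {p q : List V} (hp : C.IsPath c A (p ++ [w])) (hq : C.IsPath c A (w :: q))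
    (hpq : ∀ v ∈ p, v ∉ q) : C.IsPath c A (p ++ w :: q) := by
  induction p with
  | nil => exact hq
  | cons v p ih =>
    have hv : v ∉ p ++ w :: q := by
      have := hp.nodup.notMem
      have := hpq v (by simp)
      simp_all
    have htail := ih (hp.infix (List.suffix_cons v _).isInfix)
      fun w hw => hpq w (List.mem_cons_of_mem v hw)
    cases p with
    | nil => exact isPath_cons_cons.mpr ⟨hp.mem v (by simp), hv, (isPath_cons_cons.mp hp).2.2.1, hq⟩
    | cons _ _ =>
      exact isPath_cons_cons.mpr ⟨hp.mem v (by simp), hv, (isPath_cons_cons.mp hp).2.2.1, htail⟩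

theorem Reachable.exists_isPath (h : C.Reachable c A v w) (hw : w ∈ A) :
    ∃ l, C.IsPath c A l ∧ l.head? = some v ∧ l.getLast? = some w := by
  induction h using Relation.ReflTransGen.head_induction_on with
  | refl => exact ⟨[w], isPath_singleton.mpr hw, rfl, rfl⟩
  | @head v x hvx _ ih =>
    obtain ⟨l, hl, hxl, hwl⟩ := ih
    by_cases hv : v ∈ l
    · obtain ⟨p, q, rfl⟩ := List.append_of_mem hv
      exact ⟨v :: q, hl.infix (List.suffix_append p _).isInfix, rfl, by
        rwa [List.getLast?_append_cons] at hwl⟩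
    · obtain ⟨l, rfl⟩ := List.head?_eq_some_iff.mp hxl
      exact ⟨v :: x :: l, isPath_cons_cons.mpr ⟨hvx.left_mem, hv, hvx.color, hl⟩, rfl, by
        rwa [List.getLast?_cons_cons]⟩

theorem exists_eq_append_cons_forall_not {P : V → Prop} (h : ∃ v ∈ l, P v) :
    ∃ p v q, l = p ++ v :: q ∧ P v ∧ ∀ w ∈ p, ¬ P w := by
  obtain ⟨v, hv⟩ := Option.isSome_iff_exists.mp
    (List.find?_isSome (p := fun v => decide (P v)).mpr (by simpa using h))
  obtain ⟨hPv, p, q, rfl, hp⟩ := List.find?_eq_some_iff_append.mp hv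
  exact ⟨p, v, q, rfl, by simpa using hPv, by simpa using hp⟩

theorem Reachable.exists_isPath_between {S T : Finset V} (h : C.Reachable c A v w) (hw : w ∈ A)
    (hvT : v ∈ T) (hwS : w ∈ S) :
    ∃ p e, C.IsPath c A (p ++ [e]) ∧ e ∈ S ∧ (∀ a ∈ p, a ∉ S) ∧
      ∃ t m, p ++ [e] = t :: m ∧ t ∈ T ∧ ∀ a ∈ m, a ∉ T := by
  obtain ⟨l, hl, hvl, hwl⟩ := h.exists_isPath hw
  obtain ⟨p, e, q, rfl, heS, hpS⟩ :=
    exists_eq_append_cons_forall_not ⟨w, List.mem_of_getLast? hwl, hwS⟩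
  have hvp : v ∈ p ++ [e] := by cases p <;> simp_all
  obtain ⟨m, t, r, hm, htT, hmT⟩ :=
    exists_eq_append_cons_forall_not (l := (p ++ [e]).reverse) ⟨v, List.mem_reverse.mpr hvp, hvT⟩
  have hpe : p ++ [e] = r.reverse ++ t :: m.reverse := by simpa using congrArg List.reverse hm
  have hsuffix : t :: m.reverse <:+ p ++ [e] := ⟨r.reverse, hpe.symm⟩
  obtain ⟨p', hp'⟩ : ∃ p', p' ++ [e] = t :: m.reverse := by
    have hlast : (t :: m.reverse).getLast? = some e := by
      rw [← List.getLast?_append_cons r.reverse, ← hpe, List.getLast?_concat]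
    exact (List.getLast?_eq_some_iff.mp hlast).imp fun _ => Eq.symm
  have hp'p : p' <:+ p := List.suffix_append_self_iff.mp (hp' ▸ hsuffix)
  exact ⟨p', e, hp' ▸ hl.infix (hsuffix.isInfix.trans ⟨[], q, by simp⟩), heS,
    fun a ha => hpS a (hp'p.subset ha), t, m.reverse, hp', htT, by simpa using hmT⟩

theorem IsPath.isTailedTriangle (hp : C.IsPath c A (z :: l)) (ht : C.IsTriangle c A x y z)
    (hx : x ∉ l) (hy : y ∉ l) : C.IsTailedTriangle c A (x :: y :: z :: l) := by
  have hyz : C.IsPath c A (y :: z :: l) := isPath_cons_cons.mpr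
    ⟨ht.adj₂₃.left_mem, by simp [ht.adj₂₃.ne, hy], ht.adj₂₃.color, hp⟩
  exact ⟨isPath_cons_cons.mpr ⟨ht.adj₁₂.left_mem, by simp [ht.adj₁₂.ne, ht.adj₁₃.ne, hx],
    ht.adj₁₂.color, hyz⟩, x, y, z, l, rfl, ht.adj₁₃.color⟩

theorem IsTriangle.isTailedTriangle (h : C.IsTriangle c A x y z) :
    C.IsTailedTriangle c A [x, y, z] :=
  (isPath_singleton.mpr h.adj₁₃.right_mem).isTailedTriangle h (by simp) (by simp)

theorem IsTailedTriangle.isTriangle (h : C.IsTailedTriangle c A (x :: y :: z :: l)) :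
    C.IsTriangle c A x y z := by
  obtain ⟨hp, _, _, _, _, heq, hxz⟩ := h
  obtain ⟨hx, hxl, hxy, hp⟩ := isPath_cons_cons.mp hp
  obtain ⟨hy, hyl, hyz, hp⟩ := isPath_cons_cons.mp hp
  simp only [List.cons.injEq] at heq
  obtain ⟨rfl, rfl, rfl, rfl⟩ := heq
  have hz := hp.mem _ List.mem_cons_self
  simp only [List.mem_cons, not_or] at hxl hyl
  exact ⟨⟨hx, hy, hxl.1, hxy⟩, ⟨hx, hz, hxl.2.1, hxz⟩, ⟨hy, hz, hyl.1, hyz⟩⟩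

theorem IsTailedTriangle.concat (h : C.IsTailedTriangle c A (l ++ [v])) (hvw : C.Adj c A v w)
    (hw : w ∉ l) : C.IsTailedTriangle c A (l ++ [v, w]) := by
  obtain ⟨hp, x, y, z, l', hl', hxz⟩ := h
  have hvw' : C.IsPath c A [v, w] := isPath_cons_cons.mpr
    ⟨hvw.left_mem, by simpa using hvw.ne, hvw.color, isPath_singleton.mpr hvw.right_mem⟩
  refine ⟨hp.append hvw' ?_, x, y, z, l' ++ [w], by simpa using congrArg (· ++ [w]) hl', hxz⟩
  rintro a ha haw
  exact hw (List.mem_singleton.mp haw ▸ ha)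

theorem HasTailedTriangle.mono (h : C.HasTailedTriangle c A m) (hAB : A ⊆ B) (hn : n ≤ m) :
    C.HasTailedTriangle c B n := by
  obtain ⟨l, ⟨hp, hl⟩, hm⟩ := h
  exact ⟨l, ⟨hp.mono hAB, hl⟩, hn.trans hm⟩

theorem IsTailedTriangle.ne_nil (h : C.IsTailedTriangle c A l) : l ≠ [] := by
  obtain ⟨-, x, y, z, l', rfl, -⟩ := h
  simp

theorem IsTriangle.hasTailedTriangle_of_degree (h : C.IsTriangle c A x y z)
    (hdeg : ∀ v ∈ A, u ≤ (A.filter (C.Adj c A v)).card) : C.HasTailedTriangle c A (u + 1) := by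
  suffices hgrow : ∀ m ≤ u + 1, C.HasTailedTriangle c A m from hgrow _ le_rfl
  intro m hm
  induction m with
  | zero => exact ⟨_, h.isTailedTriangle, Nat.zero_le _⟩
  | succ m ih =>
    obtain ⟨l, hl, hlm⟩ := ih (by omega)
    obtain ⟨l, v, rfl⟩ := l.eq_nil_or_concat'.resolve_left hl.ne_nil
    rw [List.length_append, List.length_singleton] at hlm
    by_cases hnbrs : A.filter (C.Adj c A v) ⊆ l.toFinset
    · have := (hdeg v (hl.1.mem v (by simp))).trans
        ((Finset.card_le_card hnbrs).trans l.toFinset_card_le)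
      exact ⟨l ++ [v], hl, by rw [List.length_append, List.length_singleton]; omega⟩
    · obtain ⟨w, hw, hwl⟩ := Finset.not_subset.mp hnbrs
      exact ⟨l ++ [v, w], hl.concat (Finset.mem_filter.mp hw).2 (mt List.mem_toFinset.mpr hwl),
        by simpa using hlm⟩

end Paths

section Bicliques

/-- Disjoint subsets `X` and `Y` of `A` with at least `n` vertices each, all pairs between which
have colour `c`. -/
structure IsBiclique (C : PairColoring V κ) (c : κ) (A : Finset V) (n : ℕ) (X Y : Finset V) :
    Prop where
  left_subset : X ⊆ A
  right_subset : Y ⊆ A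
  disjoint : Disjoint X Y
  color : ∀ x ∈ X, ∀ y ∈ Y, C x y = c
  le_card_left : n ≤ X.card
  le_card_right : n ≤ Y.card

theorem IsBiclique.symm (h : C.IsBiclique c A n X Y) : C.IsBiclique c A n Y X :=
  ⟨h.right_subset, h.left_subset, h.disjoint.symm,
    fun y hy x hx => by rw [C.symm, h.color x hx y hy], h.le_card_right, h.le_card_left⟩

theorem IsBiclique.adj (h : C.IsBiclique c A n X Y) (hx : x ∈ X) (hy : y ∈ Y) : C.Adj c A x y :=
  ⟨h.left_subset hx, h.right_subset hy, fun e => Finset.disjoint_left.mp h.disjoint hx (e ▸ hy),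
    h.color x hx y hy⟩

theorem IsBiclique.mono {X' Y' : Finset V} (h : C.IsBiclique c A n X Y) (hX : X' ⊆ X) (hY : Y' ⊆ Y)
    (hXm : m ≤ X'.card) (hYm : m ≤ Y'.card) : C.IsBiclique c A m X' Y' :=
  ⟨hX.trans h.left_subset, hY.trans h.right_subset,
    Finset.disjoint_of_subset_left hX (Finset.disjoint_of_subset_right hY h.disjoint),
    fun x hx y hy => h.color x (hX hx) y (hY hy), hXm, hYm⟩

theorem IsBiclique.mono_set (h : C.IsBiclique c A n X Y) (hAB : A ⊆ B) : C.IsBiclique c B n X Y :=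
  { h with left_subset := h.left_subset.trans hAB, right_subset := h.right_subset.trans hAB }

theorem IsBiclique.erase (h : C.IsBiclique c A (n + 1) X Y) (x y : V) :
    C.IsBiclique c A n (X.erase x) (Y.erase y) :=
  h.mono (X.erase_subset x) (Y.erase_subset y)
    (le_trans (Nat.le_sub_one_of_lt h.le_card_left) X.pred_card_le_card_erase)
    (le_trans (Nat.le_sub_one_of_lt h.le_card_right) Y.pred_card_le_card_erase)

theorem IsBiclique.exists_isPath (h : C.IsBiclique c A (n + 1) X Y) (hv : v ∈ X) :
    ∃ l, C.IsPath c (X ∪ Y) (v :: l) ∧ l.length + 1 = 2 * (n + 1) := by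
  induction n generalizing X Y v with
  | zero =>
    obtain ⟨w, hw⟩ := Finset.card_pos.mp h.le_card_right
    have hvw := h.adj hv hw
    exact ⟨[w], isPath_cons_cons.mpr ⟨Finset.mem_union_left _ hv, by simpa using hvw.ne, hvw.color,
      isPath_singleton.mpr (Finset.mem_union_right _ hw)⟩, rfl⟩
  | succ n ih =>
    obtain ⟨w, hw⟩ := Finset.card_pos.mp (Nat.zero_lt_succ _ |>.trans_le h.le_card_right)
    have herase := h.erase v w
    obtain ⟨v', hv'⟩ := Finset.card_pos.mp (Nat.zero_lt_succ _ |>.trans_le herase.le_card_left)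
    obtain ⟨l, hl, hlen⟩ := ih herase hv'
    have hvw := h.adj hv hw
    have hv'w := h.adj (Finset.mem_of_mem_erase hv') hw
    have hvl : v ∉ v' :: l := fun hmem => by
      have := hl.mem v hmem
      simp [Finset.disjoint_left.mp h.disjoint hv] at this
    have hwl : w ∉ v' :: l := fun hmem => by
      have := hl.mem w hmem
      simp [Finset.disjoint_right.mp h.disjoint hw] at this
    have hl' := hl.mono (Finset.union_subset_union (X.erase_subset v) (Y.erase_subset w))
    exact ⟨w :: v' :: l, isPath_cons_cons.mpr ⟨Finset.mem_union_left _ hv,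
      List.not_mem_cons_of_ne_of_not_mem hvw.ne hvl, hvw.color, isPath_cons_cons.mpr
      ⟨Finset.mem_union_right _ hw, hwl, hv'w.symm.color, hl'⟩⟩, by
      simp only [List.length_cons]; omega⟩

theorem IsBiclique.hasTailedTriangle_of_adj (h : C.IsBiclique c A n X Y) (hn : 2 ≤ n) (hx : x ∈ X)
    (hy : y ∈ X) (hxy : C.Adj c A x y) : C.HasTailedTriangle c A (2 * n) := by
  obtain ⟨n, rfl⟩ := Nat.exists_eq_add_of_le' hn
  obtain ⟨w, hw⟩ := Finset.card_pos.mp (Nat.zero_lt_succ _ |>.trans_le h.le_card_right)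
  obtain ⟨l, hl, hlen⟩ := (h.erase x w).exists_isPath (Finset.mem_erase.mpr ⟨hxy.ne.symm, hy⟩)
  have hlA := hl.mono (Finset.union_subset (h.erase x w).left_subset (h.erase x w).right_subset)
  refine ⟨x :: w :: y :: l, hlA.isTailedTriangle ⟨h.adj hx hw, hxy, (h.adj hy hw).symm⟩
    (fun hmem => ?_) fun hmem => ?_, by simp; omega⟩
  · have := hl.mem x (List.mem_cons_of_mem y hmem)
    simp [Finset.disjoint_left.mp h.disjoint hx] at this
  · have := hl.mem w (List.mem_cons_of_mem y hmem)
    simp [Finset.disjoint_right.mp h.disjoint hw] at this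

theorem IsBiclique.sdiff_pair (h : C.IsBiclique c A (n + 1) X Y) (hX : ¬ (x ∈ X ∧ y ∈ X))
    (hY : ¬ (x ∈ Y ∧ y ∈ Y)) : C.IsBiclique c A n (X \ {x, y}) (Y \ {x, y}) := by
  have hcard : ∀ Z : Finset V, ¬ (x ∈ Z ∧ y ∈ Z) → n + 1 ≤ Z.card → n ≤ (Z \ {x, y}).card := by
    intro Z hZ hn
    have hone : (({x, y} : Finset V) ∩ Z).card ≤ 1 := by
      rw [Finset.card_le_one]
      simp only [Finset.mem_inter, Finset.mem_insert, Finset.mem_singleton]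
      grind
    rw [Finset.card_sdiff]
    omega
  exact h.mono Finset.sdiff_subset Finset.sdiff_subset (hcard X hX h.le_card_left)
    (hcard Y hY h.le_card_right)

theorem IsTriangle.hasTailedTriangle_of_isPath (ht : C.IsTriangle c A x y z)
    (h : C.IsBiclique c A (n + 1) X Y) (hxX : x ∉ X) (hxY : x ∉ Y) (hyX : y ∉ X) (hyY : y ∉ Y)
    {p : List V} (hp : C.IsPath c A (p ++ [w])) (hw : w ∈ X) (hpXY : ∀ v ∈ p, v ∉ X ∪ Y)
    (hpz : p ++ [w] = z :: l) (hxl : x ∉ l) (hyl : y ∉ l) :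
    C.HasTailedTriangle c A (2 * (n + 2)) := by
  obtain ⟨q, hq, hqlen⟩ := h.exists_isPath hw
  have hqXY : ∀ v ∈ q, v ∈ X ∪ Y := fun v hv => hq.mem v (List.mem_cons_of_mem w hv)
  have hpq := hp.append (hq.mono (Finset.union_subset h.left_subset h.right_subset))
    fun v hv hvq => hpXY v hv (hqXY v hvq)
  have hlist : p ++ w :: q = z :: (l ++ q) := by simpa using congrArg (· ++ q) hpz
  have hnotMem : ∀ v, v ∉ l → v ∉ X → v ∉ Y → v ∉ l ++ q := fun v hvl hvX hvY hv =>
    (List.mem_append.mp hv).elim hvl fun hvq => by simpa [hvX, hvY] using hqXY v hvq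
  rw [hlist] at hpq
  exact ⟨_, hpq.isTailedTriangle ht (hnotMem x hxl hxX hxY) (hnotMem y hyl hyX hyY), by simp; omega⟩

theorem IsTriangle.hasTailedTriangle_of_isBiclique (ht : C.IsTriangle c A x y z)
    (h : C.IsBiclique c A n X Y) (hn : 2 ≤ n) (hw : w ∈ X ∪ Y) (hr : C.Reachable c A z w) :
    C.HasTailedTriangle c A (2 * n) := by
  by_contra hno
  obtain ⟨n, rfl⟩ := Nat.exists_eq_add_of_le' hn
  have hX : ∀ a ∈ X, ∀ b ∈ X, ¬ C.Adj c A a b := fun a ha b hb hab =>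
    hno (h.hasTailedTriangle_of_adj hn ha hb hab)
  have hY : ∀ a ∈ Y, ∀ b ∈ Y, ¬ C.Adj c A a b := fun a ha b hb hab =>
    hno (h.symm.hasTailedTriangle_of_adj hn ha hb hab)
  have hwA := Finset.union_subset h.left_subset h.right_subset hw
  obtain ⟨p, e, hp, he, hpXY, v, q, hpq, hv, hq⟩ :=
    hr.exists_isPath_between (T := {x, y, z}) hwA (by simp) hw
  obtain ⟨a, b, hab, ha, hb⟩ : ∃ a b, C.IsTriangle c A a b v ∧ a ∉ q ∧ b ∉ q := by
    have hx := fun h => hq x h (by simp)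
    have hy := fun h => hq y h (by simp)
    have hz := fun h => hq z h (by simp)
    simp only [Finset.mem_insert, Finset.mem_singleton] at hv
    obtain rfl | rfl | rfl := hv
    exacts [⟨y, z, ht.rotate, hy, hz⟩, ⟨z, x, ht.rotate.rotate, hz, hx⟩, ⟨x, y, ht, hx, hy⟩]
  have heab : e ∉ ({a, b} : Finset V) := by
    have hev : e ∈ v :: q := hpq ▸ List.mem_append_right p List.mem_cons_self
    have hav := hab.adj₁₃.ne
    have hbv := hab.adj₂₃.ne
    simp only [Finset.mem_insert, Finset.mem_singleton, List.mem_cons] at hev ⊢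
    grind
  have hsdiff := h.sdiff_pair (fun hXab => hX a hXab.1 b hXab.2 hab.adj₁₂)
    fun hYab => hY a hYab.1 b hYab.2 hab.adj₁₂
  have hpXY' : ∀ v ∈ p, v ∉ X \ {a, b} ∪ Y \ {a, b} := fun v hv hv' => hpXY v hv
    (Finset.union_subset_union Finset.sdiff_subset Finset.sdiff_subset hv')
  obtain he | he := Finset.mem_union.mp he
  · exact hno (hab.hasTailedTriangle_of_isPath hsdiff (by simp) (by simp) (by simp) (by simp) hp
      (Finset.mem_sdiff.mpr ⟨he, heab⟩) hpXY' hpq ha hb)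
  · exact hno (hab.hasTailedTriangle_of_isPath hsdiff.symm (by simp) (by simp) (by simp) (by simp)
      hp (Finset.mem_sdiff.mpr ⟨he, heab⟩) (by rwa [Finset.union_comm]) hpq ha hb)

end Bicliques

section Connected

/-- Connectedness of the graph of colour `c` on `A`. -/
def Connected (C : PairColoring V κ) (c : κ) (A : Finset V) : Prop :=
  ∀ x ∈ A, ∀ y ∈ A, C.Reachable c A x y

theorem Reachable.mem (h : C.Reachable c A x y) (hx : x ∈ A) : y ∈ A := by
  induction h with
  | refl => exact hx
  | tail _ hbc _ => exact hbc.right_mem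

theorem color_ne_of_not_reachable (hx : x ∈ A) (hy : y ∈ A) (h : ¬ C.Reachable c A x y) :
    C x y ≠ c := fun hc =>
  h (.single ⟨hx, hy, fun e => h (e ▸ .refl), hc⟩)

theorem Connected.exists_adj (h : C.Connected c A) (hA : 1 < A.card) (hx : x ∈ A) :
    ∃ y, C.Adj c A x y := by
  obtain ⟨y, hy, hxy⟩ := Finset.exists_mem_ne hA x
  obtain rfl | ⟨w, hw, -⟩ := Relation.ReflTransGen.cases_head (h x hx y hy)
  · exact absurd rfl hxy
  · exact ⟨w, hw⟩

theorem Connected.exists_crossing (h : C.Connected c A) (hx : x ∈ A) (hy : y ∈ A) (hxB : x ∈ B)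
    (hyB : y ∉ B) : ∃ a ∈ B, ∃ b, b ∉ B ∧ C.Adj c A a b := by
  induction h x hx y hy with
  | refl => exact absurd hxB hyB
  | @tail a b _ hab ih =>
    by_cases ha : a ∈ B
    · exact ⟨a, ha, b, hyB, hab⟩
    · exact ih hab.left_mem ha

theorem connected_or_connected {r b : κ}
    (hrb : ∀ x ∈ A, ∀ y ∈ A, x ≠ y → C x y = r ∨ C x y = b) :
    C.Connected r A ∨ C.Connected b A := by
  refine or_iff_not_imp_left.mpr fun hr => ?_
  unfold Connected at hr
  push Not at hr
  obtain ⟨p, hp, q, hq, hpq⟩ := hr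
  have hcut : ∀ v ∈ A, ∀ w ∈ A, C.Reachable r A p v → ¬ C.Reachable r A p w → C.Adj b A v w := by
    intro v hv w hw hpv hpw
    have hvw : ¬ C.Reachable r A v w := fun h => hpw (hpv.trans h)
    have hne : v ≠ w := fun e => hpw (e ▸ hpv)
    exact ⟨hv, hw, hne, (hrb v hv w hw hne).resolve_left (color_ne_of_not_reachable hv hw hvw)⟩
  have hp_all : ∀ v ∈ A, C.Reachable b A p v := by
    intro v hv
    by_cases h : C.Reachable r A p v
    · exact (Relation.ReflTransGen.single (hcut p hp q hq .refl hpq)).tail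
        (hcut v hv q hq h hpq).symm
    · exact .single (hcut p hp v hv .refl h)
  exact fun v hv w hw => (hp_all v hv).symm.trans (hp_all w hw)

theorem Connected.exists_reachable_erase (h : C.Connected c A) (hv : v ∈ A) (hx : x ∈ A.erase v) :
    ∃ y ∈ A.erase v, C.Reachable c (A.erase v) x y ∧ C v y = c := by
  obtain ⟨hxv, hxA⟩ := Finset.mem_erase.mp hx
  induction h x hxA v hv using Relation.ReflTransGen.head_induction_on with
  | refl => exact absurd rfl hxv
  | @head a b hab _ ih =>
    by_cases hbv : b = v
    · exact ⟨a, hx, .refl, by rw [← hbv]; exact hab.symm.color⟩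
    · have hb := Finset.mem_erase.mpr ⟨hbv, hab.right_mem⟩
      obtain ⟨y, hy, hby, hvy⟩ := ih hb hbv hab.right_mem
      exact ⟨y, hy, .head ⟨hx, hb, hab.ne, hab.color⟩ hby, hvy⟩

end Connected

section Gallai

/-- There is no triangle in `A` whose edges have three different colours. -/
def NoRainbow (C : PairColoring V κ) (A : Finset V) : Prop :=
  ∀ x ∈ A, ∀ y ∈ A, ∀ z ∈ A, x ≠ y → y ≠ z → x ≠ z → C x y = C y z ∨ C x y = C x z ∨ C y z = C x z

theorem NoRainbow.mono (h : C.NoRainbow A) (hBA : B ⊆ A) : C.NoRainbow B :=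
  fun x hx y hy z hz => h x (hBA hx) y (hBA hy) z (hBA hz)

theorem NoRainbow.color_eq_of_reachable (hG : C.NoRainbow A) (hxy : C.Reachable c A x y)
    (hz : z ∈ A) (hxz : ¬ C.Reachable c A x z) : C x z = C y z := by
  induction hxy with
  | refl => rfl
  | @tail p q hxp hpq ih =>
    have hpz : ¬ C.Reachable c A p z := fun h => hxz (hxp.trans h)
    have hqz : ¬ C.Reachable c A q z := fun h => hpz (.head hpq h)
    have hne_pz : p ≠ z := fun e => hpz (e ▸ .refl)
    have hne_qz : q ≠ z := fun e => hqz (e ▸ .refl)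
    have hcpz := color_ne_of_not_reachable hpq.left_mem hz hpz
    have hcqz := color_ne_of_not_reachable hpq.right_mem hz hqz
    have := hG p hpq.left_mem q hpq.right_mem z hz hpq.ne hne_qz hne_pz
    rw [hpq.color] at this
    rw [ih]
    obtain h | h | h := this
    exacts [absurd h.symm hcqz, absurd h.symm hcpz, h.symm]

theorem NoRainbow.color_eq_of_not_connected_erase (hG : C.NoRainbow A) (hA : C.Connected c A)
    (hv : v ∈ A) (hn : ¬ C.Connected c (A.erase v)) (hx : x ∈ A.erase v) (hy : y ∈ A.erase v)
    (hvx : C v x ≠ c) (hvy : C v y ≠ c) : C v x = C v y := by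
  have hGv := hG.mono (A.erase_subset v)
  have htransfer : ∀ a ∈ A.erase v, ∀ b ∈ A.erase v, ¬ C.Reachable c (A.erase v) a b →
      C v a ≠ c → C v b = c → C a b = C v a := by
    intro a ha b hb hab hva hvb
    have hcab := color_ne_of_not_reachable ha hb hab
    obtain ⟨hav, haA⟩ := Finset.mem_erase.mp ha
    obtain ⟨hbv, hbA⟩ := Finset.mem_erase.mp hb
    have := hG v hv a haA b hbA hav.symm (fun e => hab (e ▸ .refl)) hbv.symm
    grind
  by_cases hxy : C.Reachable c (A.erase v) x y
  · obtain ⟨z, hz, hxz⟩ : ∃ z ∈ A.erase v, ¬ C.Reachable c (A.erase v) x z := by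
      by_contra! hall
      exact hn fun p hp q hq => (hall p hp).symm.trans (hall q hq)
    obtain ⟨z', hz', hzz', hvz'⟩ := hA.exists_reachable_erase hv hz
    have hxz' : ¬ C.Reachable c (A.erase v) x z' := fun h => hxz (h.trans hzz'.symm)
    have hyz' : ¬ C.Reachable c (A.erase v) y z' := fun h => hxz' (hxy.trans h)
    rw [← htransfer x hx z' hz' hxz' hvx hvz', ← htransfer y hy z' hz' hyz' hvy hvz']
    exact hGv.color_eq_of_reachable hxy hz' hxz'
  · obtain ⟨x', hx', hxx', hvx'⟩ := hA.exists_reachable_erase hv hx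
    obtain ⟨y', hy', hyy', hvy'⟩ := hA.exists_reachable_erase hv hy
    have hxy' : ¬ C.Reachable c (A.erase v) x y' := fun h => hxy (h.trans hyy'.symm)
    have hyx' : ¬ C.Reachable c (A.erase v) y x' := fun h => hxy (hxx'.trans h.symm)
    have hyx : ¬ C.Reachable c (A.erase v) y x := fun h => hxy h.symm
    rw [← htransfer x hx y' hy' hxy' hvx hvy', ← htransfer y hy x' hx' hyx' hvy hvx', C.symm x,
      C.symm y, ← hGv.color_eq_of_reachable hyy' hx hyx, ← hGv.color_eq_of_reachable hxx' hy hxy,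
      C.symm]

theorem NoRainbow.not_connected_of_three (hG : C.NoRainbow A) (hA : 1 < A.card) {a b d : κ}
    (hab : a ≠ b) (had : a ≠ d) (hbd : b ≠ d) (ha : C.Connected a A) (hb : C.Connected b A) :
    ¬ C.Connected d A := by
  induction A using Finset.strongInduction with
  | H A ih =>
    intro hd
    obtain ⟨v, hv⟩ := Finset.card_pos.mp (Nat.zero_lt_one.trans hA)
    have hmem : ∀ {e w}, C.Adj e A v w → w ∈ A.erase v := fun h =>
      Finset.mem_erase.mpr ⟨h.ne.symm, h.right_mem⟩
    obtain ⟨x, hx⟩ := ha.exists_adj hA hv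
    obtain ⟨y, hy⟩ := hb.exists_adj hA hv
    obtain ⟨z, hz⟩ := hd.exists_adj hA hv
    have hxy : x ≠ y := by
      rintro rfl
      exact hab (hx.color.symm.trans hy.color)
    have hreduce := ih _ (Finset.erase_ssubset hv) (hG.mono (A.erase_subset v))
      (Finset.one_lt_card.mpr ⟨x, hmem hx, y, hmem hy, hxy⟩)
    have hconn : ∀ {e f g : κ} {p q : V}, e ≠ f → e ≠ g → f ≠ g → C.Connected e A → C.Adj f A v p →
        C.Adj g A v q → C.Connected e (A.erase v) := by
      intro e f g p q hef heg hfg he hp hq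
      by_contra hn
      have := hG.color_eq_of_not_connected_erase he hv hn (hmem hp) (hmem hq)
        (hp.color.trans_ne hef.symm) (hq.color.trans_ne heg.symm)
      exact hfg (hp.color.symm.trans (this.trans hq.color))
    exact hreduce (hconn hab had hbd ha hy hz) (hconn hab.symm hbd had hb hx hz)
      (hconn had.symm hbd.symm hab hd hx hy)

/-- The fibres of `f` partition `A` into modules, and `f` sends each vertex to the representative
of its module. The colouring of the representatives is thus the quotient colouring. -/
structure IsModularPartition (C : PairColoring V κ) (A : Finset V) (f : V → V) : Prop where
  mapsTo : ∀ x ∈ A, f x ∈ A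
  apply_apply : ∀ x ∈ A, f (f x) = f x
  color_apply : ∀ x ∈ A, ∀ y ∈ A, f x ≠ f y → C (f x) (f y) = C x y

variable {f : V → V} {r b : κ}

theorem IsModularPartition.image_subset (h : C.IsModularPartition A f) : A.image f ⊆ A :=
  Finset.image_subset_iff.mpr h.mapsTo

theorem IsModularPartition.apply_of_mem_image (h : C.IsModularPartition A f) (hx : x ∈ A.image f) :
    f x = x := by
  obtain ⟨a, ha, rfl⟩ := Finset.mem_image.mp hx
  exact h.apply_apply a ha

theorem IsModularPartition.color_eq (h : C.IsModularPartition A f) {x' y' : V} (hx : x ∈ A)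
    (hx' : x' ∈ A) (hy : y ∈ A) (hy' : y' ∈ A) (hxx' : f x = f x') (hyy' : f y = f y')
    (hxy : f x ≠ f y) : C x y = C x' y' := by
  rw [← h.color_apply x hx y hy hxy, hxx', hyy',
    h.color_apply x' hx' y' hy' (by rwa [← hxx', ← hyy'])]

/-- The components of a disconnected colour of the quotient are again modules. -/
theorem IsModularPartition.exists_coarsening (h : C.IsModularPartition A f) (hG : C.NoRainbow A)
    (hx : x ∈ A.image f) (hy : y ∈ A.image f) (hxy : x ≠ y)
    (hn : ¬ C.Connected (C x y) (A.image f)) : ∃ g, C.IsModularPartition A g ∧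
      1 < (A.image g).card ∧ (A.image g).card < (A.image f).card := by
  let S : Setoid V := ⟨C.Reachable (C x y) (A.image f), fun _ => .refl, Reachable.symm,
    fun h h' => h.trans h'⟩
  let ρ : V → V := fun v => (Quotient.mk S v).out
  have hρ : ∀ v, C.Reachable (C x y) (A.image f) v (ρ v) := fun v =>
    Reachable.symm (Quotient.mk_out (s := S) v)
  have hρ_eq : ∀ {v w}, ρ v = ρ w ↔ C.Reachable (C x y) (A.image f) v w := fun {v w} =>
    ⟨fun e => (hρ v).trans (e ▸ (hρ w).symm), fun e => congrArg Quotient.out (Quotient.sound e)⟩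
  have hG' := hG.mono h.image_subset
  have himage : A.image (ρ ∘ f) = (A.image f).image ρ := Finset.image_image.symm
  have hρ_mem : ∀ v ∈ A, ρ (f v) ∈ A.image f := fun v hv =>
    (hρ _).mem (Finset.mem_image_of_mem f hv)
  refine ⟨ρ ∘ f, ⟨fun v hv => h.image_subset (hρ_mem v hv), fun v hv => ?_,
    fun v hv w hw hvw => ?_⟩, ?_, ?_⟩
  · rw [Function.comp_apply, Function.comp_apply, h.apply_of_mem_image (hρ_mem v hv)]
    exact hρ_eq.mpr (hρ _).symm
  · have hreach := mt hρ_eq.mpr hvw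
    have hreach' : ¬ C.Reachable (C x y) (A.image f) (f w) (ρ (f v)) := fun e =>
      hreach ((hρ _).trans e.symm)
    rw [← h.color_apply v hv w hw (mt (congrArg ρ) hvw),
      hG'.color_eq_of_reachable (hρ (f v)) (Finset.mem_image_of_mem f hw) hreach, C.symm _ (f w),
      hG'.color_eq_of_reachable (hρ (f w)) (hρ_mem v hv) hreach', C.symm]
    rfl
  · unfold Connected at hn
    push Not at hn
    obtain ⟨p, hp, q, hq, hpq⟩ := hn
    rw [himage]
    exact Finset.one_lt_card.mpr ⟨ρ p, Finset.mem_image_of_mem ρ hp, ρ q,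
      Finset.mem_image_of_mem ρ hq, mt hρ_eq.mp hpq⟩
  · rw [himage]
    exact Finset.card_image_le.lt_of_ne fun hcard =>
      hxy (Finset.card_image_iff.mp hcard hx hy (hρ_eq.mpr (.single ⟨hx, hy, hxy, rfl⟩)))

theorem IsModularPartition.exists_forall_connected (h : C.IsModularPartition A f)
    (hG : C.NoRainbow A) (hf : 1 < (A.image f).card) : ∃ g, C.IsModularPartition A g ∧
      1 < (A.image g).card ∧ ∀ x ∈ A.image g, ∀ y ∈ A.image g, x ≠ y →
        C.Connected (C x y) (A.image g) := by
  induction hcard : (A.image f).card using Nat.strong_induction_on generalizing f with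
  | _ n ih =>
    by_contra hno
    have : ¬ ∀ x ∈ A.image f, ∀ y ∈ A.image f, x ≠ y → C.Connected (C x y) (A.image f) :=
      fun hall => hno ⟨f, h, hf, hall⟩
    push Not at this
    obtain ⟨x, hx, y, hy, hxy, hn⟩ := this
    obtain ⟨g, hg, hg1, hgf⟩ := h.exists_coarsening hG hx hy hxy hn
    exact hno (ih _ (hcard ▸ hgf) hg hg1 rfl)

/-- A modular partition whose quotient has just the colours `r` and `b`, both of them connected. -/
structure IsPrimePartition (C : PairColoring V κ) (A : Finset V) (f : V → V) (r b : κ) : Prop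
    extends C.IsModularPartition A f where
  one_lt_card : 1 < (A.image f).card
  ne : r ≠ b
  color_quotient : ∀ x ∈ A.image f, ∀ y ∈ A.image f, x ≠ y → C x y = r ∨ C x y = b
  connected_quotient_left : C.Connected r (A.image f)
  connected_quotient_right : C.Connected b (A.image f)

/-- Gallai's theorem. In a modular partition with as few parts as possible all colours of the
quotient are connected, and three connected colours would force a rainbow triangle. -/
theorem NoRainbow.exists_isModularPartition (hG : C.NoRainbow A) (hA : 1 < A.card) :
    ∃ f r, (C.IsModularPartition A f ∧ 1 < (A.image f).card ∧
      ∀ x ∈ A.image f, ∀ y ∈ A.image f, x ≠ y → C x y = r) ∨ ∃ b, C.IsPrimePartition A f r b := by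
  have hid : C.IsModularPartition A id := ⟨fun _ => id, fun _ _ => rfl, fun _ _ _ _ _ => rfl⟩
  obtain ⟨f, hf, hf1, hconn⟩ := hid.exists_forall_connected hG (by rwa [Finset.image_id])
  obtain ⟨x, hx, y, hy, hxy⟩ := Finset.one_lt_card.mp hf1
  refine ⟨f, C x y, or_iff_not_imp_left.mpr fun hnot => ?_⟩
  have : ¬ ∀ z ∈ A.image f, ∀ w ∈ A.image f, z ≠ w → C z w = C x y :=
    fun hall => hnot ⟨hf, hf1, hall⟩
  push Not at this
  obtain ⟨z, hz, w, hw, hzw, hne⟩ := this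
  refine ⟨C z w, hf, hf1, hne.symm, fun p hp q hq hpq => ?_, hconn x hx y hy hxy,
    hconn z hz w hw hzw⟩
  by_contra! hpq'
  exact (hG.mono hf.image_subset).not_connected_of_three hf1 hne.symm hpq'.1.symm hpq'.2.symm
    (hconn x hx y hy hxy) (hconn z hz w hw hzw) (hconn p hp q hq hpq)

theorem IsPrimePartition.symm (h : C.IsPrimePartition A f r b) : C.IsPrimePartition A f b r where
  toIsModularPartition := h.toIsModularPartition
  one_lt_card := h.one_lt_card
  ne := h.ne.symm
  color_quotient x hx y hy hxy := (h.color_quotient x hx y hy hxy).symm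
  connected_quotient_left := h.connected_quotient_right
  connected_quotient_right := h.connected_quotient_left

theorem IsPrimePartition.color_cross (h : C.IsPrimePartition A f r b) (hx : x ∈ A) (hy : y ∈ A)
    (hxy : f x ≠ f y) : C x y = r ∨ C x y = b := by
  rw [← h.color_apply x hx y hy hxy]
  exact h.color_quotient _ (Finset.mem_image_of_mem f hx) _ (Finset.mem_image_of_mem f hy) hxy

theorem IsPrimePartition.exists_adj_left (h : C.IsPrimePartition A f r b) (hx : x ∈ A) :
    ∃ t ∈ A, f x ≠ f t ∧ ∀ y ∈ A, f y = f x → C.Adj r A y t := by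
  obtain ⟨t, ht⟩ :=
    h.connected_quotient_left.exists_adj h.one_lt_card (Finset.mem_image_of_mem f hx)
  have htA := h.image_subset ht.right_mem
  have hft := h.apply_of_mem_image ht.right_mem
  have hxt : f x ≠ f t := by rw [hft]; exact ht.ne
  refine ⟨t, htA, hxt, fun y hy hyx => ⟨hy, htA, fun e => hxt (by rw [← hyx, e]), ?_⟩⟩
  rw [← h.color_apply y hy t htA (hyx ▸ hxt), hft, hyx, ht.color]

theorem IsPrimePartition.connected_left (h : C.IsPrimePartition A f r b) : C.Connected r A := by
  have hsame : ∀ x ∈ A, C.Reachable r A x (f x) := by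
    intro x hx
    obtain ⟨t, -, -, hadj⟩ := h.exists_adj_left hx
    exact (Relation.ReflTransGen.single (hadj x hx rfl)).tail
      (hadj (f x) (h.mapsTo x hx) (h.apply_apply x hx)).symm
  exact fun x hx y hy => ((hsame x hx).trans ((h.connected_quotient_left (f x)
    (Finset.mem_image_of_mem f hx) (f y) (Finset.mem_image_of_mem f hy)).mono h.image_subset)).trans
      (hsame y hy).symm

end Gallai

section Ramsey

variable {r b : κ}

theorem exists_isTriangle_of_three_le_card (hrb : ∀ x ∈ A, ∀ y ∈ A, x ≠ y → C x y = r ∨ C x y = b)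
    (hv : 3 ≤ (A.filter (C.Adj r A v)).card) :
    ∃ x y z, C.IsTriangle r A x y z ∨ C.IsTriangle b A x y z := by
  obtain ⟨T, hT, hT3⟩ := Finset.exists_subset_card_eq hv
  obtain ⟨x, y, z, hxy, hxz, hyz, rfl⟩ := Finset.card_eq_three.mp hT3
  have hx := (Finset.mem_filter.mp (hT (show x ∈ _ by simp))).2
  have hy := (Finset.mem_filter.mp (hT (show y ∈ _ by simp))).2
  have hz := (Finset.mem_filter.mp (hT (show z ∈ _ by simp))).2
  obtain cxy | cxy := hrb x hx.right_mem y hy.right_mem hxy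
  · exact ⟨v, x, y, .inl ⟨hx, hy, hx.right_mem, hy.right_mem, hxy, cxy⟩⟩
  obtain cxz | cxz := hrb x hx.right_mem z hz.right_mem hxz
  · exact ⟨v, x, z, .inl ⟨hx, hz, hx.right_mem, hz.right_mem, hxz, cxz⟩⟩
  obtain cyz | cyz := hrb y hy.right_mem z hz.right_mem hyz
  · exact ⟨v, y, z, .inl ⟨hy, hz, hy.right_mem, hz.right_mem, hyz, cyz⟩⟩
  exact ⟨x, y, z, .inr ⟨⟨hx.right_mem, hy.right_mem, hxy, cxy⟩,
    ⟨hx.right_mem, hz.right_mem, hxz, cxz⟩, ⟨hy.right_mem, hz.right_mem, hyz, cyz⟩⟩⟩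

theorem card_le_card_filter_adj_add (hv : v ∈ A)
    (hrb : ∀ w ∈ A, v ≠ w → C v w = r ∨ C v w = b) :
    A.card ≤ (A.filter (C.Adj r A v)).card + (A.filter (C.Adj b A v)).card + 1 := by
  have hunion : A.erase v ⊆ A.filter (C.Adj r A v) ∪ A.filter (C.Adj b A v) := by
    intro w hw
    obtain ⟨hwv, hwA⟩ := Finset.mem_erase.mp hw
    obtain h | h := hrb w hwA hwv.symm
    · exact Finset.mem_union_left _ (Finset.mem_filter.mpr ⟨hwA, hv, hwA, hwv.symm, h⟩)
    · exact Finset.mem_union_right _ (Finset.mem_filter.mpr ⟨hwA, hv, hwA, hwv.symm, h⟩)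
  have hcard := (Finset.card_le_card hunion).trans (Finset.card_union_le _ _)
  rw [Finset.card_erase_of_mem hv] at hcard
  omega

theorem exists_isTriangle_of_six_le_card (hA : 6 ≤ A.card)
    (hrb : ∀ x ∈ A, ∀ y ∈ A, x ≠ y → C x y = r ∨ C x y = b) :
    ∃ x y z, C.IsTriangle r A x y z ∨ C.IsTriangle b A x y z := by
  obtain ⟨v, hv⟩ := Finset.card_pos.mp (show 0 < A.card by omega)
  have hcard := card_le_card_filter_adj_add hv (hrb v hv)
  by_cases hr : 3 ≤ (A.filter (C.Adj r A v)).card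
  · exact exists_isTriangle_of_three_le_card hrb hr
  · obtain ⟨x, y, z, h⟩ := exists_isTriangle_of_three_le_card (C := C) (v := v)
      (fun x hx y hy hxy => (hrb x hx y hy hxy).symm) (show 3 ≤ _ by omega)
    exact ⟨x, y, z, h.symm⟩

end Ramsey

section Split

variable {f : V → V}

/-- Adding the parts one by one, the first union with more than `s` vertices has at most `2 * s`. -/
theorem exists_split_of_small_fibers (hs : ∀ v, (A.filter (f · = v)).card ≤ s)
    (hA : 3 * s < A.card) :
    ∃ X Y : Finset V, X ⊆ A ∧ Y ⊆ A ∧ s < X.card ∧ s < Y.card ∧ ∀ x ∈ X, ∀ y ∈ Y, f x ≠ f y := by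
  have hgreedy : ∀ Q : Finset V, (A.filter (f · ∈ Q)).card ≤ s ∨
      ∃ P : Finset V, s < (A.filter (f · ∈ P)).card ∧ (A.filter (f · ∈ P)).card ≤ 2 * s := by
    intro Q
    induction Q using Finset.induction_on with
    | empty => simp
    | insert v Q _ ih =>
      refine ih.elim (fun ih => ?_) Or.inr
      have hsub : A.filter (f · ∈ insert v Q) ⊆ A.filter (f · = v) ∪ A.filter (f · ∈ Q) := by
        intro w
        simp only [Finset.mem_filter, Finset.mem_union, Finset.mem_insert]
        tauto
      have hcard := (Finset.card_le_card hsub).trans (Finset.card_union_le _ _)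
      have := hs v
      exact or_iff_not_imp_left.mpr fun h => ⟨insert v Q, by omega, by omega⟩
  obtain h | ⟨P, hP, hP'⟩ := hgreedy (A.image f)
  · rw [Finset.filter_true_of_mem fun w hw => Finset.mem_image_of_mem f hw] at h
    omega
  · have := Finset.card_filter_add_card_filter_not (s := A) (f · ∈ P)
    exact ⟨_, _, Finset.filter_subset (f · ∈ P) A, Finset.filter_subset (¬ f · ∈ P) A, hP, by omega,
      fun x hx y hy e => (Finset.mem_filter.mp hy).2 (e ▸ (Finset.mem_filter.mp hx).2)⟩

end Split

section Search

variable {D U : Finset V}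

/-- `D` and `U` are disjoint parts of `A` without edges of colour `c` in between, and they contain
all but at most `u` vertices of `A`. -/
structure IsSeparated (C : PairColoring V κ) (c : κ) (A : Finset V) (u : ℕ) (D U : Finset V) :
    Prop where
  left_subset : D ⊆ A
  right_subset : U ⊆ A
  disjoint : Disjoint D U
  color_ne : ∀ d ∈ D, ∀ w ∈ U, C d w ≠ c
  card_le : A.card ≤ D.card + U.card + u

/-- A state of a depth-first search of the graph of colour `c` on `A` that starts with a triangle
instead of a vertex: `l` is the stack, with its top at the end of the list, `D` is the set of the
finished vertices and `U` the set of the unvisited ones. -/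
structure IsSearchState (C : PairColoring V κ) (c : κ) (A : Finset V) (l : List V)
    (D U : Finset V) : Prop where
  isTailedTriangle : C.IsTailedTriangle c A l
  mem_iff : ∀ v, v ∈ A ↔ v ∈ l ∨ v ∈ D ∨ v ∈ U
  disjoint : Disjoint D U
  notMem_left : ∀ v ∈ l, v ∉ D
  notMem_right : ∀ v ∈ l, v ∉ U
  color_ne : ∀ d ∈ D, ∀ w ∈ U, C d w ≠ c

theorem IsTriangle.isSearchState (h : C.IsTriangle c A x y z) :
    C.IsSearchState c A [x, y, z] ∅ (A \ {x, y, z}) where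
  isTailedTriangle := h.isTailedTriangle
  mem_iff v := by
    have := h.adj₁₂.left_mem
    have := h.adj₂₃.left_mem
    have := h.adj₂₃.right_mem
    simp only [List.mem_cons, List.not_mem_nil, Finset.mem_sdiff, Finset.mem_insert,
      Finset.mem_singleton]
    grind
  disjoint := Finset.disjoint_empty_left _
  notMem_left := by simp
  notMem_right := by simp
  color_ne := by simp

theorem IsSearchState.isSeparated (h : C.IsSearchState c A l D U)
    (hu : ¬ C.HasTailedTriangle c A (u + 1)) : C.IsSeparated c A u D U where
  left_subset v hv := (h.mem_iff v).mpr (.inr (.inl hv))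
  right_subset v hv := (h.mem_iff v).mpr (.inr (.inr hv))
  disjoint := h.disjoint
  color_ne := h.color_ne
  card_le := by
    have hA : A ⊆ l.toFinset ∪ (D ∪ U) := fun v hv => by simpa using (h.mem_iff v).mp hv
    have hcard := Finset.card_le_card hA
    have hl : l.length ≤ u := by
      by_contra! hl
      exact hu ⟨l, h.isTailedTriangle, hl⟩
    have := Finset.card_union_le l.toFinset (D ∪ U)
    have := Finset.card_union_le D U
    have := l.toFinset_card_le
    omega

theorem IsSearchState.push (h : C.IsSearchState c A (l ++ [v]) D U) (hw : w ∈ U) (hvw : C v w = c) :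
    C.IsSearchState c A (l ++ [v, w]) D (U.erase w) := by
  obtain ⟨ht, hmem, hDU, hlD, hlU, hcol⟩ := h
  have hwl : w ∉ l ++ [v] := fun hwl => hlU w hwl hw
  have hadj : C.Adj c A v w := ⟨(hmem v).mpr (by simp), (hmem w).mpr (by simp [hw]),
    fun e => hwl (by simp [e]), hvw⟩
  refine ⟨ht.concat hadj fun h => hwl (by simp [h]), ?_, ?_, ?_, ?_, fun d hd a ha =>
    hcol d hd a (Finset.mem_of_mem_erase ha)⟩
  all_goals simp only [Finset.disjoint_left] at hDU ⊢; grind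

theorem IsSearchState.pop (h : C.IsSearchState c A (x :: y :: z :: (l ++ [w])) D U)
    (hw : ∀ v ∈ U, C w v ≠ c) : C.IsSearchState c A (x :: y :: z :: l) (insert w D) U := by
  have ht := h.isTailedTriangle.isTriangle
  obtain ⟨⟨hp, -⟩, hmem, hDU, hlD, hlU, hcol⟩ := h
  have hnd := hp.nodup
  refine ⟨⟨hp.infix ⟨[], [w], by simp⟩, x, y, z, l, rfl, ht.adj₁₃.color⟩, ?_, ?_, ?_, ?_, ?_⟩
  all_goals simp only [Finset.disjoint_left] at hDU ⊢; grind

theorem IsSearchState.rotate (h : C.IsSearchState c A [x, y, z] D U) :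
    C.IsSearchState c A [y, z, x] D U := by
  have ht := h.isTailedTriangle.isTriangle.rotate.isTailedTriangle
  obtain ⟨-, hmem, hDU, hlD, hlU, hcol⟩ := h
  refine ⟨ht, ?_, hDU, ?_, ?_, hcol⟩
  all_goals grind

theorem IsSearchState.exists_push_of_triangle (h : C.IsSearchState c A [x, y, z] D U)
    (hA : C.Connected c A) (hU : U.Nonempty) :
    ∃ l, ∃ w ∈ U, C.IsSearchState c A l D (U.erase w) := by
  obtain ⟨q, hq⟩ := hU
  have hqU : q ∉ [x, y, z].toFinset ∪ D := fun hqlD => (Finset.mem_union.mp hqlD).elim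
    (fun hql => h.notMem_right q (List.mem_toFinset.mp hql) hq)
    fun hqD => Finset.disjoint_left.mp h.disjoint hqD hq
  obtain ⟨a, ha, w, hw, haw⟩ := hA.exists_crossing ((h.mem_iff x).mpr (by simp))
    ((h.mem_iff q).mpr (by simp [hq])) (show x ∈ [x, y, z].toFinset ∪ D by simp) hqU
  have hwU : w ∈ U := by
    have := (h.mem_iff w).mp haw.right_mem
    simp only [Finset.mem_union, List.mem_toFinset] at hw
    tauto
  have haD : a ∉ D := fun haD => h.color_ne a haD w hwU haw.color
  have ha_eq : a = x ∨ a = y ∨ a = z := by simpa [haD] using ha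
  obtain rfl | rfl | rfl := ha_eq
  · exact ⟨_, w, hwU, h.rotate.push (l := [y, z]) hwU haw.color⟩
  · exact ⟨_, w, hwU, h.rotate.rotate.push (l := [z, x]) hwU haw.color⟩
  · exact ⟨_, w, hwU, h.push (l := [x, y]) hwU haw.color⟩

theorem IsSearchState.exists_step (h : C.IsSearchState c A l D U) (hA : C.Connected c A)
    (hU : U.Nonempty) : (∃ l', ∃ w ∈ U, C.IsSearchState c A l' D (U.erase w)) ∨
      ∃ l', ∃ w ∈ A, w ∉ D ∧ w ∉ U ∧ C.IsSearchState c A l' (insert w D) U := by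
  obtain ⟨-, x, y, z, l', rfl, -⟩ := h.isTailedTriangle
  obtain rfl | ⟨l, v, rfl⟩ := l'.eq_nil_or_concat'
  · exact .inl (h.exists_push_of_triangle hA hU)
  · by_cases hv : ∃ w ∈ U, C v w = c
    · obtain ⟨w, hw, hvw⟩ := hv
      exact .inl ⟨_, w, hw, h.push (l := x :: y :: z :: l) hw hvw⟩
    · push Not at hv
      exact .inr ⟨_, v, (h.mem_iff v).mpr (by simp), h.notMem_left v (by simp),
        h.notMem_right v (by simp), h.pop hv⟩

/-- Depth-first search, as an induction principle. The stack is a tailed triangle, so it never has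
more than `u` vertices. -/
theorem IsTriangle.search_induction (ht : C.IsTriangle c A x y z) (hA : C.Connected c A)
    (hu : ¬ C.HasTailedTriangle c A (u + 1)) {P : Finset V → Finset V → Prop} (hP : ∀ U, P ∅ U)
    (hinsert : ∀ D U, ∀ w ∈ A, w ∉ D → w ∉ U → C.IsSeparated c A u D U →
      C.IsSeparated c A u (insert w D) U → P D U → P (insert w D) U)
    (herase : ∀ D U, ∀ w ∈ U, C.IsSeparated c A u D U → C.IsSeparated c A u D (U.erase w) →
      P D U → P D (U.erase w)) : ∃ D ⊆ A, A.card ≤ D.card + u ∧ P D ∅ := by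
  suffices hsearch : ∀ n l D U, (A \ D).card + U.card = n → C.IsSearchState c A l D U → P D U →
      ∃ D ⊆ A, A.card ≤ D.card + u ∧ P D ∅ from hsearch _ _ _ _ rfl ht.isSearchState (hP _)
  intro n
  induction n using Nat.strong_induction_on with
  | _ n ih =>
    rintro l D U rfl h hDU
    have hsep := h.isSeparated hu
    obtain rfl | hU := U.eq_empty_or_nonempty
    · exact ⟨D, hsep.left_subset, by simpa using hsep.card_le, hDU⟩
    obtain ⟨l', w, hw, h'⟩ | ⟨l', w, hwA, hwD, hwU, h'⟩ := h.exists_step hA hU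
    · have := Finset.card_erase_lt_of_mem hw
      exact ih _ (by omega) l' _ _ rfl h' (herase D U w hw hsep (h'.isSeparated hu) hDU)
    · have : (A \ insert w D).card < (A \ D).card := by
        rw [Finset.sdiff_insert]
        exact Finset.card_erase_lt_of_mem (Finset.mem_sdiff.mpr ⟨hwA, hwD⟩)
      exact ih _ (by omega) l' _ _ rfl h' (hinsert D U w hwA hwD hwU hsep (h'.isSeparated hu) hDU)

end Search

section MeetsTriangle

/-- Some vertex of `A` lies in a triangle of colour `c` in `W`. -/
def MeetsTriangle (C : PairColoring V κ) (c : κ) (W A : Finset V) : Prop :=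
  ∃ x ∈ A, ∃ y z, C.IsTriangle c W x y z

theorem IsTriangle.meetsTriangle (h : C.IsTriangle c A x y z) : C.MeetsTriangle c A A :=
  ⟨x, h.adj₁₂.left_mem, y, z, h⟩

theorem IsBiclique.not_isTriangle {W : Finset V} (hXY : C.IsBiclique c W (u / 2 + 1) X Y)
    (hu : 2 ≤ u) (hW : ¬ C.HasTailedTriangle c W (u + 1)) (hw : w ∈ X ∪ Y)
    (hxw : C.Reachable c W x w) : ¬ C.IsTriangle c W x y z := fun h =>
  hW ((h.rotate.hasTailedTriangle_of_isBiclique hXY (by omega) hw hxw).mono subset_rfl (by omega))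

theorem IsBiclique.not_meetsTriangle {W : Finset V} (hXY : C.IsBiclique c A (u / 2 + 1) X Y)
    (hu : 2 ≤ u) (hW : ¬ C.HasTailedTriangle c W (u + 1)) (hAW : A ⊆ W) (hA : C.Connected c A) :
    ¬ C.MeetsTriangle c W A := by
  rintro ⟨x, hx, y, z, h⟩
  obtain ⟨w, hw⟩ := Finset.card_pos.mp (Nat.zero_lt_succ _ |>.trans_le hXY.le_card_left)
  exact (hXY.mono_set hAW).not_isTriangle hu hW (Finset.mem_union_left Y hw)
    ((hA x hx w (hXY.left_subset hw)).mono hAW) h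

end MeetsTriangle

section TwoColors

variable {r b : κ}

theorem MeetsTriangle.exists_isBiclique_of_two_colors (ht : C.MeetsTriangle r A A)
    (hconn : C.Connected r A) (hr : ¬ C.HasTailedTriangle r A (u + 1))
    (hrb : ∀ x ∈ A, ∀ y ∈ A, x ≠ y → C x y = r ∨ C x y = b) (hA : 2 * u < A.card) :
    ∃ X Y, C.IsBiclique b A (u / 2 + 1) X Y := by
  by_contra! hno
  obtain ⟨x, -, y, z, ht⟩ := ht
  have hinsert : ∀ D U, ∀ w ∈ A, w ∉ D → w ∉ U → C.IsSeparated r A u D U →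
      C.IsSeparated r A u (insert w D) U → D.card ≤ u / 2 → (insert w D).card ≤ u / 2 := by
    intro D U w _ hwD _ hsep₀ hsep hD
    by_contra hD'
    have := Finset.card_insert_of_notMem hwD
    have := hsep₀.card_le
    refine hno (insert w D) U ⟨hsep.left_subset, hsep.right_subset, hsep.disjoint, fun x hx y hy =>
      (hrb x (hsep.left_subset hx) y (hsep.right_subset hy) ?_).resolve_left
        (hsep.color_ne x hx y hy), by omega, by omega⟩
    exact fun e => Finset.disjoint_left.mp hsep.disjoint hx (e ▸ hy)
  obtain ⟨D, -, hAD, hD⟩ := ht.search_induction hconn hr (P := fun D _ => D.card ≤ u / 2)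
    (fun _ => Nat.zero_le _) hinsert (fun _ _ _ _ _ _ hD => hD)
  omega

theorem hasTailedTriangle_of_forall_eq (hu : 2 ≤ u) (hA : u < A.card)
    (hr : ∀ x ∈ A, ∀ y ∈ A, x ≠ y → C x y = r) : C.HasTailedTriangle r A (u + 1) := by
  have hadj : ∀ x ∈ A, ∀ y ∈ A, x ≠ y → C.Adj r A x y := fun x hx y hy hxy =>
    ⟨hx, hy, hxy, hr x hx y hy hxy⟩
  obtain ⟨x, hx, y, hy, z, hz, hxy, hxz, hyz⟩ :=
    Finset.two_lt_card.mp (show 2 < A.card by omega)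
  refine IsTriangle.hasTailedTriangle_of_degree
    ⟨hadj x hx y hy hxy, hadj x hx z hz hxz, hadj y hy z hz hyz⟩ fun v hv => ?_
  have hsub : A.erase v ⊆ A.filter (C.Adj r A v) := fun w hw => Finset.mem_filter.mpr
    ⟨Finset.mem_of_mem_erase hw, hadj v hv w (Finset.mem_of_mem_erase hw)
      (Finset.ne_of_mem_erase hw).symm⟩
  have := Finset.card_le_card hsub
  rw [Finset.card_erase_of_mem hv] at this
  omega

/-- A vertex of small degree in `r` has many neighbours in `b`, which span a clique in `r` unless
that vertex lies in a triangle of colour `b`. -/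
theorem MeetsTriangle.hasTailedTriangle_of_two_colors (ht : C.MeetsTriangle r A A) (hu : 2 ≤ u)
    (hA : 2 * u < A.card) (hrb : ∀ x ∈ A, ∀ y ∈ A, x ≠ y → C x y = r ∨ C x y = b)
    (hdeg : ∀ v ∈ A, u ≤ (A.filter (C.Adj r A v)).card ∨ ¬ C.MeetsTriangle b A {v}) :
    C.HasTailedTriangle r A (u + 1) := by
  obtain ⟨x, -, y, z, ht⟩ := ht
  by_contra hno
  refine hno (ht.hasTailedTriangle_of_degree fun v hv => ?_)
  by_contra hv'
  have hcard := card_le_card_filter_adj_add hv (hrb v hv)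
  refine hno ((hasTailedTriangle_of_forall_eq hu (A := A.filter (C.Adj b A v)) (by omega)
    fun x hx y hy hxy => ?_).mono (Finset.filter_subset _ _) le_rfl)
  have hx := (Finset.mem_filter.mp hx).2
  have hy := (Finset.mem_filter.mp hy).2
  exact (hrb x hx.right_mem y hy.right_mem hxy).resolve_right fun hc =>
    (hdeg v hv).resolve_left hv' ⟨v, Finset.mem_singleton_self v, x, y, hx, hy, hx.right_mem,
      hy.right_mem, hxy, hc⟩

theorem MeetsTriangle.hasTailedTriangle_of_connected (ht : C.MeetsTriangle r A A) (hu : 2 ≤ u)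
    (hA : 2 * u < A.card) (hrb : ∀ x ∈ A, ∀ y ∈ A, x ≠ y → C x y = r ∨ C x y = b)
    (hconn : C.Connected r A) (hb : ¬ C.HasTailedTriangle b A (u + 1)) :
    C.HasTailedTriangle r A (u + 1) := by
  by_contra hr
  obtain ⟨X, Y, hXY⟩ := ht.exists_isBiclique_of_two_colors hconn hr hrb hA
  refine hr (ht.hasTailedTriangle_of_two_colors hu hA hrb fun v hv => ?_)
  by_cases hvXY : ∃ w ∈ X ∪ Y, C.Reachable b A v w
  · obtain ⟨w, hw, hvw⟩ := hvXY
    right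
    rintro ⟨x, hx, y, z, h⟩
    rw [Finset.mem_singleton] at hx
    exact hXY.not_isTriangle hu hb hw (hx ▸ hvw) h
  · push Not at hvXY
    have hsub : X ∪ Y ⊆ A.filter (C.Adj r A v) := by
      intro w hw
      have hwA := Finset.union_subset hXY.left_subset hXY.right_subset hw
      have hvw : v ≠ w := fun e => hvXY w hw (e ▸ .refl)
      exact Finset.mem_filter.mpr ⟨hwA, hv, hwA, hvw, (hrb v hv w hwA hvw).resolve_right
        (color_ne_of_not_reachable hv hwA (hvXY w hw))⟩
    have hcard := Finset.card_le_card hsub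
    rw [Finset.card_union_of_disjoint hXY.disjoint] at hcard
    have := hXY.le_card_left
    have := hXY.le_card_right
    exact .inl (by omega)

theorem card_le_of_two_colors (hu : 3 ≤ u)
    (hrb : ∀ x ∈ A, ∀ y ∈ A, x ≠ y → C x y = r ∨ C x y = b)
    (hr : ¬ C.HasTailedTriangle r A (u + 1)) (hb : ¬ C.HasTailedTriangle b A (u + 1)) :
    A.card ≤ 2 * u := by
  by_contra! hA
  have hu2 : 2 ≤ u := by omega
  have hbr : ∀ x ∈ A, ∀ y ∈ A, x ≠ y → C x y = b ∨ C x y = r :=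
    fun x hx y hy hxy => (hrb x hx y hy hxy).symm
  have hmono : ∀ {c : κ}, ∀ v ∈ A, C.MeetsTriangle c A {v} → C.MeetsTriangle c A A :=
    fun v hv ⟨x, hx, h⟩ => ⟨x, Finset.mem_singleton.mp hx ▸ hv, h⟩
  have htriangle : C.MeetsTriangle r A A ∨ C.MeetsTriangle b A A := by
    obtain ⟨x, y, z, h⟩ := exists_isTriangle_of_six_le_card (by omega) hrb
    exact h.imp IsTriangle.meetsTriangle IsTriangle.meetsTriangle
  by_cases htr : C.MeetsTriangle r A A
  · by_cases htb : C.MeetsTriangle b A A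
    · obtain hc | hc := connected_or_connected hrb
      · exact hr (htr.hasTailedTriangle_of_connected hu2 hA hrb hc hb)
      · exact hb (htb.hasTailedTriangle_of_connected hu2 hA hbr hc hr)
    · exact hr (htr.hasTailedTriangle_of_two_colors hu2 hA hrb
        fun v hv => .inr fun h => htb (hmono v hv h))
  · exact hb ((htriangle.resolve_left htr).hasTailedTriangle_of_two_colors hu2 hA hbr
      fun v hv => .inr fun h => htr (hmono v hv h))

end TwoColors

section SmallParts

variable {D U D' U' : Finset V} {f : V → V} {r b : κ}

/-- Comparison of the traces of `D` and of `U` on the fibre of `f` over `v`. -/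
def IsHeavy (f : V → V) (D U : Finset V) (v : V) : Prop :=
  (U.filter (f · = v)).card ≤ (D.filter (f · = v)).card

/-- The part of `D` in the fibres of `f` that meet `D` at least as much as `U`. -/
noncomputable def heavyPart (f : V → V) (D U : Finset V) : Finset V :=
  D.filter fun x => IsHeavy f D U (f x)

/-- The part of `U` in the fibres of `f` that meet `D` less than `U`. No fibre meets both
`lightPart f D U` and `heavyPart f D U`. -/
noncomputable def lightPart (f : V → V) (D U : Finset V) : Finset V :=
  U.filter fun x => ¬ IsHeavy f D U (f x)

theorem card_filter_le_of_forall_fiber {P : V → Prop}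
    (h : ∀ v, P v → (D.filter (f · = v)).card ≤ (U.filter (f · = v)).card) :
    (D.filter fun x => P (f x)).card ≤ (U.filter fun x => P (f x)).card := by
  have hmaps : ∀ S ⊆ D ∪ U, ∀ x ∈ S.filter fun x => P (f x), f x ∈ (D ∪ U).image f :=
    fun S hS x hx => Finset.mem_image_of_mem f (hS (Finset.mem_of_mem_filter x hx))
  rw [Finset.card_eq_sum_card_fiberwise (hmaps D Finset.subset_union_left),
    Finset.card_eq_sum_card_fiberwise (hmaps U Finset.subset_union_right)]
  refine Finset.sum_le_sum fun v _ => ?_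
  by_cases hv : P v
  · have hP : ∀ S : Finset V,
        (S.filter fun x => P (f x)).filter (f · = v) = S.filter (f · = v) := by
      intro S
      ext x
      simp only [Finset.mem_filter]
      grind
    rw [hP, hP]
    exact h v hv
  · rw [Finset.filter_filter, Finset.filter_false_of_mem]
    · exact Nat.zero_le _
    · rintro x - ⟨hx, rfl⟩
      exact hv hx

theorem card_add_card_le_heavyPart_lightPart :
    D.card + U.card ≤ 2 * ((heavyPart f D U).card + (lightPart f D U).card) := by
  have hheavy : (U.filter fun x => IsHeavy f D U (f x)).card ≤ (heavyPart f D U).card :=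
    card_filter_le_of_forall_fiber (P := IsHeavy f D U) fun _ => id
  have hlight : (D.filter fun x => ¬ IsHeavy f D U (f x)).card ≤ (lightPart f D U).card := by
    unfold lightPart
    convert card_filter_le_of_forall_fiber (P := fun v => ¬ IsHeavy f D U v)
      fun _ h => (not_le.mp h).le
  have hD := D.card_filter_add_card_filter_not fun x => IsHeavy f D U (f x)
  have hU := U.card_filter_add_card_filter_not fun x => IsHeavy f D U (f x)
  unfold heavyPart lightPart at *
  omega

theorem heavyPart_subset_union (hD : D' ⊆ insert w D) (hU : U.erase w ⊆ U') :
    heavyPart f D' U' ⊆ heavyPart f D U ∪ D'.filter (f · = f w) := by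
  intro x hx
  obtain ⟨hxD, hheavy⟩ := Finset.mem_filter.mp hx
  by_cases hxw : f x = f w
  · exact Finset.mem_union_right _ (Finset.mem_filter.mpr ⟨hxD, hxw⟩)
  · have hne : ∀ y, f y = f x → y ≠ w := fun y hy e => hxw (by rw [← hy, e])
    have hDx : D'.filter (f · = f x) ⊆ D.filter (f · = f x) := by grind
    have hUx : U.filter (f · = f x) ⊆ U'.filter (f · = f x) := by grind
    refine Finset.mem_union_left _ (Finset.mem_filter.mpr ⟨by grind, ?_⟩)
    exact (Finset.card_le_card hUx).trans (hheavy.trans (Finset.card_le_card hDx))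

/-- If a fibre becomes heavy in a step of a search, then it meets `D` and `U` about equally. -/
theorem card_heavyPart_le (hD : D' ⊆ insert w D) (hU : U.erase w ⊆ U')
    (hs : (D'.filter (f · = f w)).card + (U'.filter (f · = f w)).card ≤ s)
    (hw : ¬ IsHeavy f D U (f w) → (D'.filter (f · = f w)).card ≤ (U'.filter (f · = f w)).card) :
    (heavyPart f D' U').card ≤ (heavyPart f D U).card + max 1 (s / 2) := by
  by_cases hheavy : IsHeavy f D U (f w)
  · have hsub : heavyPart f D' U' ⊆ insert w (heavyPart f D U) := by
      intro x hx
      have := heavyPart_subset_union hD hU hx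
      simp only [heavyPart, Finset.mem_union, Finset.mem_insert, Finset.mem_filter] at this ⊢
      grind
    have := (Finset.card_le_card hsub).trans (Finset.card_insert_le _ _)
    omega
  · have := (Finset.card_le_card (heavyPart_subset_union (f := f) hD hU)).trans
      (Finset.card_union_le _ _)
    have := hw hheavy
    omega

theorem IsSeparated.isBiclique_heavyPart_lightPart (h : C.IsSeparated r A u D U)
    (hrb : ∀ x ∈ A, ∀ y ∈ A, f x ≠ f y → C x y = r ∨ C x y = b)
    (hn : n ≤ (heavyPart f D U).card) (hn' : n ≤ (lightPart f D U).card) :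
    C.IsBiclique b A n (heavyPart f D U) (lightPart f D U) where
  left_subset := (Finset.filter_subset _ _).trans h.left_subset
  right_subset := (Finset.filter_subset _ _).trans h.right_subset
  disjoint := Finset.disjoint_of_subset_left (Finset.filter_subset _ _)
    (Finset.disjoint_of_subset_right (Finset.filter_subset _ _) h.disjoint)
  color x hx y hy := by
    obtain ⟨hxD, hx⟩ := Finset.mem_filter.mp hx
    obtain ⟨hyU, hy⟩ := Finset.mem_filter.mp hy
    exact (hrb x (h.left_subset hxD) y (h.right_subset hyU) fun e => hy (e ▸ hx)).resolve_left
      (h.color_ne x hxD y hyU)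
  le_card_left := hn
  le_card_right := hn'

theorem IsSeparated.card_fiber_add_le (h : C.IsSeparated r A u D U)
    (hf : ∀ v, (A.filter (f · = v)).card ≤ s) :
    (D.filter (f · = v)).card + (U.filter (f · = v)).card ≤ s := by
  rw [← Finset.card_union_of_disjoint (Finset.disjoint_of_subset_left (Finset.filter_subset _ _)
    (Finset.disjoint_of_subset_right (Finset.filter_subset _ _) h.disjoint)), ← Finset.filter_union]
  exact (Finset.card_le_card (Finset.filter_subset_filter _
    (Finset.union_subset h.left_subset h.right_subset))).trans (hf v)

theorem MeetsTriangle.exists_isBiclique_of_small_fibers (ht : C.MeetsTriangle r A A) (hu : 3 ≤ u)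
    (hconn : C.Connected r A) (hr : ¬ C.HasTailedTriangle r A (u + 1))
    (hrb : ∀ x ∈ A, ∀ y ∈ A, f x ≠ f y → C x y = r ∨ C x y = b)
    (hf : ∀ v, (A.filter (f · = v)).card ≤ u / 2) (hA : 5 * u < A.card + 3 * (u / 2)) :
    ∃ X Y, C.IsBiclique b A (u / 2 + 1) X Y := by
  by_contra! hno
  have hsmall : ∀ {D U D' U' : Finset V}, C.IsSeparated r A u D' U' →
      (heavyPart f D U).card ≤ u / 2 →
      (heavyPart f D' U').card ≤ (heavyPart f D U).card + max 1 (u / 2 / 2) →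
      (heavyPart f D' U').card ≤ u / 2 := by
    intro D U D' U' hsep hD hD'
    by_contra hlarge
    have := hsep.card_le
    have := card_add_card_le_heavyPart_lightPart (f := f) (D := D') (U := U')
    exact hno _ _ (hsep.isBiclique_heavyPart_lightPart hrb (by omega) (by omega))
  have hinsert : ∀ D U, ∀ w ∈ A, w ∉ D → w ∉ U → C.IsSeparated r A u D U →
      C.IsSeparated r A u (insert w D) U → (heavyPart f D U).card ≤ u / 2 →
      (heavyPart f (insert w D) U).card ≤ u / 2 := by
    intro D U w _ hwD _ _ hsep hD
    refine hsmall hsep hD (card_heavyPart_le subset_rfl (U.erase_subset w)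
      (hsep.card_fiber_add_le hf) fun hw => ?_)
    rw [Finset.filter_insert, if_pos rfl, Finset.card_insert_of_notMem (by simp [hwD])]
    exact not_le.mp hw
  have herase : ∀ D U, ∀ w ∈ U, C.IsSeparated r A u D U → C.IsSeparated r A u D (U.erase w) →
      (heavyPart f D U).card ≤ u / 2 → (heavyPart f D (U.erase w)).card ≤ u / 2 := by
    intro D U w hwU _ hsep hD
    refine hsmall hsep hD (card_heavyPart_le (D.subset_insert w) subset_rfl
      (hsep.card_fiber_add_le hf) fun hw => ?_)
    rw [Finset.filter_erase, Finset.card_erase_of_mem (by simp [hwU])]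
    exact Nat.le_sub_one_of_lt (not_le.mp hw)
  obtain ⟨x, -, y, z, ht⟩ := ht
  obtain ⟨D, -, hAD, hD⟩ := ht.search_induction hconn hr
    (P := fun D U => (heavyPart f D U).card ≤ u / 2) (fun _ => by simp [heavyPart]) hinsert herase
  have hheavy : heavyPart f D ∅ = D := Finset.filter_true_of_mem fun x _ => by simp [IsHeavy]
  rw [hheavy] at hD
  omega

theorem card_filter_ne_le_of_small_fibers (hu : 2 ≤ u) (hrA : C.Connected r A)
    (hr : ¬ C.HasTailedTriangle r A (u + 1)) (ht : C.MeetsTriangle r A A)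
    (hb : ¬ C.MeetsTriangle b A A) (hrb : ∀ x ∈ A, ∀ y ∈ A, f x ≠ f y → C x y = r ∨ C x y = b)
    (hf : ∀ v, (A.filter (f · = v)).card ≤ u / 2) (hv : v ∈ A) :
    (A.filter fun w => f v ≠ f w ∧ C v w = b).card ≤ 3 * (u / 2) := by
  by_contra! hlt
  have hsub : A.filter (fun w => f v ≠ f w ∧ C v w = b) ⊆ A := Finset.filter_subset _ _
  obtain ⟨X, Y, hX, hY, hXc, hYc, hXY⟩ := exists_split_of_small_fibers
    (fun p => (Finset.card_le_card (Finset.filter_subset_filter _ hsub)).trans (hf p)) hlt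
  refine IsBiclique.not_meetsTriangle (A := A) ⟨hX.trans hsub, hY.trans hsub,
    Finset.disjoint_left.mpr fun x hx hy => hXY x hx x hy rfl, fun x hx y hy => ?_, hXc, hYc⟩
    hu hr subset_rfl hrA ht
  have hxy := hXY x hx y hy
  obtain ⟨hxA, hvx, cx⟩ := Finset.mem_filter.mp (hX hx)
  obtain ⟨hyA, hvy, cy⟩ := Finset.mem_filter.mp (hY hy)
  refine (hrb x hxA y hyA hxy).resolve_right fun hc => hb (IsTriangle.meetsTriangle (x := v)
    ⟨⟨hv, hxA, ?_, cx⟩, ⟨hv, hyA, ?_, cy⟩, hxA, hyA, ?_, hc⟩)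
  exacts [fun e => hvx (e ▸ rfl), fun e => hvy (e ▸ rfl), fun e => hxy (e ▸ rfl)]

theorem MeetsTriangle.hasTailedTriangle_of_small_fibers (ht : C.MeetsTriangle r A A) (hu : 3 ≤ u)
    (hrA : C.Connected r A) (hbA : C.Connected b A)
    (hrb : ∀ x ∈ A, ∀ y ∈ A, f x ≠ f y → C x y = r ∨ C x y = b)
    (hf : ∀ v, (A.filter (f · = v)).card ≤ u / 2) (hA : 5 * u < A.card + 3 * (u / 2))
    (hb : ¬ C.HasTailedTriangle b A (u + 1)) : C.HasTailedTriangle r A (u + 1) := by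
  by_contra hr
  obtain ⟨X, Y, hXY⟩ := ht.exists_isBiclique_of_small_fibers hu hrA hr hrb hf hA
  have hnb := hXY.not_meetsTriangle (by omega) hb subset_rfl hbA
  obtain ⟨x, -, y, z, ht'⟩ := id ht
  refine hr (ht'.hasTailedTriangle_of_degree fun v hv => ?_)
  have hsub : A ⊆ A.filter (C.Adj r A v) ∪ A.filter (f · = f v) ∪
      A.filter fun w => f v ≠ f w ∧ C v w = b := by
    intro w hw
    by_cases hvw : f v = f w
    · simp [hw, hvw]
    · have hne : v ≠ w := fun e => hvw (e ▸ rfl)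
      obtain h | h := hrb v hv w hw hvw
      · have : C.Adj r A v w := ⟨hv, hw, hne, h⟩
        simp [hw, this]
      · simp [hw, hvw, h]
  have := (Finset.card_le_card hsub).trans ((Finset.card_union_le _ _).trans
    (Nat.add_le_add_right (Finset.card_union_le _ _) _))
  have := card_filter_ne_le_of_small_fibers (by omega) hrA hr ht hnb hrb hf hv
  have := hf (f v)
  omega

end SmallParts

section Reroute

variable {C' : PairColoring V κ} {W E Z : Finset V}

theorem IsPath.exists_reroute (hp : C'.IsPath c A (x :: l)) (hAW : A ⊆ W)
    (hE : ∀ a ∈ A, ∀ d ∈ A, a ≠ d → C' a d = c → C a d ≠ c → a ∈ E ∧ d ∈ E) (hZW : Z ⊆ W)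
    (hZE : ∀ z ∈ Z, ∀ e ∈ E, C e z = c) (hZ : ∀ z ∈ Z, z ∉ x :: l)
    (hcard : (E ∩ (x :: l).toFinset).card ≤ Z.card + 1) :
    ∃ l', C.IsPath c W (x :: l') ∧ l.length ≤ l'.length ∧ ∀ v ∈ l', v ∈ l ∨ v ∈ Z := by
  induction l generalizing x Z with
  | nil => exact ⟨[], isPath_singleton.mpr (hAW (hp.mem x (by simp))), le_rfl, by simp⟩
  | cons y l ih =>
    obtain ⟨hx, hxl, hxy, hp⟩ := isPath_cons_cons.mp hp
    have hne : x ≠ y := fun e => hxl (by simp [e])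
    have hZl : ∀ z ∈ Z, z ∉ y :: l := fun z hz h => hZ z hz (List.mem_cons_of_mem _ h)
    rw [List.toFinset_cons] at hcard
    by_cases hc : C x y = c
    · obtain ⟨l', hl', hlen, hsub⟩ := ih hp hZW hZE hZl ((Finset.card_le_card
        (Finset.inter_subset_inter_left (Finset.subset_insert _ _))).trans hcard)
      refine ⟨y :: l', isPath_cons_cons.mpr ⟨hAW hx, ?_, hc, hl'⟩, by simpa, ?_⟩ <;> grind
    · obtain ⟨hxE, hyE⟩ := hE x hx y (hp.mem y (by simp)) hne hxy hc
      rw [Finset.inter_insert_of_mem hxE, Finset.card_insert_of_notMem (by simp_all)] at hcard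
      have hpos := Finset.card_pos.mpr ⟨y, show y ∈ E ∩ (y :: l).toFinset by simp [hyE]⟩
      obtain ⟨z, hz⟩ := Finset.card_pos.mp (show 0 < Z.card by omega)
      obtain ⟨l', hl', hlen, hsub⟩ := ih hp ((Z.erase_subset z).trans hZW)
        (fun a ha => hZE a (Finset.mem_of_mem_erase ha))
        (fun a ha => hZl a (Finset.mem_of_mem_erase ha))
        (by rw [Finset.card_erase_of_mem hz]; omega)
      have hzy : C z y = c := by rw [C.symm, hZE z hz y hyE]
      refine ⟨z :: y :: l', isPath_cons_cons.mpr ⟨hAW hx, ?_, hZE z hz x hxE,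
        isPath_cons_cons.mpr ⟨hZW hz, ?_, hzy, hl'⟩⟩, by simp only [List.length_cons]; omega, ?_⟩
      all_goals grind

theorem HasTailedTriangle.exists_length_eq (h : C.HasTailedTriangle c A m) (hm : 3 ≤ m) :
    ∃ x y z l, C.IsTailedTriangle c A (x :: y :: z :: l) ∧ l.length + 3 = m := by
  obtain ⟨_, ⟨hp, x, y, z, l, rfl, hxz⟩, hlen⟩ := h
  have hinfix : x :: y :: z :: l.take (m - 3) <:+: x :: y :: z :: l :=
    ⟨[], l.drop (m - 3), by simp⟩
  refine ⟨x, y, z, l.take (m - 3), ⟨hp.infix hinfix, x, y, z, _, rfl, hxz⟩, ?_⟩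
  simp only [List.length_cons] at hlen
  rw [List.length_take]
  omega

end Reroute

section Absorbing

variable {K K' : Finset κ} {A₁ A₂ P W F : Finset V} {γ : V → κ} {b : κ} {t : ℕ}

/-- A colouring of the pairs in `A` by colours from `K` in which there is neither a rainbow triangle
nor a monochromatic tailed triangle on `t` vertices. -/
structure IsAdmissible (C : PairColoring V κ) (K : Finset κ) (A : Finset V) (t : ℕ) : Prop where
  mem : ∀ x ∈ A, ∀ y ∈ A, x ≠ y → C x y ∈ K
  noRainbow : C.NoRainbow A
  free : ∀ c, ¬ C.HasTailedTriangle c A t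

/-- The vertices of `W` outside `A` that send colour `c` to all of `A`. -/
noncomputable def colorNbrs (C : PairColoring V κ) (c : κ) (W A : Finset V) : Finset V :=
  (W \ A).filter fun v => ∀ a ∈ A, C v a = c

theorem mem_colorNbrs : v ∈ C.colorNbrs c W A ↔ (v ∈ W ∧ v ∉ A) ∧ ∀ a ∈ A, C v a = c := by
  rw [colorNbrs, Finset.mem_filter, Finset.mem_sdiff]

/-- The colouring in which each vertex `v` of `B` sends colour `γ v` to all vertices outside `B`
and to the vertices of `B` with the same value of `γ`. -/
noncomputable def recolor (C : PairColoring V κ) (B : Finset V) (γ : V → κ) :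
    PairColoring V κ where
  toFun x y :=
    if x ∈ B then if y ∈ B then if γ x = γ y then γ x else C x y else γ x
    else if y ∈ B then γ y else C x y
  symm x y := by
    have := C.symm x y
    grind

theorem recolor_of_mem (hx : x ∈ B) (hy : y ∈ B) :
    C.recolor B γ x y = if γ x = γ y then γ x else C x y := by
  simp [recolor, hx, hy]

theorem recolor_of_mem_of_notMem (hx : x ∈ B) (hy : y ∉ B) : C.recolor B γ x y = γ x := by
  simp [recolor, hx, hy]

theorem recolor_of_notMem (hx : x ∉ B) (hy : y ∉ B) : C.recolor B γ x y = C x y := by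
  simp [recolor, hx, hy]

/-- The situation in which the vertices of `B` can be made part of `P` by recolouring: they do not
distinguish the vertices of `A₁ ∪ A₂`, where `A₁ ⊆ P` and `A₂` is disjoint from `P`. Paths through
edges that have been recoloured are rerouted through `A₂`, or through `A₁` if that set is large. -/
structure IsAbsorbing (C : PairColoring V κ) (W P B A₁ A₂ : Finset V) (γ : V → κ) (b : κ)
    (s t : ℕ) : Prop where
  left_subset : A₁ ⊆ P
  right_subset : A₂ ⊆ W
  union_subset : P ∪ B ⊆ W
  disjoint : Disjoint P B
  disjoint_right : Disjoint (P ∪ B) A₂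
  color_left : ∀ v ∈ B, ∀ a ∈ A₁, C v a = γ v
  color_right : ∀ v ∈ B, ∀ a ∈ A₂, C v a = γ v
  color_sdiff : ∀ x ∈ P, x ∉ A₁ → ∀ a ∈ A₁, C x a = b
  color_eq_or : ∀ v ∈ B, ∀ x ∈ P, C v x = γ v ∨ γ v = b
  card_le : ∀ c, (C.colorNbrs c (P ∪ B) A₁).card ≤ s
  lt_card : s < A₂.card
  eq_or_le_card : P = A₁ ∨ t ≤ A₁.card
  exists_adj : ∀ v ∈ B, ∃ p q, C.Adj (γ v) A₂ p q

theorem IsAbsorbing.color_eq_or_color_eq (h : C.IsAbsorbing W P B A₁ A₂ γ b s t)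
    (hW : C.NoRainbow W) (hx : x ∈ B) (hy : y ∈ B) (hxy : x ≠ y) (hγ : γ x ≠ γ y) :
    C x y = γ x ∨ C x y = γ y := by
  obtain ⟨a, ha⟩ := Finset.card_pos.mp (Nat.zero_lt_of_lt h.lt_card)
  have hne : ∀ v ∈ B, v ≠ a := fun v hv e =>
    Finset.disjoint_left.mp h.disjoint_right (Finset.mem_union_right _ hv) (e ▸ ha)
  have hBW := Finset.union_subset_right h.union_subset
  have := hW x (hBW hx) y (hBW hy) a (h.right_subset ha) hxy (hne y hy) (hne x hx)
  rw [h.color_right x hx a ha, h.color_right y hy a ha] at this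
  tauto

theorem IsAbsorbing.mem_colorNbrs (h : C.IsAbsorbing W P B A₁ A₂ γ b s t) (hv : v ∈ B) :
    v ∈ C.colorNbrs (γ v) (P ∪ B) A₁ :=
  PairColoring.mem_colorNbrs.mpr ⟨⟨Finset.mem_union_right _ hv, fun hvA =>
    Finset.disjoint_left.mp h.disjoint (h.left_subset hvA) hv⟩, h.color_left v hv⟩

theorem IsAbsorbing.mem_colorNbrs_of_color_ne (h : C.IsAbsorbing W P B A₁ A₂ γ b s t) (hv : v ∈ B)
    (hx : x ∈ P) (hvx : C v x ≠ γ v) : x ∈ C.colorNbrs (γ v) (P ∪ B) A₁ := by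
  have hxA : x ∉ A₁ := fun hxA => hvx (h.color_left v hv x hxA)
  rw [(h.color_eq_or v hv x hx).resolve_left hvx]
  exact PairColoring.mem_colorNbrs.mpr ⟨⟨Finset.mem_union_left _ hx, hxA⟩, h.color_sdiff x hx hxA⟩

theorem IsAbsorbing.mem_of_recolor_eq (h : C.IsAbsorbing W P B A₁ A₂ γ b s t) (hx : x ∈ P ∪ B)
    (hy : y ∈ P ∪ B) (hxy : C.recolor B γ x y = c) (hne : C x y ≠ c) :
    (x ∈ C.colorNbrs c (P ∪ B) A₁ ∧ y ∈ C.colorNbrs c (P ∪ B) A₁) ∧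
      (x ∈ B ∧ γ x = c ∨ y ∈ B ∧ γ y = c) := by
  by_cases hxB : x ∈ B <;> by_cases hyB : y ∈ B
  · rw [recolor_of_mem hxB hyB] at hxy
    split_ifs at hxy with hγ
    · exact ⟨⟨hxy ▸ h.mem_colorNbrs hxB, hxy ▸ hγ ▸ h.mem_colorNbrs hyB⟩, .inl ⟨hxB, hxy⟩⟩
    · exact absurd hxy hne
  · rw [recolor_of_mem_of_notMem hxB hyB] at hxy
    subst hxy
    have hyP := (Finset.mem_union.mp hy).resolve_right hyB
    exact ⟨⟨h.mem_colorNbrs hxB, h.mem_colorNbrs_of_color_ne hxB hyP hne⟩, .inl ⟨hxB, rfl⟩⟩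
  · rw [PairColoring.symm, recolor_of_mem_of_notMem hyB hxB] at hxy
    subst hxy
    rw [C.symm] at hne
    have hxP := (Finset.mem_union.mp hx).resolve_right hxB
    exact ⟨⟨h.mem_colorNbrs_of_color_ne hyB hxP hne, h.mem_colorNbrs hyB⟩, .inr ⟨hyB, rfl⟩⟩
  · exact absurd ((recolor_of_notMem hxB hyB).symm.trans hxy) hne

theorem IsAbsorbing.notMem_of_mem_right (h : C.IsAbsorbing W P B A₁ A₂ γ b s t) (hv : v ∈ A₂) :
    v ∉ P ∪ B :=
  Finset.disjoint_right.mp h.disjoint_right hv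

theorem IsAbsorbing.color_of_eq (h : C.IsAbsorbing W P B A₁ A₂ γ b s t) (hP : P = A₁)
    (hx : x ∈ C.colorNbrs c (P ∪ B) A₁) (hA₁ : A₁.Nonempty) (hv : v ∈ A₂) : C x v = c := by
  obtain ⟨⟨hxPB, hxA⟩, hxc⟩ := PairColoring.mem_colorNbrs.mp hx
  obtain ⟨a, ha⟩ := hA₁
  have hxB := (Finset.mem_union.mp hxPB).resolve_left fun hxP => hxA (hP ▸ hxP)
  rw [h.color_right x hxB v hv, ← h.color_left x hxB a ha, hxc a ha]

theorem card_inter_le_card_sdiff_of_disjoint {E L : Finset V} (hAE : Disjoint A E)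
    (hL : L.card ≤ A.card) : (E ∩ L).card ≤ (A \ L).card := by
  have hsub : A ∩ L ∪ E ∩ L ⊆ L :=
    Finset.union_subset Finset.inter_subset_right Finset.inter_subset_right
  have hdisj : Disjoint (A ∩ L) (E ∩ L) := Finset.disjoint_of_subset_left Finset.inter_subset_left
    (Finset.disjoint_of_subset_right Finset.inter_subset_left hAE)
  have := Finset.card_le_card hsub
  rw [Finset.card_union_of_disjoint hdisj] at this
  have := Finset.card_sdiff_add_card_inter A L
  omega

theorem IsAbsorbing.exists_detours (h : C.IsAbsorbing W P B A₁ A₂ γ b s t) (hA₁ : A₁.Nonempty)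
    {L : Finset V} (hL : L ⊆ P ∪ B) (hLt : L.card ≤ t) (hF : F ⊆ A₂) (hF2 : F.card ≤ 2) (c : κ) :
    ∃ Z ⊆ W, (∀ z ∈ Z, ∀ e ∈ C.colorNbrs c (P ∪ B) A₁, C e z = c) ∧ (∀ z ∈ Z, z ∉ L ∧ z ∉ F) ∧
      (C.colorNbrs c (P ∪ B) A₁ ∩ L).card ≤ Z.card + 1 := by
  obtain hP | hA₁t := h.eq_or_le_card
  · refine ⟨A₂ \ F, Finset.sdiff_subset.trans h.right_subset, fun z hz e he => ?_,
      fun z hz => ?_, ?_⟩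
    · exact h.color_of_eq hP he hA₁ (Finset.mem_sdiff.mp hz).1
    · have hz := Finset.mem_sdiff.mp hz
      exact ⟨fun hzL => h.notMem_of_mem_right hz.1 (hL hzL), hz.2⟩
    · rw [Finset.card_sdiff_of_subset hF]
      have := h.card_le c
      have := h.lt_card
      have := Finset.card_le_card
        (Finset.inter_subset_left : C.colorNbrs c (P ∪ B) A₁ ∩ L ⊆ C.colorNbrs c (P ∪ B) A₁)
      omega
  · have hsub : A₁ ⊆ P ∪ B := h.left_subset.trans Finset.subset_union_left
    refine ⟨A₁ \ L, Finset.sdiff_subset.trans (hsub.trans h.union_subset), fun z hz e he => ?_,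
      fun z hz => ?_, ?_⟩
    · exact (PairColoring.mem_colorNbrs.mp he).2 z (Finset.mem_sdiff.mp hz).1
    · have hz := Finset.mem_sdiff.mp hz
      exact ⟨hz.2, fun hzF => h.notMem_of_mem_right (hF hzF) (hsub hz.1)⟩
    · refine (card_inter_le_card_sdiff_of_disjoint ?_ (hLt.trans hA₁t)).trans (Nat.le_succ _)
      exact Finset.disjoint_right.mpr fun v hv => (PairColoring.mem_colorNbrs.mp hv).1.2

/-- A path of the new colouring that starts in `B` becomes, after rerouting, the tail of a triangle
whose other two vertices are in `A₂`. -/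
theorem IsAbsorbing.not_isPath (h : C.IsAbsorbing W P B A₁ A₂ γ b s t) (hA₁ : A₁.Nonempty)
    (hfree : ¬ C.HasTailedTriangle c W t) (hv : v ∈ B) (hγ : γ v = c)
    (hl : t ≤ l.length + 3) (hlt : l.length < t) :
    ¬ (C.recolor B γ).IsPath c (P ∪ B) (v :: l) := by
  intro hp
  obtain ⟨p, q, hpq⟩ := h.exists_adj v hv
  rw [hγ] at hpq
  have hF : ({p, q} : Finset V) ⊆ A₂ := by
    simp [Finset.insert_subset_iff, hpq.left_mem, hpq.right_mem]
  have hlen : (v :: l).toFinset.card ≤ t := (List.toFinset_card_le _).trans hlt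
  obtain ⟨Z, hZW, hZc, hZ, hZcard⟩ := h.exists_detours hA₁
    (fun w hw => hp.mem w (List.mem_toFinset.mp hw)) hlen hF Finset.card_le_two c
  obtain ⟨l', hp', hl', hsub⟩ := hp.exists_reroute h.union_subset
    (fun a ha d hd _ h₁ h₂ => (h.mem_of_recolor_eq ha hd h₁ h₂).1) hZW hZc
    (fun z hz hzl => (hZ z hz).1 (List.mem_toFinset.mpr hzl)) hZcard
  have hnotMem : ∀ w ∈ ({p, q} : Finset V), w ∉ l' := fun w hw hwl => (hsub w hwl).elim
    (fun hwl => h.notMem_of_mem_right (hF hw) (hp.mem w (List.mem_cons_of_mem _ hwl)))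
    fun hwZ => (hZ w hwZ).2 hw
  have hadj : ∀ w ∈ A₂, C.Adj c W w v := fun w hw => ⟨h.right_subset hw,
    h.union_subset (Finset.mem_union_right _ hv),
    fun e => h.notMem_of_mem_right hw (e ▸ Finset.mem_union_right _ hv),
    by rw [C.symm, h.color_right v hv w hw, hγ]⟩
  exact hfree ⟨_, hp'.isTailedTriangle ⟨hpq.mono h.right_subset, hadj p hpq.left_mem,
    hadj q hpq.right_mem⟩ (hnotMem p (by simp)) (hnotMem q (by simp)),
    by simp only [List.length_cons]; omega⟩

theorem IsAbsorbing.not_hasTailedTriangle_recolor (h : C.IsAbsorbing W P B A₁ A₂ γ b s t)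
    (hA₁ : A₁.Nonempty) (ht : 3 ≤ t) (hfree : ¬ C.HasTailedTriangle c W t) :
    ¬ (C.recolor B γ).HasTailedTriangle c (P ∪ B) t := by
  intro hT
  obtain ⟨x, y, z, l, hT, hlen⟩ := hT.exists_length_eq ht
  have htri := hT.isTriangle
  obtain ⟨hx, hxl, -, hp⟩ := isPath_cons_cons.mp hT.1
  obtain ⟨-, hyl, -, hpz⟩ := isPath_cons_cons.mp hp
  have hpx : (C.recolor B γ).IsPath c (P ∪ B) (x :: z :: l) := isPath_cons_cons.mpr
    ⟨hx, fun h => hxl (List.mem_cons_of_mem _ h), htri.adj₁₃.color, hpz⟩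
  have hBx : ¬ (x ∈ B ∧ γ x = c) := fun hB => h.not_isPath hA₁ hfree hB.1 hB.2
    (by simp only [List.length_cons]; omega) (by simp only [List.length_cons]; omega) hpx
  have hBy : ¬ (y ∈ B ∧ γ y = c) := fun hB => h.not_isPath hA₁ hfree hB.1 hB.2
    (by simp only [List.length_cons]; omega) (by simp only [List.length_cons]; omega) hp
  have hBz : ¬ (z ∈ B ∧ γ z = c) := fun hB => h.not_isPath hA₁ hfree hB.1 hB.2
    (by omega) (by omega) hpz
  have hadj : ∀ {a d}, ¬ (a ∈ B ∧ γ a = c) → ¬ (d ∈ B ∧ γ d = c) →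
      (C.recolor B γ).Adj c (P ∪ B) a d → C.Adj c W a d := fun ha hd had =>
    ⟨h.union_subset had.left_mem, h.union_subset had.right_mem, had.ne, by_contra fun hne =>
      (h.mem_of_recolor_eq had.left_mem had.right_mem had.color hne).2.elim ha hd⟩
  obtain ⟨Z, hZW, hZc, hZ, hZcard⟩ := h.exists_detours (L := (x :: y :: z :: l).toFinset) hA₁
    (fun w hw => hT.1.mem w (List.mem_toFinset.mp hw))
    ((List.toFinset_card_le _).trans hlen.le) (Finset.empty_subset _) (Nat.zero_le _) c
  obtain ⟨l', hp', hl', hsub⟩ := hpz.exists_reroute h.union_subset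
    (fun a ha d hd _ h₁ h₂ => (h.mem_of_recolor_eq ha hd h₁ h₂).1) hZW hZc
    (fun w hw hwl => (hZ w hw).1 (by simp_all))
    ((Finset.card_le_card (Finset.inter_subset_inter_left fun w hw => by simp_all)).trans hZcard)
  refine hfree ⟨_, hp'.isTailedTriangle ⟨hadj hBx hBy htri.adj₁₂, hadj hBx hBz htri.adj₁₃,
    hadj hBy hBz htri.adj₂₃⟩ (fun hxl' => ?_) (fun hyl' => ?_),
    by simp only [List.length_cons]; omega⟩
  · exact (hsub x hxl').elim (fun h => hxl (by simp [h])) fun h => (hZ x h).1 (by simp)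
  · exact (hsub y hyl').elim (fun h => hyl (by simp [h])) fun h => (hZ y h).1 (by simp)

theorem NoRainbow.recolor (hA : C.NoRainbow A)
    (hγ : ∀ x ∈ B, ∀ y ∈ B, x ≠ y → γ x ≠ γ y → C x y = γ x ∨ C x y = γ y) :
    (C.recolor B γ).NoRainbow A := by
  intro x hx y hy z hz hxy hyz hxz
  have hC := hA x hx y hy z hz hxy hyz hxz
  have hγxy := fun hx hy => hγ x hx y hy hxy
  have hγyz := fun hy hz => hγ y hy z hz hyz
  have hγxz := fun hx hz => hγ x hx z hz hxz
  clear hγ hA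
  simp only [PairColoring.recolor]
  grind

theorem IsAbsorbing.isAdmissible_recolor (h : C.IsAbsorbing W P B A₁ A₂ γ b s t)
    (hA₁ : A₁.Nonempty) (ht : 3 ≤ t) (hW : C.IsAdmissible K W t)
    (hP : ∀ x ∈ P, ∀ y ∈ P, x ≠ y → C x y ∈ K') (hB : ∀ v ∈ B, γ v ∈ K') :
    (C.recolor B γ).IsAdmissible K' (P ∪ B) t := by
  have hγ : ∀ x ∈ B, ∀ y ∈ B, x ≠ y → γ x ≠ γ y → C x y = γ x ∨ C x y = γ y :=
    fun x hx y hy => h.color_eq_or_color_eq hW.noRainbow hx hy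
  refine ⟨fun x hx y hy hxy => ?_, (hW.noRainbow.mono h.union_subset).recolor hγ,
    fun c => h.not_hasTailedTriangle_recolor hA₁ ht (hW.free c)⟩
  by_cases hxB : x ∈ B <;> by_cases hyB : y ∈ B
  · rw [recolor_of_mem hxB hyB]
    split_ifs with he
    · exact hB x hxB
    · obtain e | e := hγ x hxB y hyB hxy he <;> rw [e]
      exacts [hB x hxB, hB y hyB]
  · rw [recolor_of_mem_of_notMem hxB hyB]
    exact hB x hxB
  · rw [PairColoring.symm, recolor_of_mem_of_notMem hyB hxB]
    exact hB y hyB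
  · rw [recolor_of_notMem hxB hyB]
    exact hP x ((Finset.mem_union.mp hx).resolve_right hxB) y
      ((Finset.mem_union.mp hy).resolve_right hyB) hxy

end Absorbing

section MaxOrder

/-- The largest order of a colouring with `k` colours without rainbow triangles and without
monochromatic tailed triangles on `u + 1` vertices. -/
def maxOrder (u : ℕ) : ℕ → ℕ
  | 0 => 1
  | 1 => u
  | 2 => 2 * u
  | k + 3 => 5 * maxOrder u (k + 1)

theorem two_mul_maxOrder_le (hu : 3 ≤ u) (k : ℕ) : 2 * maxOrder u k ≤ maxOrder u (k + 1) := by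
  induction k using maxOrder.induct with
  | case1 => simp only [maxOrder]; omega
  | case2 => simp only [maxOrder]; omega
  | case3 => simp only [maxOrder]; omega
  | case4 k ih => simp only [maxOrder] at ih ⊢; omega

theorem le_maxOrder_succ (hu : 3 ≤ u) (k : ℕ) : u ≤ maxOrder u (k + 1) := by
  induction k with
  | zero => simp [maxOrder]
  | succ k ih =>
    have := two_mul_maxOrder_le hu (k + 1)
    omega

theorem maxOrder_add_mul_le (hu : 3 ≤ u) (k : ℕ) :
    maxOrder u k + (k + 1) * (u / 2) ≤ maxOrder u (k + 1) := by
  induction k using maxOrder.induct with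
  | case1 => simp only [maxOrder]; omega
  | case2 => simp only [maxOrder]; omega
  | case3 => simp only [maxOrder]; omega
  | case4 k ih =>
    simp only [maxOrder] at ih ⊢
    generalize u / 2 = s at *
    linarith [Nat.zero_le (k * s)]

theorem maxOrder_add_maxOrder_add_mul_le (u k : ℕ) :
    maxOrder u (k + 2) + maxOrder u (k + 1) + (k + 4) * (u / 2) ≤ maxOrder u (k + 3) := by
  induction k using Nat.twoStepInduction with
  | zero => simp only [maxOrder]; omega
  | one => simp only [maxOrder]; omega
  | more k ih _ =>
    simp only [maxOrder] at ih ⊢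
    generalize u / 2 = s at *
    linarith [Nat.zero_le (k * s)]

theorem five_mul_add_mul_le_maxOrder (hu : 3 ≤ u) (k : ℕ) :
    5 * u + k * (u / 2) ≤ maxOrder u (k + 3) := by
  induction k with
  | zero => simp [maxOrder]
  | succ k ih =>
    have := two_mul_maxOrder_le hu (k + 3)
    have := Nat.div_mul_le_self u 2
    linarith [Nat.zero_le (k * (u / 2))]

end MaxOrder

section Modules

variable {W : Finset V} {K : Finset κ}

/-- A nonempty subset `A` of `W` whose elements are not distinguished by the colours of the pairs
that they form with the vertices of `W` outside `A`. -/
structure IsModule (C : PairColoring V κ) (W A : Finset V) : Prop where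
  subset : A ⊆ W
  nonempty : A.Nonempty
  color_eq : ∀ v ∈ W, v ∉ A → ∀ a ∈ A, ∀ a' ∈ A, C v a = C v a'

/-- A module with at most `s` outside neighbours in each colour. -/
structure IsSmallCut (C : PairColoring V κ) (s : ℕ) (W A : Finset V) : Prop
    extends C.IsModule W A where
  card_le : ∀ c, (C.colorNbrs c W A).card ≤ s

theorem colorNbrs_mono (h : A ⊆ B) : C.colorNbrs c A X ⊆ C.colorNbrs c B X := fun _ hv =>
  mem_colorNbrs.mpr ⟨⟨h (mem_colorNbrs.mp hv).1.1, (mem_colorNbrs.mp hv).1.2⟩,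
    (mem_colorNbrs.mp hv).2⟩

theorem IsModule.mono (h : C.IsModule W A) (hAB : A ⊆ B) (hBW : B ⊆ W) : C.IsModule B A :=
  ⟨hAB, h.nonempty, fun v hv => h.color_eq v (hBW hv)⟩

theorem IsModule.trans (h : C.IsModule A B) (hA : C.IsModule W A) : C.IsModule W B where
  subset := h.subset.trans hA.subset
  nonempty := h.nonempty
  color_eq v hv hvB a ha a' ha' := by
    by_cases hvA : v ∈ A
    · exact h.color_eq v hvA hvB a ha a' ha'
    · exact hA.color_eq v hv hvA a (h.subset ha) a' (h.subset ha')

theorem IsModule.mem_colorNbrs (h : C.IsModule W A) (hv : v ∈ W) (hvA : v ∉ A) (hx : x ∈ A)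
    (hvx : C v x = c) : v ∈ C.colorNbrs c W A :=
  PairColoring.mem_colorNbrs.mpr ⟨⟨hv, hvA⟩, fun a ha => (h.color_eq v hv hvA a ha x hx).trans hvx⟩

theorem IsModule.card_sdiff_le (h : C.IsModule W A) (hs : ∀ c ∈ K, (C.colorNbrs c W A).card ≤ s)
    (hK : ∀ v ∈ W, v ∉ A → ∀ a ∈ A, C v a ∈ K) : (W \ A).card ≤ K.card * s := by
  obtain ⟨a, ha⟩ := h.nonempty
  rw [mul_comm]
  refine Finset.card_le_mul_card_image_of_maps_to (f := fun v => C v a) (fun v hv => ?_) s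
    fun c hc => (Finset.card_le_card fun v hv => ?_).trans (hs c hc)
  · rw [Finset.mem_sdiff] at hv
    exact hK v hv.1 hv.2 a ha
  · rw [Finset.mem_filter, Finset.mem_sdiff] at hv
    exact h.mem_colorNbrs hv.1.1 hv.1.2 ha hv.2

theorem IsModule.colorNbrs_subset_union (h : C.IsModule A B) (hA : C.IsModule W A) :
    C.colorNbrs c W B ⊆ C.colorNbrs c A B ∪ C.colorNbrs c W A := by
  intro v hv
  obtain ⟨⟨hvW, hvB⟩, hvc⟩ := PairColoring.mem_colorNbrs.mp hv
  rw [Finset.mem_union]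
  by_cases hvA : v ∈ A
  · exact .inl (PairColoring.mem_colorNbrs.mpr ⟨⟨hvA, hvB⟩, hvc⟩)
  · obtain ⟨b, hb⟩ := h.nonempty
    exact .inr (hA.mem_colorNbrs hvW hvA (h.subset hb) (hvc b hb))

theorem isBiclique_colorNbrs (hAW : A ⊆ W) (hA : n ≤ A.card)
    (hc : n ≤ (C.colorNbrs c W A).card) : C.IsBiclique c W n (C.colorNbrs c W A) A where
  left_subset _ hv := (mem_colorNbrs.mp hv).1.1
  right_subset := hAW
  disjoint := Finset.disjoint_left.mpr fun _ hv => (mem_colorNbrs.mp hv).1.2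
  color _ hv := (mem_colorNbrs.mp hv).2
  le_card_left := hc
  le_card_right := hA

theorem IsBiclique.color_ne (h : C.IsBiclique c W (u / 2 + 1) X Y) (hu : 2 ≤ u)
    (hW : ¬ C.HasTailedTriangle c W (u + 1)) (hx : x ∈ X) (hy : y ∈ X) (hxy : x ≠ y) :
    C x y ≠ c := fun hc =>
  hW ((h.hasTailedTriangle_of_adj (by omega) hx hy
    ⟨h.left_subset hx, h.left_subset hy, hxy, hc⟩).mono subset_rfl (by omega))

/-- A neighbour of `B` in `A` and one outside `A` would form an edge inside one side of a biclique
whose other side is `B`. -/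
theorem IsSmallCut.card_colorNbrs_le (hA : C.IsSmallCut (u / 2) W A) (h : C.IsModule A B)
    (hu : 2 ≤ u) (hc : ¬ C.HasTailedTriangle c W (u + 1)) (hB : u / 2 < B.card)
    (hBc : (C.colorNbrs c A B).card ≤ u / 2) : (C.colorNbrs c W B).card ≤ u / 2 := by
  by_contra hlt
  have hbic : C.IsBiclique c W (u / 2 + 1) (C.colorNbrs c W B) B :=
    isBiclique_colorNbrs (h.subset.trans hA.subset) hB (not_le.mp hlt)
  have hsub := h.colorNbrs_subset_union (c := c) hA.toIsModule
  obtain ⟨p, hp, hpW⟩ := Finset.not_subset.mp fun hs => hlt ((Finset.card_le_card hs).trans hBc)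
  obtain ⟨q, hq, hqA⟩ := Finset.not_subset.mp fun hs =>
    hlt ((Finset.card_le_card hs).trans (hA.card_le c))
  have hpA := mem_colorNbrs.mp ((Finset.mem_union.mp (hsub hp)).resolve_left hpW)
  have hqB := mem_colorNbrs.mp ((Finset.mem_union.mp (hsub hq)).resolve_right hqA)
  exact hbic.color_ne hu hc hp hq (fun e => hpA.1.2 (e ▸ hqB.1.1)) (hpA.2 q hqB.1.1)

theorem exists_minimal_isSmallCut (C : PairColoring V κ) (s : ℕ) (hW : W.Nonempty) :
    ∃ A, C.IsSmallCut s W A ∧ ∀ A', C.IsSmallCut s W A' → A.card ≤ A'.card := by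
  have hcut : C.IsSmallCut s W W := ⟨⟨subset_rfl, hW, fun v hv hv' => absurd hv hv'⟩,
    fun c => by simp [colorNbrs]⟩
  obtain ⟨A, hA, hmin⟩ := (measure Finset.card).wf.has_min {A | C.IsSmallCut s W A} ⟨W, hcut⟩
  exact ⟨A, hA, fun A' hA' => not_lt.mp (hmin A' hA')⟩

end Modules

section InductionStep

variable {W A₁ A₂ : Finset V} {K T : Finset κ} {k : ℕ} {r b : κ}

theorem IsAdmissible.mono (h : C.IsAdmissible K A m) (hBA : B ⊆ A) : C.IsAdmissible K B m where
  mem x hx y hy := h.mem x (hBA hx) y (hBA hy)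
  noRainbow := h.noRainbow.mono hBA
  free c hc := h.free c (hc.mono hBA le_rfl)

theorem IsAdmissible.sdiff (h : C.IsAdmissible K A m)
    (hT : ∀ x ∈ A, ∀ y ∈ A, x ≠ y → C x y ∉ T) : C.IsAdmissible (K \ T) A m where
  mem x hx y hy hxy := Finset.mem_sdiff.mpr ⟨h.mem x hx y hy hxy, hT x hx y hy hxy⟩
  noRainbow := h.noRainbow
  free := h.free

/-- The hypotheses of the induction step, from fewer than `k + 3` to `k + 3` colours, of the proof
that `maxOrder` is an upper bound. -/
structure IsInductionStep (C : PairColoring V κ) (K : Finset κ) (W : Finset V) (u k : ℕ) :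
    Prop where
  three_le : 3 ≤ u
  isAdmissible : C.IsAdmissible K W (u + 1)
  card_eq : K.card = k + 3
  card_le_of_card_lt : ∀ (C' : PairColoring V κ) (K' : Finset κ) (A : Finset V), K'.card < k + 3 →
    C'.IsAdmissible K' A (u + 1) → A.card ≤ maxOrder u K'.card

theorem IsInductionStep.card_le_of_notMem (hS : C.IsInductionStep K W u k) (hAW : A ⊆ W)
    (hT : T ⊆ K) (hT0 : T.Nonempty) (hA : ∀ x ∈ A, ∀ y ∈ A, x ≠ y → C x y ∉ T) :
    A.card ≤ maxOrder u (k + 3 - T.card) := by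
  have hK : (K \ T).card = k + 3 - T.card := by rw [Finset.card_sdiff_of_subset hT, hS.card_eq]
  have := hT0.card_pos
  rw [← hK]
  exact hS.card_le_of_card_lt C _ A (by omega) ((hS.isAdmissible.mono hAW).sdiff hA)

theorem IsInductionStep.card_le_of_ne (hS : C.IsInductionStep K W u k) (hAW : A ⊆ W) (hr : r ∈ K)
    (hA : ∀ x ∈ A, ∀ y ∈ A, x ≠ y → C x y ≠ r) : A.card ≤ maxOrder u (k + 2) :=
  hS.card_le_of_notMem hAW (T := {r}) (by simpa) (by simp) (by simpa)

theorem IsInductionStep.card_le_of_ne_of_ne (hS : C.IsInductionStep K W u k) (hAW : A ⊆ W)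
    (hr : r ∈ K) (hb : b ∈ K) (hrb : r ≠ b)
    (hA : ∀ x ∈ A, ∀ y ∈ A, x ≠ y → C x y ≠ r ∧ C x y ≠ b) : A.card ≤ maxOrder u (k + 1) := by
  have := hS.card_le_of_notMem hAW (T := {r, b}) (by simp [Finset.insert_subset_iff, hr, hb])
    (by simp) (by simpa using hA)
  rwa [Finset.card_pair hrb] at this

/-- Two large modules of `W` joined by the colour `r`, such that any other vertex that distinguishes
between them sends `r` to one of them and `b` to the other. -/
structure IsLinkedPair (C : PairColoring V κ) (r b : κ) (W : Finset V) (s : ℕ) (A₁ A₂ : Finset V) :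
    Prop where
  ne : r ≠ b
  isModule_left : C.IsModule W A₁
  isModule_right : C.IsModule W A₂
  isBiclique : C.IsBiclique r W (s + 1) A₁ A₂
  color_eq_or : ∀ v ∈ W, v ∉ A₁ → v ∉ A₂ → ∀ x ∈ A₁, ∀ y ∈ A₂,
    C v x = C v y ∨ (C v x = b ∧ C v y = r) ∨ (C v x = r ∧ C v y = b)
  card_le_left : ∀ c, c ≠ r → (C.colorNbrs c W A₁).card ≤ s
  card_le_right : ∀ c, c ≠ r → (C.colorNbrs c W A₂).card ≤ s

theorem IsLinkedPair.left_subset (h : C.IsLinkedPair r b W s A₁ A₂) : A₁ ⊆ C.colorNbrs r W A₂ :=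
  fun x hx => mem_colorNbrs.mpr ⟨⟨h.isBiclique.left_subset hx,
    Finset.disjoint_left.mp h.isBiclique.disjoint hx⟩, h.isBiclique.color x hx⟩

theorem IsLinkedPair.right_subset (h : C.IsLinkedPair r b W s A₁ A₂) : A₂ ⊆ C.colorNbrs r W A₁ :=
  fun y hy => mem_colorNbrs.mpr ⟨⟨h.isBiclique.right_subset hy,
    Finset.disjoint_right.mp h.isBiclique.disjoint hy⟩, h.isBiclique.symm.color y hy⟩

theorem IsLinkedPair.color_ne_of_left (h : C.IsLinkedPair r b W (u / 2) A₁ A₂) (hu : 2 ≤ u)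
    (hr : ¬ C.HasTailedTriangle r W (u + 1)) (hx : x ∈ C.colorNbrs r W A₁)
    (hy : y ∈ C.colorNbrs r W A₁) (hxy : x ≠ y) : C x y ≠ r :=
  have hle := h.isBiclique.le_card_right.trans (Finset.card_le_card h.right_subset)
  (isBiclique_colorNbrs h.isBiclique.left_subset h.isBiclique.le_card_left hle).color_ne
    hu hr hx hy hxy

theorem IsLinkedPair.color_ne_of_right (h : C.IsLinkedPair r b W (u / 2) A₁ A₂) (hu : 2 ≤ u)
    (hr : ¬ C.HasTailedTriangle r W (u + 1)) (hx : x ∈ C.colorNbrs r W A₂)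
    (hy : y ∈ C.colorNbrs r W A₂) (hxy : x ≠ y) : C x y ≠ r :=
  have hle := h.isBiclique.le_card_left.trans (Finset.card_le_card h.left_subset)
  (isBiclique_colorNbrs h.isBiclique.right_subset h.isBiclique.le_card_right hle).color_ne
    hu hr hx hy hxy

theorem IsLinkedPair.disjoint_colorNbrs (h : C.IsLinkedPair r b W (u / 2) A₁ A₂) (hu : 2 ≤ u)
    (hr : ¬ C.HasTailedTriangle r W (u + 1)) :
    Disjoint (C.colorNbrs r W A₁) (C.colorNbrs r W A₂) := by
  obtain ⟨y, hy⟩ := h.isModule_right.nonempty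
  refine Finset.disjoint_left.mpr fun v hv₁ hv₂ => ?_
  have hv := mem_colorNbrs.mp hv₂
  exact h.color_ne_of_left hu hr hv₁ (h.right_subset hy) (fun e => hv.1.2 (e ▸ hy)) (hv.2 y hy)

theorem IsLinkedPair.color_eq_of_notMem (h : C.IsLinkedPair r b W s A₁ A₂) (hv : v ∈ W)
    (hv₁ : v ∉ C.colorNbrs r W A₁) (hv₂ : v ∉ C.colorNbrs r W A₂) (hx : x ∈ A₁) (hy : y ∈ A₂) :
    C v x = C v y ∧ C v x ≠ r := by
  have hvA₁ : v ∉ A₁ := fun hvA => hv₂ (h.left_subset hvA)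
  have hvA₂ : v ∉ A₂ := fun hvA => hv₁ (h.right_subset hvA)
  have hx' : C v x ≠ r := fun e => hv₁ (h.isModule_left.mem_colorNbrs hv hvA₁ hx e)
  have hy' : C v y ≠ r := fun e => hv₂ (h.isModule_right.mem_colorNbrs hv hvA₂ hy e)
  have := h.color_eq_or v hv hvA₁ hvA₂ x hx y hy
  tauto

theorem IsLinkedPair.color_eq_right (h : C.IsLinkedPair r b W s A₁ A₂)
    (hd : Disjoint (C.colorNbrs r W A₁) (C.colorNbrs r W A₂)) (hv : v ∈ C.colorNbrs r W A₂)
    (hvA : v ∉ A₁) (hx : x ∈ A₁) : C v x = b := by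
  obtain ⟨⟨hvW, hvA₂⟩, hvr⟩ := mem_colorNbrs.mp hv
  obtain ⟨y, hy⟩ := h.isModule_right.nonempty
  have hvx : C v x ≠ r := fun e =>
    Finset.disjoint_right.mp hd hv (h.isModule_left.mem_colorNbrs hvW hvA hx e)
  have := h.color_eq_or v hvW hvA hvA₂ x hx y hy
  rw [hvr y hy] at this
  tauto

theorem IsLinkedPair.card_le (h : C.IsLinkedPair r b W s A₁ A₂)
    (hd : Disjoint (C.colorNbrs r W A₁) (C.colorNbrs r W A₂)) (hr : r ∈ K)
    (hK : ∀ x ∈ W, ∀ y ∈ W, x ≠ y → C x y ∈ K) :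
    W.card ≤ A₁.card + A₂.card + K.card * s := by
  obtain ⟨x, hx⟩ := h.isModule_left.nonempty
  obtain ⟨y, hy⟩ := h.isModule_right.nonempty
  set R := W \ C.colorNbrs r W A₁ with hR
  have hRW : R ⊆ W := Finset.sdiff_subset
  have hAR : A₁ ⊆ R := fun v hv => Finset.mem_sdiff.mpr ⟨h.isBiclique.left_subset hv,
    fun hv' => (mem_colorNbrs.mp hv').1.2 hv⟩
  have hout : (R \ A₁).card ≤ (K.erase r).card * s := by
    refine (h.isModule_left.mono hAR hRW).card_sdiff_le (fun c hc => ?_) fun v hv hvA a ha => ?_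
    · exact (Finset.card_le_card (colorNbrs_mono hRW)).trans
        (h.card_le_left c (Finset.ne_of_mem_erase hc))
    · refine Finset.mem_erase.mpr ⟨fun e => (Finset.mem_sdiff.mp hv).2
        (h.isModule_left.mem_colorNbrs (hRW hv) hvA ha e), ?_⟩
      exact hK v (hRW hv) a (h.isBiclique.left_subset ha) fun e => hvA (e ▸ ha)
  have hcover : W ⊆ A₁ ∪ A₂ ∪ C.colorNbrs b W A₂ ∪ R \ A₁ := by
    intro v hv
    by_cases hv₁ : v ∈ C.colorNbrs r W A₁
    · by_cases hvA₂ : v ∈ A₂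
      · simp [hvA₂]
      · have hvN₂ : C v y ≠ r := fun e =>
          Finset.disjoint_left.mp hd hv₁ (h.isModule_right.mem_colorNbrs hv hvA₂ hy e)
        obtain ⟨⟨-, hvA₁⟩, hvr⟩ := mem_colorNbrs.mp hv₁
        have := h.color_eq_or v hv hvA₁ hvA₂ x hx y hy
        rw [hvr x hx] at this
        have hvb : C v y = b := by tauto
        simp [h.isModule_right.mem_colorNbrs hv hvA₂ hy hvb]
    · by_cases hvA : v ∈ A₁ <;> simp [hR, hv, hv₁, hvA]
  have := Finset.card_le_card hcover
  have := Finset.card_union_le (A₁ ∪ A₂ ∪ C.colorNbrs b W A₂) (R \ A₁)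
  have := Finset.card_union_le (A₁ ∪ A₂) (C.colorNbrs b W A₂)
  have := Finset.card_union_le A₁ A₂
  have := h.card_le_right b h.ne.symm
  rw [← Finset.card_erase_add_one hr, add_mul]
  omega

theorem IsLinkedPair.color_eq_or_color_eq (h : C.IsLinkedPair r b W s A₁ A₂) (hW : C.NoRainbow W)
    (hd : Disjoint (C.colorNbrs r W A₁) (C.colorNbrs r W A₂)) (hv : v ∈ W)
    (hv₁ : v ∉ C.colorNbrs r W A₁) (hv₂ : v ∉ C.colorNbrs r W A₂) (hx : x ∈ A₁)
    (hw : w ∈ C.colorNbrs r W A₂) : C v w = C v x ∨ C v x = b := by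
  have hvA₁ : v ∉ A₁ := fun hvA => hv₂ (h.left_subset hvA)
  have hvA₂ : v ∉ A₂ := fun hvA => hv₁ (h.right_subset hvA)
  by_cases hwA : w ∈ A₁
  · exact .inl (h.isModule_left.color_eq v hv hvA₁ w hwA x hx)
  have hxW := h.isBiclique.left_subset hx
  obtain ⟨y, hy⟩ := h.isModule_right.nonempty
  have hyW := h.isBiclique.right_subset hy
  obtain ⟨⟨hwW, hwA₂⟩, hwr⟩ := mem_colorNbrs.mp hw
  have hxy := h.color_eq_of_notMem hv hv₁ hv₂ hx hy
  have hwx := h.color_eq_right hd hw hwA hx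
  have hvw : v ≠ w := fun e => hv₂ (e ▸ hw)
  have hvwy := hW v hv w hwW y hyW hvw (fun e => hwA₂ (e ▸ hy)) fun e => hvA₂ (e ▸ hy)
  have hvwx := hW v hv w hwW x hxW hvw (fun e => hwA (e ▸ hx)) fun e => hvA₁ (e ▸ hx)
  rw [hwr y hy, ← hxy.1] at hvwy
  rw [hwx] at hvwx
  have := h.ne
  grind

theorem IsLinkedPair.isAbsorbing (h : C.IsLinkedPair r b W s A₁ A₂) (hW : C.NoRainbow W)
    (hd : Disjoint (C.colorNbrs r W A₁) (C.colorNbrs r W A₂)) (hx : x ∈ A₁)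
    (hB : B = W \ (C.colorNbrs r W A₁ ∪ C.colorNbrs r W A₂))
    (hm : C.colorNbrs r W A₂ = A₁ ∨ m ≤ A₁.card)
    (hadj : ∀ v ∈ B, ∃ p q, C.Adj (C v x) A₂ p q) :
    C.IsAbsorbing W (C.colorNbrs r W A₂) B A₁ A₂ (C · x) b s m := by
  have hmem : ∀ v ∈ B, v ∈ W ∧ v ∉ C.colorNbrs r W A₁ ∧ v ∉ C.colorNbrs r W A₂ := by
    simp [hB]
  have hNW : C.colorNbrs r W A₂ ∪ B ⊆ W := Finset.union_subset
    (fun v hv => (mem_colorNbrs.mp hv).1.1) fun v hv => (hmem v hv).1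
  have hN₁ : Disjoint (C.colorNbrs r W A₂ ∪ B) (C.colorNbrs r W A₁) :=
    Finset.disjoint_union_left.mpr ⟨hd.symm, Finset.disjoint_left.mpr fun v hv => (hmem v hv).2.1⟩
  refine ⟨h.left_subset, h.isBiclique.right_subset, hNW,
    Finset.disjoint_right.mpr fun v hv => (hmem v hv).2.2,
    Finset.disjoint_of_subset_right h.right_subset hN₁, fun v hv a ha => ?_, fun v hv a ha => ?_,
    fun w hw hwA a ha => h.color_eq_right hd hw hwA ha, fun v hv w hw => ?_, fun c => ?_,
    h.isBiclique.le_card_right, hm, hadj⟩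
  · obtain ⟨hvW, -, hv₂⟩ := hmem v hv
    exact h.isModule_left.color_eq v hvW (fun hvA => hv₂ (h.left_subset hvA)) a ha x hx
  · obtain ⟨hvW, hv₁, hv₂⟩ := hmem v hv
    exact (h.color_eq_of_notMem hvW hv₁ hv₂ hx ha).1.symm
  · obtain ⟨hvW, hv₁, hv₂⟩ := hmem v hv
    exact h.color_eq_or_color_eq hW hd hvW hv₁ hv₂ hx hw
  · have hsub : C.colorNbrs c (C.colorNbrs r W A₂ ∪ B) A₁ ⊆ C.colorNbrs c W A₁ :=
      colorNbrs_mono hNW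
    by_cases hc : c = r
    · subst hc
      rw [Finset.eq_empty_of_forall_notMem (s := C.colorNbrs c _ A₁) fun v hv =>
        Finset.disjoint_left.mp hN₁ (mem_colorNbrs.mp hv).1.1 (hsub hv)]
      exact Nat.zero_le s
    · exact (Finset.card_le_card hsub).trans (h.card_le_left c hc)

theorem IsInductionStep.card_le_of_isAbsorbing {γ : V → κ} {P : Finset V}
    (hS : C.IsInductionStep K W u k) (h : C.IsAbsorbing W P B A₁ A₂ γ b s (u + 1))
    (hA₁ : A₁.Nonempty) (hT : T ⊆ K) (hT0 : T.Nonempty)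
    (hP : ∀ x ∈ P, ∀ y ∈ P, x ≠ y → C x y ∉ T) (hB : ∀ v ∈ B, γ v ∈ K \ T) :
    (P ∪ B).card ≤ maxOrder u (k + 3 - T.card) := by
  have hK : (K \ T).card = k + 3 - T.card := by rw [Finset.card_sdiff_of_subset hT, hS.card_eq]
  have := hT0.card_pos
  have := hS.three_le
  rw [← hK]
  refine hS.card_le_of_card_lt (C.recolor B γ) _ _ (by omega)
    (h.isAdmissible_recolor hA₁ (by omega) hS.isAdmissible ?_ hB)
  exact ((hS.isAdmissible.mono (Finset.union_subset_left h.union_subset)).sdiff hP).mem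

theorem IsInductionStep.card_le_of_isLinkedPair_of_isAbsorbing
    (hS : C.IsInductionStep K W u k) (h : C.IsLinkedPair r b W (u / 2) A₁ A₂) (hr : r ∈ K)
    (hx : x ∈ A₁) (hB : B = W \ (C.colorNbrs r W A₁ ∪ C.colorNbrs r W A₂))
    (habs : C.IsAbsorbing W (C.colorNbrs r W A₂) B A₁ A₂ (C · x) b (u / 2) (u + 1)) :
    W.card ≤ maxOrder u (k + 3) := by
  have hu : 2 ≤ u := by have := hS.three_le; omega
  have hrfree := hS.isAdmissible.free r
  have hBK : ∀ v ∈ B, C v x ∈ K \ {r} := fun v hv => by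
    have hv' : v ∈ W ∧ v ∉ C.colorNbrs r W A₁ ∧ v ∉ C.colorNbrs r W A₂ := by simpa [hB] using hv
    obtain ⟨y, hy⟩ := h.isModule_right.nonempty
    have hvx := (h.color_eq_of_notMem hv'.1 hv'.2.1 hv'.2.2 hx hy).2
    exact Finset.mem_sdiff.mpr ⟨hS.isAdmissible.mem v hv'.1 x (h.isBiclique.left_subset hx)
      fun e => hv'.2.2 (h.left_subset (e ▸ hx)), by simpa⟩
  have hP := hS.card_le_of_isAbsorbing habs ⟨x, hx⟩ (T := {r}) (by simpa) (by simp)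
    (fun x hx y hy hxy => by simpa using h.color_ne_of_right hu hrfree hx hy hxy) hBK
  have hN₁ : (C.colorNbrs r W A₁).card ≤ maxOrder u (k + 2) :=
    hS.card_le_of_ne (fun v hv => (mem_colorNbrs.mp hv).1.1) hr
      fun x hx y hy => h.color_ne_of_left hu hrfree hx hy
  have hW : W ⊆ C.colorNbrs r W A₂ ∪ B ∪ C.colorNbrs r W A₁ := fun v hv => by
    simp only [hB, Finset.mem_union, Finset.mem_sdiff]
    tauto
  have := Finset.card_le_card hW
  have := Finset.card_union_le (C.colorNbrs r W A₂ ∪ B) (C.colorNbrs r W A₁)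
  have : 2 * maxOrder u (k + 2) ≤ maxOrder u (k + 3) := two_mul_maxOrder_le hS.three_le (k + 2)
  simp only [Finset.card_singleton, Nat.add_one_sub_one] at hP
  omega

/-- If the vertices joined by `r` to neither side cannot be absorbed, then one of the sides has so
few vertices that crude counting suffices. -/
theorem IsInductionStep.card_le_of_isLinkedPair (hS : C.IsInductionStep K W u k)
    (h : C.IsLinkedPair r b W (u / 2) A₁ A₂) (hr : r ∈ K) : W.card ≤ maxOrder u (k + 3) := by
  have hu : 2 ≤ u := by have := hS.three_le; omega
  have hrfree := hS.isAdmissible.free r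
  have hd := h.disjoint_colorNbrs hu hrfree
  have hA₁ : ∀ x ∈ A₁, ∀ y ∈ A₁, x ≠ y → C x y ≠ r := fun x hx y hy =>
    h.color_ne_of_right hu hrfree (h.left_subset hx) (h.left_subset hy)
  have hA₂ : ∀ x ∈ A₂, ∀ y ∈ A₂, x ≠ y → C x y ≠ r := fun x hx y hy =>
    h.color_ne_of_left hu hrfree (h.right_subset hx) (h.right_subset hy)
  have hA₁card := hS.card_le_of_ne h.isBiclique.left_subset hr hA₁
  have hA₂card := hS.card_le_of_ne h.isBiclique.right_subset hr hA₂
  suffices A₁.card ≤ maxOrder u (k + 1) ∨ A₂.card ≤ maxOrder u (k + 1) ∨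
      W.card ≤ maxOrder u (k + 3) by
    have hW := h.card_le hd hr hS.isAdmissible.mem
    rw [hS.card_eq] at hW
    have := maxOrder_add_maxOrder_add_mul_le u k
    grind
  obtain ⟨x, hx⟩ := h.isModule_left.nonempty
  by_cases hm : u + 1 ≤ A₁.card
  · refine .inr ?_
    by_cases hadj : ∀ v ∈ W \ (C.colorNbrs r W A₁ ∪ C.colorNbrs r W A₂),
        ∃ p q, C.Adj (C v x) A₂ p q
    · exact .inr (hS.card_le_of_isLinkedPair_of_isAbsorbing h hr hx rfl
        (h.isAbsorbing hS.isAdmissible.noRainbow hd hx rfl (.inr hm) hadj))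
    · push Not at hadj
      obtain ⟨v, hv, hvadj⟩ := hadj
      have hv' : v ∈ W ∧ v ∉ C.colorNbrs r W A₁ ∧ v ∉ C.colorNbrs r W A₂ := by simpa using hv
      obtain ⟨y, hy⟩ := h.isModule_right.nonempty
      have hvx := (h.color_eq_of_notMem hv'.1 hv'.2.1 hv'.2.2 hx hy).2
      refine .inl (hS.card_le_of_ne_of_ne h.isBiclique.right_subset hr
        (hS.isAdmissible.mem v hv'.1 x (h.isBiclique.left_subset hx)
          fun e => hv'.2.2 (h.left_subset (e ▸ hx))) hvx.symm fun p hp q hq hpq => ?_)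
      exact ⟨hA₂ p hp q hq hpq, fun e => hvadj p q ⟨hp, hq, hpq, e⟩⟩
  · exact .inl ((by omega : A₁.card ≤ u).trans (le_maxOrder_succ hS.three_le k))

end InductionStep

section Fibers

variable {W T : Finset V} {K : Finset κ} {f : V → V} {r b : κ} {p : V}

theorem card_fiber_le_of_mem_image
    (h : v ∈ A.image f → (A.filter (f · = v)).card ≤ n) : (A.filter (f · = v)).card ≤ n := by
  by_cases hv : v ∈ A.image f
  · exact h hv
  · rw [Finset.filter_eq_empty_iff.mpr fun w hw (e : f w = v) =>
      hv (e ▸ Finset.mem_image_of_mem f hw)]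
    exact Nat.zero_le n

theorem card_le_sum_card_fiber_add (hT : T ⊆ A.image f)
    (hn : ∀ v, v ∉ T → (A.filter (f · = v)).card ≤ n) :
    A.card ≤ ∑ v ∈ T, (A.filter (f · = v)).card + ((A.image f).card - T.card) * n := by
  rw [Finset.card_eq_sum_card_image f A, ← Finset.sum_sdiff hT, add_comm,
    ← Finset.card_sdiff_of_subset hT, ← smul_eq_mul]
  gcongr
  exact Finset.sum_le_card_nsmul _ _ _ fun v hv => hn v (Finset.mem_sdiff.mp hv).2

theorem disjoint_fiber {v w : V} (h : v ≠ w) :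
    Disjoint (A.filter (f · = v)) (A.filter (f · = w)) :=
  Finset.disjoint_filter.mpr fun _ _ hv hw => h (hv.symm.trans hw)

theorem color_ne_of_not_meetsTriangle (h : ¬ C.MeetsTriangle c W A) (hx : x ∈ A)
    (hxy : C.Adj c W x y) (hxz : C.Adj c W x z) (hyz : y ≠ z) : C y z ≠ c := fun hc =>
  h ⟨x, hx, y, z, hxy, hxz, hxy.right_mem, hxz.right_mem, hyz, hc⟩

theorem MeetsTriangle.card_colorNbrs_le (h : C.MeetsTriangle c W A) (hA : C.Connected c A)
    (hu : 2 ≤ u) (hc : ¬ C.HasTailedTriangle c W (u + 1)) (hAW : A ⊆ W) (hBA : B ⊆ A)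
    (hB : u / 2 < B.card) : (C.colorNbrs c A B).card ≤ u / 2 := by
  by_contra hlt
  exact (isBiclique_colorNbrs hBA hB (not_le.mp hlt)).not_meetsTriangle hu hc hAW hA h

theorem IsModularPartition.isModule_fiber (h : C.IsModularPartition A f) (hp : p ∈ A) :
    C.IsModule A (A.filter (f · = f p)) where
  subset := Finset.filter_subset _ _
  nonempty := ⟨p, Finset.mem_filter.mpr ⟨hp, rfl⟩⟩
  color_eq v hv hvp a ha a' ha' := by
    rw [Finset.mem_filter] at hvp ha ha'
    exact h.color_eq hv hv ha.1 ha'.1 rfl (ha.2.trans ha'.2.symm)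
      fun e => hvp ⟨hv, e.trans ha.2⟩

theorem IsPrimePartition.nonempty (h : C.IsPrimePartition A f r b) : A.Nonempty :=
  Finset.image_nonempty.mp (Finset.card_pos.mp (Nat.zero_lt_of_lt h.one_lt_card))

theorem IsPrimePartition.left_mem (h : C.IsPrimePartition A f r b)
    (hK : ∀ x ∈ A, ∀ y ∈ A, x ≠ y → C x y ∈ K) : r ∈ K := by
  obtain ⟨x, hx⟩ := h.nonempty
  obtain ⟨t, ht, -, hxt⟩ := h.exists_adj_left hx
  have hadj := hxt x hx rfl
  exact hadj.color ▸ hK x hx t ht hadj.ne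

theorem IsPrimePartition.color_ne_left (h : C.IsPrimePartition A f r b) (hAW : A ⊆ W)
    (hr : ¬ C.MeetsTriangle r W A) (hx : x ∈ A) (hy : y ∈ A) (hxy : x ≠ y) (hf : f x = f y) :
    C x y ≠ r := by
  obtain ⟨t, ht, -, hadj⟩ := h.exists_adj_left hx
  exact color_ne_of_not_meetsTriangle hr ht ((hadj x hx rfl).symm.mono hAW)
    ((hadj y hy hf.symm).symm.mono hAW) hxy

theorem IsPrimePartition.color_ne_left_of_notMem (h : C.IsPrimePartition A f r b)
    (hA : C.IsModule W A) (hr : ¬ C.MeetsTriangle r W A) (hv : v ∈ W) (hvA : v ∉ A) (hx : x ∈ A) :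
    C v x ≠ r := by
  intro hc
  obtain ⟨t, ht, -, hadj⟩ := h.exists_adj_left hx
  have hxv : C.Adj r W x v := ⟨hA.subset hx, hv, fun e => hvA (e ▸ hx), by rw [C.symm, hc]⟩
  exact color_ne_of_not_meetsTriangle hr hx hxv ((hadj x hx rfl).mono hA.subset)
    (fun e => hvA (e ▸ ht)) (hA.color_eq v hv hvA t ht x hx ▸ hc)

theorem IsPrimePartition.card_image_le_five (h : C.IsPrimePartition A f r b) (hAW : A ⊆ W)
    (hr : ¬ C.MeetsTriangle r W A) (hb : ¬ C.MeetsTriangle b W A) : (A.image f).card ≤ 5 := by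
  by_contra hlt
  have hsub := h.image_subset
  obtain ⟨x, y, z, ht | ht⟩ :=
    exists_isTriangle_of_six_le_card (not_le.mp hlt) h.color_quotient
  · exact hr ⟨x, hsub ht.adj₁₂.left_mem, y, z, ht.mono (hsub.trans hAW)⟩
  · exact hb ⟨x, hsub ht.adj₁₂.left_mem, y, z, ht.mono (hsub.trans hAW)⟩

theorem IsPrimePartition.mem_colorNbrs_or (h : C.IsPrimePartition A f r b) (hp : p ∈ A)
    (hv : v ∈ A) (hvp : f v ≠ f p) :
    v ∈ C.colorNbrs r A (A.filter (f · = f p)) ∨ v ∈ C.colorNbrs b A (A.filter (f · = f p)) := by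
  have hv' : v ∉ A.filter (f · = f p) := fun hv => hvp (Finset.mem_filter.mp hv).2
  have hp' : p ∈ A.filter (f · = f p) := Finset.mem_filter.mpr ⟨hp, rfl⟩
  have hm := h.isModule_fiber hp
  exact (h.color_cross hv hp hvp).imp (hm.mem_colorNbrs hv hv' hp') (hm.mem_colorNbrs hv hv' hp')

theorem IsPrimePartition.colorNbrs_fiber_eq_empty (h : C.IsPrimePartition A f r b) (hp : p ∈ A)
    (hr : c ≠ r) (hb : c ≠ b) : C.colorNbrs c A (A.filter (f · = f p)) = ∅ := by
  refine Finset.eq_empty_of_forall_notMem fun v hv => ?_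
  obtain ⟨⟨hvA, hvp⟩, hvc⟩ := mem_colorNbrs.mp hv
  have hcp := hvc p (Finset.mem_filter.mpr ⟨hp, rfl⟩)
  obtain e | e := h.color_cross hvA hp fun e => hvp (Finset.mem_filter.mpr ⟨hvA, e⟩)
  exacts [hr (hcp.symm.trans e), hb (hcp.symm.trans e)]

end Fibers

section TriangleFree

variable {W A₁ A₂ : Finset V} {K : Finset κ} {f : V → V} {k : ℕ} {r b : κ} {p q : V}

theorem IsSmallCut.isAbsorbing (hA : C.IsSmallCut s W A) (hA₁ : A₁ ⊆ A) (hA₂ : A₂ ⊆ A)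
    (hd : Disjoint A₁ A₂) (hx : x ∈ A₁) (hs : s < A₂.card)
    (hadj : ∀ v ∈ W \ A, ∃ p q, C.Adj (C v x) A₂ p q) (b : κ) (m : ℕ) :
    C.IsAbsorbing W A₁ (W \ A) A₁ A₂ (C · x) b s m := by
  have hcolor : ∀ v ∈ W \ A, ∀ a ∈ A, C v a = C v x := fun v hv a ha =>
    hA.color_eq v (Finset.mem_sdiff.mp hv).1 (Finset.mem_sdiff.mp hv).2 a ha x (hA₁ hx)
  have hdA : ∀ {D}, D ⊆ A → Disjoint (W \ A) D := fun hD =>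
    Finset.disjoint_of_subset_right hD Finset.sdiff_disjoint
  refine ⟨subset_rfl, hA₂.trans hA.subset,
    Finset.union_subset (hA₁.trans hA.subset) Finset.sdiff_subset, (hdA hA₁).symm,
    Finset.disjoint_union_left.mpr ⟨hd, hdA hA₂⟩, fun v hv a ha => hcolor v hv a (hA₁ ha),
    fun v hv a ha => hcolor v hv a (hA₂ ha), fun y hy hy' => absurd hy hy',
    fun v hv y hy => .inl (hcolor v hv y (hA₁ hy)), fun c => ?_, hs, .inl rfl, hadj⟩
  refine (Finset.card_le_card fun v hv => ?_).trans (hA.card_le c)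
  obtain ⟨⟨hv, hvA₁⟩, hvc⟩ := mem_colorNbrs.mp hv
  have hvA := Finset.mem_sdiff.mp ((Finset.mem_union.mp hv).resolve_left hvA₁)
  exact hA.mem_colorNbrs hvA.1 hvA.2 (hA₁ hx) (hvc x hx)

/-- Either the vertices outside `A` can be absorbed by `A₁`, or `A₂` avoids a third colour. -/
theorem IsInductionStep.card_union_sdiff_add_card_le (hS : C.IsInductionStep K W u k)
    (hA : C.IsSmallCut (u / 2) W A) (hr : r ∈ K) (hb : b ∈ K) (hrb : r ≠ b) (hA₁ : A₁ ⊆ A)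
    (hA₂ : A₂ ⊆ A) (hd : Disjoint A₁ A₂) (hx : x ∈ A₁) (hs : u / 2 < A₂.card)
    (h₁ : ∀ y ∈ A₁, ∀ z ∈ A₁, y ≠ z → C y z ≠ r ∧ C y z ≠ b)
    (h₂ : ∀ y ∈ A₂, ∀ z ∈ A₂, y ≠ z → C y z ≠ r ∧ C y z ≠ b)
    (hout : ∀ v ∈ W, v ∉ A → ∀ a ∈ A, C v a ≠ r ∧ C v a ≠ b) :
    (A₁ ∪ W \ A).card + A₂.card ≤ 2 * maxOrder u (k + 1) := by
  have hT : ({r, b} : Finset κ) ⊆ K := by simp [Finset.insert_subset_iff, hr, hb]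
  have houtK : ∀ v ∈ W, v ∉ A → ∀ a ∈ A, C v a ∈ K \ {r, b} := fun v hv hvA a ha =>
    Finset.mem_sdiff.mpr ⟨hS.isAdmissible.mem v hv a (hA.subset ha) fun e => hvA (e ▸ ha),
      by simpa using hout v hv hvA a ha⟩
  have hA₁card := hS.card_le_of_ne_of_ne (hA₁.trans hA.subset) hr hb hrb h₁
  by_cases hadj : ∀ v ∈ W \ A, ∃ p q, C.Adj (C v x) A₂ p q
  · have hle := hS.card_le_of_isAbsorbing (hA.isAbsorbing hA₁ hA₂ hd hx hs hadj b (u + 1)) ⟨x, hx⟩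
      hT (by simp) (by simpa using h₁) fun v hv =>
        houtK v (Finset.mem_sdiff.mp hv).1 (Finset.mem_sdiff.mp hv).2 x (hA₁ hx)
    have hA₂card := hS.card_le_of_ne_of_ne (hA₂.trans hA.subset) hr hb hrb h₂
    simp only [Finset.card_pair hrb, Nat.reduceSubDiff] at hle
    omega
  · push Not at hadj
    obtain ⟨v, hv, hvadj⟩ := hadj
    rw [Finset.mem_sdiff] at hv
    have hvx := Finset.mem_sdiff.mp (houtK v hv.1 hv.2 x (hA₁ hx))
    have hle := hS.card_le_of_notMem (T := insert (C v x) {r, b}) (hA₂.trans hA.subset)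
      (Finset.insert_subset hvx.1 hT) (by simp) fun y hy z hz hyz => by
        have hne : C y z ≠ C v x := fun e => hvadj y z ⟨hy, hz, hyz, e⟩
        simpa [hne] using h₂ y hy z hz hyz
    rw [Finset.card_insert_of_notMem hvx.2, Finset.card_pair hrb, Nat.add_sub_cancel] at hle
    have hWA := hA.card_sdiff_le (fun c _ => hA.card_le c) houtK
    rw [Finset.card_sdiff_of_subset hT, hS.card_eq, Finset.card_pair hrb] at hWA
    have : maxOrder u k + (k + 3 - 2) * (u / 2) ≤ _ := maxOrder_add_mul_le hS.three_le k
    have := Finset.card_union_le A₁ (W \ A)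
    omega

theorem IsInductionStep.card_le_of_not_meetsTriangle (hS : C.IsInductionStep K W u k)
    (hA : C.IsSmallCut (u / 2) W A) (h : C.IsPrimePartition A f r b)
    (hr : ¬ C.MeetsTriangle r W A) (hb : ¬ C.MeetsTriangle b W A) (hp : p ∈ A) (hq : q ∈ A)
    (hpq : f p ≠ f q) (hs : u / 2 < (A.filter (f · = f q)).card) :
    W.card ≤ maxOrder u (k + 3) := by
  have hK := (hS.isAdmissible.mono hA.subset).mem
  have hrK := h.left_mem hK
  have hbK := h.symm.left_mem hK
  have hfib : ∀ v, A.filter (f · = v) ⊆ A := fun v => Finset.filter_subset _ _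
  have hne : ∀ v, ∀ x ∈ A.filter (f · = v), ∀ y ∈ A.filter (f · = v), x ≠ y →
      C x y ≠ r ∧ C x y ≠ b := fun v x hx y hy hxy => by
    rw [Finset.mem_filter] at hx hy
    have hf := hx.2.trans hy.2.symm
    exact ⟨h.color_ne_left hA.subset hr hx.1 hy.1 hxy hf,
      h.symm.color_ne_left hA.subset hb hx.1 hy.1 hxy hf⟩
  have hle := hS.card_union_sdiff_add_card_le hA hrK hbK h.ne (hfib (f p)) (hfib (f q))
    (disjoint_fiber hpq) (Finset.mem_filter.mpr ⟨hp, rfl⟩) hs (hne _) (hne _)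
    fun v hv hvA a ha => ⟨h.color_ne_left_of_notMem hA.toIsModule hr hv hvA ha,
      h.symm.color_ne_left_of_notMem hA.toIsModule hb hv hvA ha⟩
  have hpart : ∀ v, (A.filter (f · = v)).card ≤ maxOrder u (k + 1) := fun v =>
    hS.card_le_of_ne_of_ne ((hfib v).trans hA.subset) hrK hbK h.ne (hne v)
  have hAcard := card_le_sum_card_fiber_add (A := A) (f := f) (T := {f p, f q})
    (by simp [Finset.insert_subset_iff, Finset.mem_image_of_mem f, hp, hq]) fun v _ => hpart v
  rw [Finset.sum_pair hpq, Finset.card_pair hpq] at hAcard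
  have himg := h.card_image_le_five hA.subset hr hb
  have hmul : ((A.image f).card - 2) * maxOrder u (k + 1) ≤ 3 * maxOrder u (k + 1) :=
    Nat.mul_le_mul_right _ (by omega)
  have hunion := Finset.card_union_of_disjoint (Finset.disjoint_of_subset_left (hfib (f p))
    (Finset.disjoint_sdiff (s := A) (t := W)))
  have hW := Finset.card_sdiff_add_card_eq_card hA.subset
  simp only [maxOrder]
  omega

end TriangleFree

section LargeFibers

variable {W : Finset V} {K : Finset κ} {f : V → V} {k : ℕ} {r b : κ} {p q : V}

theorem IsPrimePartition.card_colorNbrs_le_three_mul (h : C.IsPrimePartition A f r b)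
    (hAW : A ⊆ W) (hu : 2 ≤ u) (hfree : ¬ C.HasTailedTriangle b W (u + 1))
    (hr : ¬ C.MeetsTriangle r W A) (hb : C.MeetsTriangle b W A) (hp : p ∈ A)
    (hs : ∀ v, v ≠ f p → (A.filter (f · = v)).card ≤ u / 2) :
    (C.colorNbrs r A (A.filter (f · = f p))).card ≤ 3 * (u / 2) := by
  by_contra hlt
  set N := C.colorNbrs r A (A.filter (f · = f p))
  have hNA : N ⊆ A := fun v hv => (mem_colorNbrs.mp hv).1.1
  have hp' : p ∈ A.filter (f · = f p) := Finset.mem_filter.mpr ⟨hp, rfl⟩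
  have hadj : ∀ v ∈ N, C.Adj r W p v := fun v hv => by
    obtain ⟨⟨hvA, hvp⟩, hvr⟩ := mem_colorNbrs.mp hv
    exact ⟨hAW hp, hAW hvA, fun e => hvp (e ▸ hp'), by rw [C.symm, hvr p hp']⟩
  have hNs : ∀ v, (N.filter (f · = v)).card ≤ u / 2 := fun v => by
    by_cases hv : v = f p
    · rw [Finset.filter_eq_empty_iff.mpr fun w hw e => (mem_colorNbrs.mp hw).1.2
        (Finset.mem_filter.mpr ⟨hNA hw, e.trans hv⟩)]
      exact Nat.zero_le _
    · exact (Finset.card_le_card (Finset.filter_subset_filter _ hNA)).trans (hs v hv)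
  obtain ⟨X, Y, hX, hY, hXcard, hYcard, hXY⟩ := exists_split_of_small_fibers hNs (not_le.mp hlt)
  have hbic : C.IsBiclique b A (u / 2 + 1) X Y :=
    { left_subset := hX.trans hNA
      right_subset := hY.trans hNA
      disjoint := Finset.disjoint_left.mpr fun v hv hv' => hXY v hv v hv' rfl
      color := fun x hx y hy => (h.color_cross (hNA (hX hx)) (hNA (hY hy))
        (hXY x hx y hy)).resolve_left (color_ne_of_not_meetsTriangle hr hp (hadj x (hX hx))
          (hadj y (hY hy)) fun e => hXY x hx y hy (congrArg f e))
      le_card_left := hXcard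
      le_card_right := hYcard }
  exact hbic.not_meetsTriangle hu hfree hAW h.symm.connected_left hb

theorem IsPrimePartition.card_le_card_fiber_add (h : C.IsPrimePartition A f r b) (hp : p ∈ A) :
    A.card ≤ (A.filter (f · = f p)).card + (C.colorNbrs r A (A.filter (f · = f p))).card +
      (C.colorNbrs b A (A.filter (f · = f p))).card := by
  have hcover : A ⊆ A.filter (f · = f p) ∪ C.colorNbrs r A (A.filter (f · = f p)) ∪
      C.colorNbrs b A (A.filter (f · = f p)) := fun v hv => by
    by_cases hvp : f v = f p
    · simp [hv, hvp]
    · obtain hv' | hv' := h.mem_colorNbrs_or hp hv hvp <;> simp [hv']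
  have := Finset.card_le_card hcover
  have := Finset.card_union_le (A.filter (f · = f p) ∪ C.colorNbrs r A (A.filter (f · = f p)))
    (C.colorNbrs b A (A.filter (f · = f p)))
  have := Finset.card_union_le (A.filter (f · = f p)) (C.colorNbrs r A (A.filter (f · = f p)))
  omega

theorem IsInductionStep.card_le_add_four_mul (hS : C.IsInductionStep K W u k) (hAW : A ⊆ W)
    (h : C.IsPrimePartition A f r b) (hr : ¬ C.MeetsTriangle r W A) (hp : p ∈ A)
    (hps : u / 2 < (A.filter (f · = f p)).card)
    (hs : ∀ v, v ≠ f p → (A.filter (f · = v)).card ≤ u / 2) :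
    A.card ≤ maxOrder u (k + 2) + 4 * (u / 2) := by
  have hu : 2 ≤ u := by have := hS.three_le; omega
  have hK := (hS.isAdmissible.mono hAW).mem
  have hfib : A.filter (f · = f p) ⊆ A := Finset.filter_subset _ _
  have hbfree := hS.isAdmissible.free b
  have hle := hS.card_le_of_ne (hfib.trans hAW) (h.left_mem hK) fun x hx y hy hxy =>
    h.color_ne_left hAW hr (hfib hx) (hfib hy) hxy
      ((Finset.mem_filter.mp hx).2.trans (Finset.mem_filter.mp hy).2.symm)
  by_cases hb : C.MeetsTriangle b W A
  · have := h.card_le_card_fiber_add hp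
    have := h.card_colorNbrs_le_three_mul hAW hu hbfree hr hb hp hs
    have := hb.card_colorNbrs_le h.symm.connected_left hu hbfree hAW hfib hps
    omega
  · have himg := h.card_image_le_five hAW hr hb
    have hAcard := card_le_sum_card_fiber_add (A := A) (f := f) (T := {f p})
      (by simpa using ⟨p, hp, rfl⟩) fun v hv => hs v (by simpa using hv)
    rw [Finset.sum_singleton, Finset.card_singleton] at hAcard
    have : ((A.image f).card - 1) * (u / 2) ≤ 4 * (u / 2) := Nat.mul_le_mul_right _ (by omega)
    omega

theorem IsInductionStep.card_le_of_unique_large (hS : C.IsInductionStep K W u k)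
    (hA : C.IsSmallCut (u / 2) W A) (h : C.IsPrimePartition A f r b) (hp : p ∈ A)
    (hps : u / 2 < (A.filter (f · = f p)).card)
    (hs : ∀ v, v ≠ f p → (A.filter (f · = v)).card ≤ u / 2)
    (hN : u / 2 < (C.colorNbrs r A (A.filter (f · = f p))).card) :
    W.card ≤ maxOrder u (k + 3) := by
  have hu : 2 ≤ u := by have := hS.three_le; omega
  have hr : ¬ C.MeetsTriangle r W A :=
    (isBiclique_colorNbrs (Finset.filter_subset _ _) hps hN).not_meetsTriangle hu
      (hS.isAdmissible.free r) hA.subset h.connected_left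
  have hrK := h.left_mem (hS.isAdmissible.mono hA.subset).mem
  have hWA := hA.card_sdiff_le (K := K.erase r) (fun c _ => hA.card_le c) fun v hv hvA a ha =>
    Finset.mem_erase.mpr ⟨h.color_ne_left_of_notMem hA.toIsModule hr hv hvA ha,
      hS.isAdmissible.mem v hv a (hA.subset ha) fun e => hvA (e ▸ ha)⟩
  have hcard : (K.erase r).card = k + 2 := by rw [Finset.card_erase_of_mem hrK, hS.card_eq]; rfl
  rw [hcard] at hWA
  have hAcard := hS.card_le_add_four_mul hA.subset h hr hp hps hs
  have hW := Finset.card_sdiff_add_card_eq_card hA.subset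
  have := maxOrder_add_maxOrder_add_mul_le u k
  have := le_maxOrder_succ hS.three_le k
  have := Nat.mul_div_le u 2
  linarith

theorem IsPrimePartition.card_colorNbrs_fiber_le (h : C.IsPrimePartition A f r b)
    (hA : C.IsSmallCut (u / 2) W A) (hu : 2 ≤ u) (hc : ¬ C.HasTailedTriangle c W (u + 1))
    (hb : C.MeetsTriangle b W A) (hp : p ∈ A) (hps : u / 2 < (A.filter (f · = f p)).card)
    (hcr : c ≠ r) : (C.colorNbrs c W (A.filter (f · = f p))).card ≤ u / 2 := by
  have hm := h.isModule_fiber hp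
  refine hA.card_colorNbrs_le hm hu hc hps ?_
  by_cases hcb : c = b
  · subst hcb
    exact hb.card_colorNbrs_le h.symm.connected_left hu hc hA.subset hm.subset hps
  · simp [h.colorNbrs_fiber_eq_empty hp hcr hcb]

theorem IsPrimePartition.isLinkedPair (h : C.IsPrimePartition A f r b)
    (hA : C.IsSmallCut (u / 2) W A) (hu : 2 ≤ u) (hfree : ∀ c, ¬ C.HasTailedTriangle c W (u + 1))
    (hb : C.MeetsTriangle b W A) (hp : p ∈ A) (hq : q ∈ A)
    (hbic : C.IsBiclique r W (u / 2 + 1) (A.filter (f · = f p)) (A.filter (f · = f q))) :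
    C.IsLinkedPair r b W (u / 2) (A.filter (f · = f p)) (A.filter (f · = f q)) := by
  refine ⟨h.ne, (h.isModule_fiber hp).trans hA.toIsModule,
    (h.isModule_fiber hq).trans hA.toIsModule, hbic, fun v hv hvp hvq x hx y hy => ?_,
    fun c => h.card_colorNbrs_fiber_le hA hu (hfree c) hb hp hbic.le_card_left,
    fun c => h.card_colorNbrs_fiber_le hA hu (hfree c) hb hq hbic.le_card_right⟩
  rw [Finset.mem_filter] at hvp hvq hx hy
  by_cases hvA : v ∈ A
  · have hvx := h.color_cross hvA hx.1 fun e => hvp ⟨hvA, e.trans hx.2⟩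
    have hvy := h.color_cross hvA hy.1 fun e => hvq ⟨hvA, e.trans hy.2⟩
    grind
  · exact .inl (hA.color_eq v hv hvA x hx.1 y hy.1)

theorem IsInductionStep.card_le_of_two_large (hS : C.IsInductionStep K W u k)
    (hA : C.IsSmallCut (u / 2) W A) (h : C.IsPrimePartition A f r b) (hp : p ∈ A) (hq : q ∈ A)
    (hpq : f p ≠ f q) (hps : u / 2 < (A.filter (f · = f p)).card)
    (hqs : u / 2 < (A.filter (f · = f q)).card) (hc : C p q = r) :
    W.card ≤ maxOrder u (k + 3) := by
  have hu : 2 ≤ u := by have := hS.three_le; omega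
  have hbic : C.IsBiclique r A (u / 2 + 1) (A.filter (f · = f p)) (A.filter (f · = f q)) :=
    { left_subset := Finset.filter_subset _ _
      right_subset := Finset.filter_subset _ _
      disjoint := disjoint_fiber hpq
      color := fun x hx y hy => by
        rw [Finset.mem_filter] at hx hy
        rw [h.color_eq hx.1 hp hy.1 hq hx.2 hy.2 (by rwa [hx.2, hy.2]), hc]
      le_card_left := hps
      le_card_right := hqs }
  by_cases hb : C.MeetsTriangle b W A
  · exact hS.card_le_of_isLinkedPair (h.isLinkedPair hA hu hS.isAdmissible.free hb hp hq
      (hbic.mono_set hA.subset)) (h.left_mem (hS.isAdmissible.mono hA.subset).mem)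
  · exact hS.card_le_of_not_meetsTriangle hA h (hbic.not_meetsTriangle hu (hS.isAdmissible.free r)
      hA.subset h.connected_left) hb hp hq hpq hqs

end LargeFibers

section Joins

variable {W : Finset V} {K : Finset κ} {f : V → V} {k : ℕ} {r : κ}

/-- `A` is the disjoint union of the nonempty sets `X` and `Y`, and all pairs between them have the
colour `r`. -/
structure IsJoin (C : PairColoring V κ) (r : κ) (A X Y : Finset V) : Prop where
  union_eq : X ∪ Y = A
  disjoint : Disjoint X Y
  nonempty_left : X.Nonempty
  nonempty_right : Y.Nonempty
  color : ∀ x ∈ X, ∀ y ∈ Y, C x y = r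

theorem IsJoin.symm (h : C.IsJoin r A X Y) : C.IsJoin r A Y X where
  union_eq := by rw [Finset.union_comm, h.union_eq]
  disjoint := h.disjoint.symm
  nonempty_left := h.nonempty_right
  nonempty_right := h.nonempty_left
  color y hy x hx := by rw [C.symm, h.color x hx y hy]

theorem IsJoin.mem_right (h : C.IsJoin r A X Y) (hv : v ∈ A) (hvX : v ∉ X) : v ∈ Y :=
  (Finset.mem_union.mp (h.union_eq ▸ hv)).resolve_left hvX

theorem IsJoin.isModule_left (h : C.IsJoin r A X Y) : C.IsModule A X where
  subset := h.union_eq ▸ Finset.subset_union_left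
  nonempty := h.nonempty_left
  color_eq v hv hvX a ha a' ha' := by
    rw [h.symm.color v (h.mem_right hv hvX) a ha, h.symm.color v (h.mem_right hv hvX) a' ha']

theorem IsJoin.colorNbrs_eq_empty (h : C.IsJoin r A X Y) (hc : c ≠ r) :
    C.colorNbrs c A X = ∅ := by
  obtain ⟨x, hx⟩ := h.nonempty_left
  refine Finset.eq_empty_of_forall_notMem fun v hv => ?_
  obtain ⟨⟨hvA, hvX⟩, hvc⟩ := mem_colorNbrs.mp hv
  exact hc ((hvc x hx).symm.trans (h.symm.color v (h.mem_right hvA hvX) x hx))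

/-- Otherwise the other side would be a smaller small cut. -/
theorem IsJoin.lt_card_right (h : C.IsJoin r A X Y) (hA : C.IsSmallCut (u / 2) W A)
    (hmin : ∀ A', C.IsSmallCut (u / 2) W A' → A.card ≤ A'.card) (hu : 2 ≤ u)
    (hfree : ∀ c, ¬ C.HasTailedTriangle c W (u + 1)) (hAcard : 2 * (u / 2) < A.card) :
    u / 2 < Y.card := by
  by_contra! hY
  have hcard := Finset.card_union_of_disjoint h.disjoint
  rw [h.union_eq] at hcard
  have hcut : C.IsSmallCut (u / 2) W X :=
    { h.isModule_left.trans hA.toIsModule with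
      card_le := fun c => hA.card_colorNbrs_le h.isModule_left hu (hfree c) (by omega)
        ((Finset.card_le_card fun v hv => h.mem_right (mem_colorNbrs.mp hv).1.1
          (mem_colorNbrs.mp hv).1.2).trans hY) }
  have := hmin X hcut
  have := h.nonempty_right.card_pos
  omega

theorem IsJoin.isBiclique (h : C.IsJoin r A X Y) (hX : n ≤ X.card) (hY : n ≤ Y.card) :
    C.IsBiclique r A n X Y where
  left_subset := h.isModule_left.subset
  right_subset := h.symm.isModule_left.subset
  disjoint := h.disjoint
  color := h.color
  le_card_left := hX
  le_card_right := hY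

theorem IsJoin.card_colorNbrs_le (h : C.IsJoin r A X Y) (hA : C.IsSmallCut (u / 2) W A)
    (hu : 2 ≤ u) (hc : ¬ C.HasTailedTriangle c W (u + 1)) (hX : u / 2 < X.card) (hcr : c ≠ r) :
    (C.colorNbrs c W X).card ≤ u / 2 :=
  hA.card_colorNbrs_le h.isModule_left hu hc hX (by simp [h.colorNbrs_eq_empty hcr])

theorem IsInductionStep.card_le_of_isJoin (hS : C.IsInductionStep K W u k)
    (hA : C.IsSmallCut (u / 2) W A) (hmin : ∀ A', C.IsSmallCut (u / 2) W A' → A.card ≤ A'.card)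
    (hAcard : 2 * (u / 2) < A.card) (h : C.IsJoin r A X Y) : W.card ≤ maxOrder u (k + 3) := by
  have hu : 2 ≤ u := by have := hS.three_le; omega
  have hfree := hS.isAdmissible.free
  have hX := h.symm.lt_card_right hA hmin hu hfree hAcard
  have hY := h.lt_card_right hA hmin hu hfree hAcard
  have hbic := (h.isBiclique hX hY).mono_set hA.subset
  obtain ⟨x, hx⟩ := h.nonempty_left
  obtain ⟨y, hy⟩ := h.nonempty_right
  have hxy := hbic.adj hx hy
  have hr : r ∈ K := hxy.color ▸ hS.isAdmissible.mem x hxy.left_mem y hxy.right_mem hxy.ne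
  obtain ⟨b, -, hbr⟩ := Finset.exists_mem_ne (by rw [hS.card_eq]; omega : 1 < K.card) r
  refine hS.card_le_of_isLinkedPair (b := b) ⟨hbr.symm, h.isModule_left.trans hA.toIsModule,
    h.symm.isModule_left.trans hA.toIsModule, hbic, fun v hv hvX hvY x hx y hy => .inl ?_,
    fun c => h.card_colorNbrs_le hA hu (hfree c) hX,
    fun c => h.symm.card_colorNbrs_le hA hu (hfree c) hY⟩ hr
  exact hA.color_eq v hv (fun hvA => hvY (h.mem_right hvA hvX)) x (h.isModule_left.subset hx) y
    (h.symm.isModule_left.subset hy)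

theorem IsModularPartition.exists_isJoin (h : C.IsModularPartition A f)
    (hcard : 1 < (A.image f).card)
    (hr : ∀ x ∈ A.image f, ∀ y ∈ A.image f, x ≠ y → C x y = r) : ∃ X Y, C.IsJoin r A X Y := by
  obtain ⟨_, hp', _, hq', hpq⟩ := Finset.one_lt_card.mp hcard
  obtain ⟨p, hp, rfl⟩ := Finset.mem_image.mp hp'
  obtain ⟨q, hq, rfl⟩ := Finset.mem_image.mp hq'
  refine ⟨A.filter (f · = f p), A.filter (¬ f · = f p), Finset.filter_union_filter_not_eq _ A,
    Finset.disjoint_filter_filter_not _ _ _, ⟨p, Finset.mem_filter.mpr ⟨hp, rfl⟩⟩,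
    ⟨q, Finset.mem_filter.mpr ⟨hq, hpq.symm⟩⟩, fun x hx y hy => ?_⟩
  rw [Finset.mem_filter] at hx hy
  have hxy : f x ≠ f y := fun e => hy.2 (e.symm.trans hx.2)
  rw [← h.color_apply x hx.1 y hy.1 hxy]
  exact hr _ (Finset.mem_image_of_mem f hx.1) _ (Finset.mem_image_of_mem f hy.1) hxy

end Joins

section UpperBound

variable {W : Finset V} {K : Finset κ} {f : V → V} {k : ℕ} {r b : κ} {p : V}

theorem IsInductionStep.lt_card_add_of_isSmallCut (hS : C.IsInductionStep K W u k)
    (hA : C.IsSmallCut (u / 2) W A) (hW : maxOrder u (k + 3) < W.card) :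
    5 * u < A.card + 3 * (u / 2) := by
  have hout := hA.card_sdiff_le (K := K) (fun c _ => hA.card_le c) fun v hv hvA a ha =>
    hS.isAdmissible.mem v hv a (hA.subset ha) fun e => hvA (e ▸ ha)
  have := Finset.card_sdiff_add_card_eq_card hA.subset
  have := five_mul_add_mul_le_maxOrder hS.three_le k
  rw [hS.card_eq, add_mul] at hout
  omega

theorem IsPrimePartition.exists_lt_card_fiber (h : C.IsPrimePartition A f r b) (hu : 3 ≤ u)
    (hfree : ∀ c, ¬ C.HasTailedTriangle c A (u + 1)) (hA : 5 * u < A.card + 3 * (u / 2)) :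
    ∃ p ∈ A, u / 2 < (A.filter (f · = f p)).card := by
  by_contra! hsmall
  have hf : ∀ v, (A.filter (f · = v)).card ≤ u / 2 := fun v =>
    card_fiber_le_of_mem_image fun hv => by
      obtain ⟨p, hp, rfl⟩ := Finset.mem_image.mp hv
      exact hsmall p hp
  have hcross : ∀ x ∈ A, ∀ y ∈ A, f x ≠ f y → C x y = r ∨ C x y = b :=
    fun x hx y hy => h.color_cross hx hy
  have himg : 6 ≤ (A.image f).card := by
    by_contra hlt
    have := Finset.card_le_mul_card_image (f := f) A (u / 2) fun v _ => hf v
    have : u / 2 * (A.image f).card ≤ u / 2 * 5 := Nat.mul_le_mul_left _ (by omega)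
    omega
  have hr := h.connected_left
  have hb := h.symm.connected_left
  obtain ⟨x, y, z, ht | ht⟩ := exists_isTriangle_of_six_le_card himg h.color_quotient
  · exact hfree r ((ht.mono h.image_subset).meetsTriangle.hasTailedTriangle_of_small_fibers hu hr hb
      hcross hf hA (hfree b))
  · exact hfree b ((ht.mono h.image_subset).meetsTriangle.hasTailedTriangle_of_small_fibers hu hb hr
      (fun x hx y hy hxy => (hcross x hx y hy hxy).symm) hf hA (hfree r))

/-- Otherwise the fibre would be a smaller small cut. -/
theorem IsPrimePartition.lt_card_colorNbrs_or (h : C.IsPrimePartition A f r b)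
    (hA : C.IsSmallCut (u / 2) W A) (hmin : ∀ A', C.IsSmallCut (u / 2) W A' → A.card ≤ A'.card)
    (hu : 2 ≤ u) (hfree : ∀ c, ¬ C.HasTailedTriangle c W (u + 1)) (hp : p ∈ A)
    (hps : u / 2 < (A.filter (f · = f p)).card) :
    u / 2 < (C.colorNbrs r A (A.filter (f · = f p))).card ∨
      u / 2 < (C.colorNbrs b A (A.filter (f · = f p))).card := by
  by_contra! hle
  have hm := h.isModule_fiber hp
  have hcut : C.IsSmallCut (u / 2) W (A.filter (f · = f p)) :=
    { hm.trans hA.toIsModule with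
      card_le := fun c => hA.card_colorNbrs_le hm hu (hfree c) hps <| by
        by_cases hr : c = r
        · exact hr ▸ hle.1
        by_cases hb : c = b
        · exact hb ▸ hle.2
        simp [h.colorNbrs_fiber_eq_empty hp hr hb] }
  have heq := Finset.eq_of_subset_of_card_le hm.subset (hmin _ hcut)
  have hf := Finset.filter_eq_self.mp heq
  refine h.one_lt_card.not_ge (Finset.card_le_one.mpr fun v hv w hw => ?_)
  obtain ⟨x, hx, rfl⟩ := Finset.mem_image.mp hv
  obtain ⟨y, hy, rfl⟩ := Finset.mem_image.mp hw
  exact (hf x hx).trans (hf y hy).symm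

theorem IsInductionStep.card_le_of_isPrimePartition (hS : C.IsInductionStep K W u k)
    (hA : C.IsSmallCut (u / 2) W A) (hmin : ∀ A', C.IsSmallCut (u / 2) W A' → A.card ≤ A'.card)
    (hAcard : 5 * u < A.card + 3 * (u / 2)) (h : C.IsPrimePartition A f r b) :
    W.card ≤ maxOrder u (k + 3) := by
  have hu := hS.three_le
  have hfree := hS.isAdmissible.free
  obtain ⟨p, hp, hps⟩ := h.exists_lt_card_fiber hu
    (hS.isAdmissible.mono hA.subset).free hAcard
  by_cases hq : ∃ q ∈ A, f p ≠ f q ∧ u / 2 < (A.filter (f · = f q)).card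
  · obtain ⟨q, hq, hpq, hqs⟩ := hq
    obtain hc | hc := h.color_cross hp hq hpq
    · exact hS.card_le_of_two_large hA h hp hq hpq hps hqs hc
    · exact hS.card_le_of_two_large hA h.symm hp hq hpq hps hqs hc
  · push Not at hq
    have hs : ∀ v, v ≠ f p → (A.filter (f · = v)).card ≤ u / 2 := fun v hv =>
      card_fiber_le_of_mem_image fun hvA => by
        obtain ⟨q, hqA, rfl⟩ := Finset.mem_image.mp hvA
        exact hq q hqA hv.symm
    obtain hN | hN := h.lt_card_colorNbrs_or hA hmin (by omega) hfree hp hps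
    · exact hS.card_le_of_unique_large hA h hp hps hs hN
    · exact hS.card_le_of_unique_large hA h.symm hp hps hs hN

theorem IsInductionStep.card_le (hS : C.IsInductionStep K W u k) :
    W.card ≤ maxOrder u (k + 3) := by
  by_contra! hW
  obtain ⟨A, hA, hmin⟩ := exists_minimal_isSmallCut C (u / 2)
    (Finset.card_pos.mp (Nat.zero_lt_of_lt hW))
  have hAcard := hS.lt_card_add_of_isSmallCut hA hW
  have hu := hS.three_le
  obtain ⟨f, r, ⟨hf, hcard, hr⟩ | ⟨b, hf⟩⟩ :=
    (hS.isAdmissible.mono hA.subset).noRainbow.exists_isModularPartition (by omega)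
  · obtain ⟨X, Y, hXY⟩ := hf.exists_isJoin hcard hr
    exact hW.not_ge (hS.card_le_of_isJoin hA hmin (by omega) hXY)
  · exact hW.not_ge (hS.card_le_of_isPrimePartition hA hmin hAcard hf)

theorem IsAdmissible.card_le_maxOrder {C : PairColoring V κ} {K : Finset κ} {A : Finset V}
    (h : C.IsAdmissible K A (u + 1)) (hu : 3 ≤ u) : A.card ≤ maxOrder u K.card := by
  induction hK : K.card using Nat.strong_induction_on generalizing C K A with
  | _ n ih =>
    subst hK
    match hK : K.card with
    | 0 =>
      refine Finset.card_le_one.mpr fun x hx y hy => ?_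
      by_contra hxy
      simpa [Finset.card_eq_zero.mp hK] using h.mem x hx y hy hxy
    | 1 =>
      obtain ⟨r, rfl⟩ := Finset.card_eq_one.mp hK
      by_contra hlt
      exact h.free r (hasTailedTriangle_of_forall_eq (by omega) (not_le.mp hlt)
        (by simpa using h.mem))
    | 2 =>
      obtain ⟨r, b, -, rfl⟩ := Finset.card_eq_two.mp hK
      exact card_le_of_two_colors hu (by simpa using h.mem) (h.free r) (h.free b)
    | k + 3 =>
      exact IsInductionStep.card_le ⟨hu, h, hK, fun C' K' A' hK' h' =>
        ih K'.card (by omega) h' rfl⟩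

end UpperBound

section LowerBound

variable {W μ : Type*} {D : PairColoring W μ} {d : μ} {K : Finset κ} {L : Finset μ}
  {T : Finset W} {t : ℕ}

theorem IsTailedTriangle.map (h : C.IsTailedTriangle c A l) (f : V → W)
    (hf : ∀ x ∈ l, ∀ y ∈ l, f x = f y → x = y)
    (hcolor : ∀ x ∈ l, ∀ y ∈ l, C x y = c → D (f x) (f y) = d) (hT : ∀ x ∈ l, f x ∈ T) :
    D.IsTailedTriangle d T (l.map f) := by
  obtain ⟨hp, x, y, z, l', rfl, hxz⟩ := h
  refine ⟨⟨hp.nodup.map_on hf, List.forall_mem_map.mpr hT, ?_⟩, f x, f y, f z, l'.map f, rfl,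
    hcolor x (by simp) z (by simp) hxz⟩
  rw [List.isChain_map]
  exact hp.isChain.imp_of_mem_imp fun x y hx hy => hcolor x hx y hy

theorem hasTailedTriangle_three_iff :
    C.HasTailedTriangle c A 3 ↔ ∃ x y z, C.IsTriangle c A x y z := by
  constructor
  · rintro ⟨l, hl, -⟩
    obtain ⟨-, x, y, z, l', rfl, -⟩ := id hl
    exact ⟨x, y, z, hl.isTriangle⟩
  · rintro ⟨x, y, z, h⟩
    exact ⟨_, h.isTailedTriangle, le_rfl⟩

theorem HasTailedTriangle.le_card (h : C.HasTailedTriangle c A m) : m ≤ A.card := by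
  obtain ⟨l, ⟨hp, -⟩, hm⟩ := h
  rw [← List.toFinset_card_of_nodup hp.nodup] at hm
  exact hm.trans (Finset.card_le_card fun v hv => hp.mem v (List.mem_toFinset.mp hv))

/-- The colouring in which all pairs have the same colour. -/
def const (V : Type*) (c : κ) : PairColoring V κ where
  toFun _ _ := c
  symm _ _ := rfl

theorem isAdmissible_const (hc : c ∈ K) (hA : A.card < t) : (const V c).IsAdmissible K A t where
  mem _ _ _ _ _ := hc
  noRainbow _ _ _ _ _ _ _ _ _ := .inl rfl
  free _ h := hA.not_ge h.le_card

/-- The colouring obtained from `D` by replacing each vertex by a copy of `C`, the colours of which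
are taken to be different from those of `D`. -/
noncomputable def lex (C : PairColoring V κ) (D : PairColoring W μ) :
    PairColoring (V × W) (κ ⊕ μ) where
  toFun p q := if p.2 = q.2 then .inl (C p.1 q.1) else .inr (D p.2 q.2)
  symm p q := by simp only [C.symm p.1, D.symm p.2, eq_comm]

theorem lex_eq_inl_iff {p q : V × W} : C.lex D p q = .inl c ↔ p.2 = q.2 ∧ C p.1 q.1 = c := by
  simp only [lex]
  split_ifs with h <;> simp [h]

theorem lex_eq_inr_iff {p q : V × W} : C.lex D p q = .inr d ↔ p.2 ≠ q.2 ∧ D p.2 q.2 = d := by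
  simp only [lex]
  split_ifs with h <;> simp [h]

theorem NoRainbow.lex (hC : C.NoRainbow A) (hD : D.NoRainbow T) :
    (C.lex D).NoRainbow (A ×ˢ T) := by
  rintro ⟨x, x'⟩ hx ⟨y, y'⟩ hy ⟨z, z'⟩ hz hxy hyz hxz
  rw [Finset.mem_product] at hx hy hz
  have hC := hC x hx.1 y hy.1 z hz.1
  have hD := hD x' hx.2 y' hy.2 z' hz.2
  have hsymm := D.symm x' y'
  simp only [PairColoring.lex, ne_eq, Prod.mk.injEq] at *
  grind

theorem IsTailedTriangle.fst_of_lex {l : List (V × W)}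
    (h : (C.lex D).IsTailedTriangle (.inl c) (A ×ˢ T) l) :
    C.IsTailedTriangle c A (l.map Prod.fst) := by
  have hsnd : ∀ p ∈ l, ∀ q ∈ l, p.2 = q.2 := by
    have hchain : (l.map Prod.snd).IsChain (· = ·) := (List.isChain_map _).mpr
      (h.1.isChain.imp fun _ _ hpq => (lex_eq_inl_iff.mp hpq).1)
    exact fun p hp q hq => (List.isChain_iff_pairwise.mp hchain).forall_of_forall (fun _ _ => rfl)
      (List.mem_map_of_mem hp) (List.mem_map_of_mem hq)
  exact h.map Prod.fst (fun p hp q hq hpq => Prod.ext hpq (hsnd p hp q hq))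
    (fun p _ q _ hpq => (lex_eq_inl_iff.mp hpq).2)
    (fun p hp => (Finset.mem_product.mp (h.1.mem p hp)).1)

theorem IsTriangle.snd_of_lex {p q r : V × W}
    (h : (C.lex D).IsTriangle (.inr d) (A ×ˢ T) p q r) : D.IsTriangle d T p.2 q.2 r.2 := by
  have hadj {p q : V × W} (h : (C.lex D).Adj (.inr d) (A ×ˢ T) p q) : D.Adj d T p.2 q.2 :=
    ⟨(Finset.mem_product.mp h.left_mem).2, (Finset.mem_product.mp h.right_mem).2,
      (lex_eq_inr_iff.mp h.color).1, (lex_eq_inr_iff.mp h.color).2⟩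
  exact ⟨hadj h.adj₁₂, hadj h.adj₁₃, hadj h.adj₂₃⟩

theorem IsAdmissible.lex (hC : C.IsAdmissible K A t) (hD : D.IsAdmissible L T 3) (ht : 3 ≤ t) :
    (C.lex D).IsAdmissible (K.disjSum L) (A ×ˢ T) t where
  mem p hp q hq hpq := by
    rw [Finset.mem_product] at hp hq
    by_cases h : p.2 = q.2
    · rw [lex_eq_inl_iff.mpr ⟨h, rfl⟩, Finset.inl_mem_disjSum]
      exact hC.mem _ hp.1 _ hq.1 fun h' => hpq (Prod.ext h' h)
    · rw [lex_eq_inr_iff.mpr ⟨h, rfl⟩, Finset.inr_mem_disjSum]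
      exact hD.mem _ hp.2 _ hq.2 h
  noRainbow := hC.noRainbow.lex hD.noRainbow
  free
    | .inl c => fun ⟨l, hl, hlt⟩ => hC.free c ⟨_, hl.fst_of_lex, by rwa [List.length_map]⟩
    | .inr d => fun h => hD.free d <| by
      obtain ⟨p, q, r, hpqr⟩ := hasTailedTriangle_three_iff.mp (h.mono subset_rfl ht)
      exact hasTailedTriangle_three_iff.mpr ⟨_, _, _, hpqr.snd_of_lex⟩

/-- The decomposition of the complete graph on five vertices into two cycles of length five. -/
def pentagon : PairColoring (Fin 5) (Fin 2) where
  toFun x y := if y = x + 1 ∨ x = y + 1 then 0 else 1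
  symm _ _ := by simp only [or_comm]

theorem isAdmissible_pentagon : pentagon.IsAdmissible Finset.univ Finset.univ 3 where
  mem _ _ _ _ _ := Finset.mem_univ _
  noRainbow x _ y _ z _ _ _ _ := by
    generalize pentagon x y = a, pentagon y z = b, pentagon x z = c
    revert a b c
    decide
  free c h := by
    obtain ⟨x, y, z, hxy, hxz, hyz⟩ := hasTailedTriangle_three_iff.mp h
    have hno_triangle : ∀ x y z : Fin 5, x ≠ y → x ≠ z → y ≠ z → pentagon x y = pentagon x z →
        pentagon x y ≠ pentagon y z := by decide
    exact hno_triangle x y z hxy.ne hxz.ne hyz.ne (hxy.color.trans hxz.color.symm)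
      (hxy.color.trans hyz.color.symm)

theorem exists_isAdmissible (hu : 2 ≤ u) (k : ℕ) :
    ∃ (V κ : Type) (_ : Fintype V) (_ : Fintype κ) (C : PairColoring V κ),
      Fintype.card V = maxOrder u (k + 1) ∧ Fintype.card κ = k + 1 ∧
      C.IsAdmissible Finset.univ Finset.univ (u + 1) := by
  induction k using Nat.twoStepInduction with
  | zero => exact ⟨Fin u, Fin 1, inferInstance, inferInstance, const _ 0, by simp [maxOrder], rfl,
      isAdmissible_const (Finset.mem_univ _) (by simp)⟩
  | one =>
    refine ⟨Fin u × Fin 2, Fin 1 ⊕ Fin 1, inferInstance, inferInstance,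
      (const _ 0).lex (const _ 0), ?_, rfl, ?_⟩
    · simp [maxOrder, mul_comm]
    · rw [← Finset.univ_disjSum_univ, ← Finset.univ_product_univ]
      exact (isAdmissible_const (Finset.mem_univ _) (by simp)).lex
        (isAdmissible_const (Finset.mem_univ _) (by simp)) (by omega)
  | more k ih _ =>
    obtain ⟨V, κ, _, _, C, hV, hκ, hC⟩ := ih
    refine ⟨V × Fin 5, κ ⊕ Fin 2, inferInstance, inferInstance, C.lex pentagon, ?_, ?_, ?_⟩
    · simp [maxOrder, hV, mul_comm]
    · simp [hκ, add_right_comm]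
    · rw [← Finset.univ_disjSum_univ, ← Finset.univ_product_univ]
      exact hC.lex isAdmissible_pentagon (by omega)

/-- The colouring of the pairs in `V` induced by a map `f` from `V` to the vertices of `D` and a
renaming `e` of the colours. -/
def comap (D : PairColoring W μ) (f : V ↪ W) (e : μ ≃ κ) : PairColoring V κ where
  toFun x y := e (D (f x) (f y))
  symm x y := by rw [D.symm]

theorem IsAdmissible.comap (h : D.IsAdmissible L T t) {f : V ↪ W} (hf : ∀ x ∈ A, f x ∈ T)
    (e : μ ≃ κ) : (D.comap f e).IsAdmissible (L.map e.toEmbedding) A t where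
  mem x hx y hy hxy := Finset.mem_map_of_mem _
    (h.mem _ (hf x hx) _ (hf y hy) (f.injective.ne hxy))
  noRainbow x hx y hy z hz hxy hyz hxz := by
    simpa only [PairColoring.comap, e.injective.eq_iff] using h.noRainbow _ (hf x hx) _ (hf y hy) _
      (hf z hz) (f.injective.ne hxy) (f.injective.ne hyz) (f.injective.ne hxz)
  free c := fun ⟨l, hl, hlt⟩ => h.free (e.symm c) ⟨l.map f, hl.map f
    (fun _ _ _ _ hxy => f.injective hxy) (fun _ _ _ _ hxy => e.eq_symm_apply.mpr hxy)
    (fun x hx => hf x (hl.1.mem x hx)), by rwa [List.length_map]⟩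

end LowerBound

section Labelings

variable {t : ℕ}

/-- The restriction of `C` to the edges of the complete graph. -/
def toLabeling (C : PairColoring V κ) : SimpleGraph.TopEdgeLabeling V κ :=
  SimpleGraph.EdgeLabeling.mk (fun x y _ => C x y) fun x y _ => C.symm y x

theorem exists_toLabeling_eq [Nonempty κ] (L : SimpleGraph.TopEdgeLabeling V κ) :
    ∃ C : PairColoring V κ, C.toLabeling = L := by
  obtain ⟨c⟩ := ‹Nonempty κ›
  refine ⟨⟨fun x y => if h : x ≠ y then L.get x y h else c, fun x y => ?_⟩, ?_⟩
  · by_cases h : x = y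
    · rw [h]
    · rw [dif_pos h, dif_pos (Ne.symm h)]
      exact (L.get_comm x y _).symm
  · ext x y h
    exact dif_pos h

theorem labelGraph_toLabeling_adj : (C.toLabeling.labelGraph c).Adj x y ↔ x ≠ y ∧ C x y = c := by
  rw [SimpleGraph.TopEdgeLabeling.labelGraph_adj]
  simp only [toLabeling, SimpleGraph.EdgeLabeling.get_mk, exists_prop]

theorem pathPlus_adj (i j : Fin t) : (pathPlus t).Adj i j ↔
    (i.val + 1 = j.val ∨ j.val + 1 = i.val) ∨
      (i.val = 0 ∧ j.val = 2) ∨ (j.val = 0 ∧ i.val = 2) := by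
  simp only [pathPlus, SimpleGraph.sup_adj, SimpleGraph.pathGraph_adj, SimpleGraph.fromRel_adj,
    ne_eq, Fin.ext_iff]
  omega

theorem isTailedTriangle_ofFn {f : Fin t → V} (ht : 3 ≤ t) (hf : Function.Injective f)
    (hA : ∀ i, f i ∈ A) (hcolor : ∀ i j, (pathPlus t).Adj i j → C (f i) (f j) = c) :
    C.IsTailedTriangle c A (List.ofFn f) := by
  obtain ⟨t, rfl⟩ := Nat.exists_eq_add_of_le' ht
  refine ⟨⟨List.nodup_ofFn.mpr hf, List.forall_mem_ofFn_iff.mpr hA, ?_⟩, f 0, f 1, f 2,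
    List.ofFn fun i : Fin t => f i.succ.succ.succ, by simp only [List.ofFn_succ]; rfl,
    hcolor 0 2 ((pathPlus_adj 0 2).mpr (.inr (.inl ⟨rfl, rfl⟩)))⟩
  refine List.isChain_iff_getElem.mpr fun i hi => ?_
  rw [List.getElem_ofFn, List.getElem_ofFn]
  exact hcolor _ _ ((pathPlus_adj _ _).mpr (.inl (.inl rfl)))

theorem IsTailedTriangle.color_eq_of_adj (h : C.IsTailedTriangle c A l) {i j : Fin l.length}
    (hij : (pathPlus l.length).Adj i j) : C l[i] l[j] = c := by
  wlog hlt : i < j generalizing i j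
  · rw [C.symm]
    exact this hij.symm (lt_of_le_of_ne (not_lt.mp hlt) hij.ne.symm)
  obtain ⟨i, hi⟩ := i
  obtain ⟨j, hj⟩ := j
  obtain rfl | ⟨rfl, rfl⟩ : j = i + 1 ∨ i = 0 ∧ j = 2 := by
    simp only [pathPlus_adj, Fin.mk_lt_mk] at hij hlt
    omega
  · exact List.isChain_iff_getElem.mp h.1.isChain i hj
  · obtain ⟨-, x, y, z, l', rfl, hxz⟩ := h
    exact hxz

theorem IsTailedTriangle.take (h : C.IsTailedTriangle c A l) (hn : 3 ≤ n) :
    C.IsTailedTriangle c A (l.take n) := by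
  obtain ⟨n, rfl⟩ := Nat.exists_eq_add_of_le' hn
  obtain ⟨hp, x, y, z, l', rfl, hxz⟩ := h
  exact ⟨hp.infix (List.take_prefix _ _).isInfix, x, y, z, l'.take n, rfl, hxz⟩

theorem hasMonochromaticCopy_toLabeling_iff [Fintype V] (ht : 3 ≤ t) :
    HasMonochromaticCopy C.toLabeling (pathPlus t) ↔
      ∃ c, C.HasTailedTriangle c Finset.univ t := by
  refine exists_congr fun c => ⟨?_, ?_⟩
  · rintro ⟨f⟩
    exact ⟨List.ofFn f, isTailedTriangle_ofFn ht f.injective (fun _ => Finset.mem_univ _)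
      fun i j hij => (labelGraph_toLabeling_adj.mp (f.toHom.map_adj hij)).2,
      (List.length_ofFn).ge⟩
  · rintro ⟨l, hl, hlt⟩
    obtain ⟨l, hl, rfl⟩ : ∃ l, C.IsTailedTriangle c Finset.univ l ∧ l.length = t :=
      ⟨_, hl.take ht, by rw [List.length_take, min_eq_left hlt]⟩
    have hinj : Function.Injective fun i : Fin l.length => l[i] :=
      List.nodup_iff_injective_get.mp hl.1.nodup
    exact ⟨⟨⟨fun i => l[i], fun hij => labelGraph_toLabeling_adj.mpr
      ⟨hinj.ne hij.ne, hl.color_eq_of_adj hij⟩⟩, hinj⟩⟩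

theorem injOn_edgeSet_top_iff {F : Sym2 (Fin 3) → κ} :
    Set.InjOn F (⊤ : SimpleGraph (Fin 3)).edgeSet ↔
      ¬ (F s(0, 1) = F s(1, 2) ∨ F s(0, 1) = F s(0, 2) ∨ F s(1, 2) = F s(0, 2)) := by
  have hedges : (⊤ : SimpleGraph (Fin 3)).edgeSet = {s(0, 1), s(1, 2), s(0, 2)} := by
    ext e
    induction e using Sym2.inductionOn with | _ i j
    fin_cases i <;> fin_cases j <;> simp
  rw [hedges, Set.injOn_insert (by simp), Set.injOn_insert (by simp)]
  simp only [Set.injOn_singleton, Set.image_insert_eq, Set.image_singleton, Set.mem_insert_iff,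
    Set.mem_singleton_iff]
  tauto

theorem injective_toLabeling_mapEdgeSet_iff
    (f : SimpleGraph.Copy (⊤ : SimpleGraph (Fin 3)) (⊤ : SimpleGraph V)) :
    Function.Injective (fun e => C.toLabeling (f.toHom.mapEdgeSet e)) ↔
      ¬ (C (f 0) (f 1) = C (f 1) (f 2) ∨ C (f 0) (f 1) = C (f 0) (f 2) ∨
        C (f 1) (f 2) = C (f 0) (f 2)) := by
  refine Iff.trans ?_ (injOn_edgeSet_top_iff
    (F := Sym2.lift ⟨fun i j => C (f i) (f j), fun i j => C.symm _ _⟩))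
  rw [Set.injOn_iff_injective]
  refine iff_of_eq (congrArg _ (funext fun ⟨e, he⟩ => ?_))
  induction e using Sym2.inductionOn with | _ i j
  rfl

theorem hasRainbowCopy_toLabeling_iff [Fintype V] :
    HasRainbowCopy C.toLabeling (⊤ : SimpleGraph (Fin 3)) ↔ ¬ C.NoRainbow Finset.univ := by
  simp only [HasRainbowCopy, injective_toLabeling_mapEdgeSet_iff]
  constructor
  · rintro ⟨f, hf⟩ hG
    exact hf (hG _ (Finset.mem_univ _) _ (Finset.mem_univ _) _ (Finset.mem_univ _)
      (f.injective.ne (by decide)) (f.injective.ne (by decide)) (f.injective.ne (by decide)))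
  · intro h
    simp only [NoRainbow, not_forall] at h
    obtain ⟨x, -, y, -, z, -, hxy, hyz, hxz, hne⟩ := h
    have hinj : Function.Injective ![x, y, z] := by
      intro i j
      fin_cases i <;> fin_cases j <;> simp [hxy, hyz, hxz, hxy.symm, hyz.symm, hxz.symm]
    exact ⟨⟨⟨![x, y, z], fun hij => hinj.ne hij⟩, hinj⟩, hne⟩

theorem isAdmissible_univ_iff [Fintype V] [Fintype κ] (ht : 3 ≤ t) :
    C.IsAdmissible Finset.univ Finset.univ t ↔
      ¬ (HasRainbowCopy C.toLabeling (⊤ : SimpleGraph (Fin 3)) ∨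
        HasMonochromaticCopy C.toLabeling (pathPlus t)) := by
  rw [hasRainbowCopy_toLabeling_iff, hasMonochromaticCopy_toLabeling_iff ht, not_or, not_not,
    not_exists]
  exact ⟨fun h => ⟨h.noRainbow, h.free⟩, fun h => ⟨fun _ _ _ _ _ => Finset.mem_univ _, h.1, h.2⟩⟩

theorem isGallaiRamseyNumber_pathPlus (hu : 3 ≤ u) (k : ℕ) :
    IsGallaiRamseyNumber (k + 1) (⊤ : SimpleGraph (Fin 3)) (pathPlus (u + 1))
      (maxOrder u (k + 1) + 1) := by
  constructor
  · intro L
    by_contra hL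
    obtain ⟨C, rfl⟩ := exists_toLabeling_eq L
    simpa using ((isAdmissible_univ_iff (by omega)).mpr hL).card_le_maxOrder hu
  · intro n hn
    by_contra! hlt
    obtain ⟨V, κ, _, _, D, hV, hκ, hD⟩ := exists_isAdmissible (Nat.le_of_succ_le hu) k
    obtain ⟨f⟩ : Nonempty (Fin n ↪ V) :=
      Function.Embedding.nonempty_of_card_le (by rw [Fintype.card_fin]; omega)
    have hC := hD.comap (A := Finset.univ) (f := f) (fun _ _ => Finset.mem_univ _)
      (Fintype.equivFinOfCardEq hκ)
    rw [Finset.map_univ_equiv] at hC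
    exact (isAdmissible_univ_iff (by omega)).mp hC (hn _)

theorem maxOrder_succ_eq (u k : ℕ) : maxOrder u (k + 1) =
    if Even (k + 1) then 2 * u * 5 ^ ((k + 1 - 2) / 2) else u * 5 ^ ((k + 1 - 1) / 2) := by
  induction k using Nat.twoStepInduction with
  | zero => simp [maxOrder]
  | one => simp [maxOrder]
  | more k ih _ =>
    have heven : Even (k + 2 + 1) ↔ Even (k + 1) := by
      rw [add_right_comm, Nat.even_add]
      simp
    simp only [maxOrder, ih, heven]
    split_ifs with hk
    · obtain ⟨a, ha⟩ := hk
      rw [show (k + 2 + 1 - 2) / 2 = (k + 1 - 2) / 2 + 1 by omega, pow_succ]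
      ring
    · rw [show (k + 2 + 1 - 1) / 2 = (k + 1 - 1) / 2 + 1 by omega, pow_succ]
      ring

end Labelings

end PairColoring

theorem mainTheorem2 (t k : ℕ) (ht : 4 ≤ t) (hk : 1 ≤ k) :
    IsGallaiRamseyNumber k (⊤ : SimpleGraph (Fin 3)) (pathPlus t)
      (if Even k then 2 * (t - 1) * 5 ^ ((k - 2) / 2) + 1
        else (t - 1) * 5 ^ ((k - 1) / 2) + 1) := by
  obtain ⟨u, rfl⟩ := Nat.exists_eq_add_of_le' (show 1 ≤ t by omega)
  obtain ⟨k, rfl⟩ := Nat.exists_eq_add_of_le' hk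
  rw [← apply_ite (· + 1), Nat.add_sub_cancel u 1, ← PairColoring.maxOrder_succ_eq u k]
  exact PairColoring.isGallaiRamseyNumber_pathPlus (by omega) k
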